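/- **Setting.** Let $\mathcal X$ be a measurable space, $\mathcal A$ a finite set of $A\ge 1$ actions, $H,K\ge 1$, and consider a Markov decision process with transition kernels $P_h:\mathcal X\times\mathcal A\to\Delta(\mathcal X)$ and cost kernels $C_h:\mathcal X\times\mathcal A\to\Delta([0,1])$, $h\in[H]$, such that under every policy and from every initial state the cumulative cost lies in $[0,1]$ almost surely. A policy $\pi=(\pi_h)_h$ consists of kernels $\pi_h:\mathcal X\to\Delta(\mathcal A)$. From $x_1$ it generates $a_h\sim\pi_h(x_h)$, $c_h\sim C_h(x_h,a_h)$, $x_{h+1}\sim P_h(x_h,a_h)$, with $c_h$ and $x_{h+1}$ independent given $(x_h,a_h)$. Put $Z^\pi(x_1)=\sum_{h=1}^H c_h$, $V^\pi(x_1)=\mathbb E[Z^\pi(x_1)]$, $V^\star(x_1)=\inf_\pi V^\pi(x_1)$, and let $d^{\pi,x_1}_h$ be the law of $(x_h,a_h)$. Let $\lambda$ be a $\sigma$-finite measure concentrated on $[0,1]$, and let $\mathcal F=\mathcal F_1\times\dots\times\mathcal F_H$ where each $\mathcal F_h$ is a finite nonempty set of conditional probability densities $f_h(\cdot\mid x,a)$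 with respect to $\lambda$; put $f_{H+1}=\delta_0$ and $\mathcal F_{H+1}=\{\delta_0\}$. A bar denotes the mean of a distribution. Fix a measurable tie-breaking rule for $\operatorname{argmin}$ over $\mathcal A$. For a conditional distribution $d$, $\mathcal T^{\pi,D}_h d(x,a)$ is the law of $c+y$, where $c\sim C_h(x,a)$ and, independently, $x'\sim P_h(x,a)$, $a'\sim\pi_{h+1}(x')$, $y\sim d(x',a')$; $\mathcal T^{\star,D}_h d$ is the same with $a'=\operatorname{argmin}_a\bar d(x',a)$. Let $D_\triangle(p\,\|\,q)=\int\frac{(p-q)^2}{p+q}\,d\lambda$. Let $\Pi$ be a set of policies that contains the greedy policy $x\mapsto \operatorname{argmin}_a\bar f_h(x,a)$ ($h\in[H]$) of every $f\in\mathcal F$. Assume *distributional Bellman completeness*: $\mathcal T_h^{\pi,D}f_{h+1}\in\mathcal F_h$ for all $\pi\in\Pi$, $h\in[H]$, $f_{h+1}\in\mathcal F_{h+1}$. **Eluder dimension.** For a set $\Psi$ of functions $\mathcal S\to\mathbb R$, a set $\mathfrak D$ of distributions on $\mathcal S$ and $\varepsilon_0>0$, $\dim(\Psi,\mathfrak D,\varepsilon_0)$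 is the supremum of the lengths $L$ of sequences $d^{(1)},\dots,d^{(L)}\in\mathfrak D$ for which there is $\varepsilon\ge\varepsilon_0$ such that for every $t\le L$ some $\psi\in\Psi$ has $|\mathbb E_{d^{(t)}}\psi|>\varepsilon$ and $\sum_{i<t}|\mathbb E_{d^{(i)}}\psi|\le\varepsilon$. With $\psi_{f,h}(x,a)=D_\triangle(f_h(x,a)\,\|\,\mathcal T_h^{\star,D}f_{h+1}(x,a))$, let $$d_{\mathrm{RL}}=\max_h\dim\big(\{\psi_{f,h}:f\in\mathcal F\},\{d_h^{\pi,x_1}:\pi\in\Pi,x_1\in\mathcal X\},\tfrac1K\big),$$ and let $d_{\mathrm{RL,V}}$ be the same with the functions $x\mapsto\frac1A\sum_a\psi_{f,h}(x,a)$ and the laws of $x_h$ under $\pi$ from $x_1$, $\pi\in\Pi$, $x_1\in\mathcal X$. **Algorithm (O-DISCO).** Let $\delta\in(0,1)$ and $\beta=\log(HK|\mathcal F|/\delta)$. In episode $k=1,\dots,K$ an adaptive adversary reveals $x_{1,k}$. Let $\mathcal F_{k-1}$ be the set of $f\in\mathcal F$ such that for all $h$ and all $g\in\mathcal F_h$,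 $\sum_{i<k}\log f_h(z^f_{h,i}\mid x_{h,i},a_{h,i})\ge\sum_{i<k}\log g(z^f_{h,i}\mid x_{h,i},a_{h,i})-\beta$ (with $\log 0=-\infty$). The learner chooses $f^{(k)}\in\operatorname{argmin}_{f\in\mathcal F_{k-1}}\min_a\bar f_1(x_{1,k},a)$ (any $f^{(k)}\in\mathcal F$ if $\mathcal F_{k-1}$ is empty) and lets $\pi^k$ be the greedy policy of $f^{(k)}$. Without uniform action exploration (UAE), it runs $\pi^k$ from $x_{1,k}$ and records the transitions $(x_{h,k},a_{h,k},c_{h,k},x'_{h,k})$, $h\in[H]$, of the trajectory. With UAE, for each $h$ it makes a separate rollout of $\pi^k$ from $x_{1,k}$ up to $x_{h,k}$, draws $a_{h,k}$ uniformly from $\mathcal A$, and records $c_{h,k}\sim C_h(x_{h,k},a_{h,k})$, $x'_{h,k}\sim P_h(x_{h,k},a_{h,k})$. For $f\in\mathcal F$ it sets $z^f_{h,k}=c_{h,k}+y$ with $y\sim f_{h+1}(x'_{h,k},a')$, $a'=\operatorname{argmin}_a\bar f_{h+1}(x'_{h,k},a)$. The output $\bar\pi$ draws $k\in[K]$ uniformly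 and runs $\pi^k$. **Theorem.** There is a universal constant $c>0$ such that in this setting, with $L=1+\log K$: 1. Without UAE, if $d_{\mathrm{RL}}<\infty$ and $d=\max(1,d_{\mathrm{RL}})$, then with probability at least $1-\delta$, $$\sum_{k=1}^K\big(V^{\pi^k}(x_{1,k})-V^\star(x_{1,k})\big)\le c\Big(H\sqrt{\textstyle\sum_{k=1}^K\operatorname{Var}(Z^{\pi^k}(x_{1,k}))\cdot d\,\beta L}+H^{2.5}d\,\beta L\Big).$$ 2. With UAE, if $d_{\mathrm{RL,V}}<\infty$ and $d=\max(1,d_{\mathrm{RL,V}})$, then with probability at least $1-\delta$, $$\sum_{k=1}^K\big(V^{\pi^k}(x_{1,k})-V^\star(x_{1,k})\big)\le c\Big(H\sqrt{A\textstyle\sum_{k=1}^K\operatorname{Var}(Z^{\pi^k}(x_{1,k}))\cdot d\,\beta L}+A H^{2.5}d\,\beta L\Big),$$ and, if all initial states equal one state $x_1$, $K\big(V^{\bar\pi}(x_1)-V^\star(x_1)\big)$ is at most the same right-hand side. -/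

import Mathlib

open MeasureTheory ProbabilityTheory
open scoped ENNReal NNReal

noncomputable section

namespace DistRL

/-- One observed transition `((x_h, a_h), c_h, x_{h+1})`. -/
abbrev Step (X A : Type*) := (X × A) × ℝ × X

/-- Markov decision process with transition kernels `P_h` and cost distributions `C_h` on `[0,1]`.
Steps are numbered from `0`; with horizon `H` only the steps `h < H` are ever used. -/
structure MDP (X A : Type*) [MeasurableSpace X] [MeasurableSpace A] where
  P : ℕ → Kernel (X × A) X
  C : ℕ → Kernel (X × A) ℝ
  markovP : ∀ h, IsMarkovKernel (P h)
  markovC : ∀ h, IsMarkovKernel (C h)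
  cost_mem : ∀ h xa, ∀ᵐ c ∂(C h xa), c ∈ Set.Icc (0 : ℝ) 1

attribute [instance] MDP.markovP MDP.markovC

/-- A (time-dependent, randomized) Markov policy. -/
structure Policy (X A : Type*) [MeasurableSpace X] [MeasurableSpace A] where
  kern : ℕ → Kernel X A
  markov : ∀ h, IsMarkovKernel (kern h)

attribute [instance] Policy.markov

/-- A fixed tie-breaking rule for `argmin_a q(a)`. -/
structure ArgminRule (A : Type*) [MeasurableSpace A] where
  act : (A → ℝ) → A
  measurable_act : Measurable act
  act_le : ∀ (q : A → ℝ) (a : A), q (act q) ≤ q a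

section Rollout

variable {X A : Type*} [MeasurableSpace X] [MeasurableSpace A]

/-- From state `x`: draw `a ∼ ρ(x)`, then, independently, `c ∼ C_h(x,a)` and `x' ∼ P_h(x,a)`. -/
def MDP.stepKernel (M : MDP X A) (h : ℕ) (ρ : Kernel X A) : Kernel X (Step X A) :=
  (Kernel.id ×ₖ (M.C h ×ₖ M.P h)) ∘ₖ (Kernel.id ×ₖ ρ)

/-- The law of the trajectory of `n` steps obtained by rolling in `π` from a state at step `h`. -/
def MDP.roll (M : MDP X A) (π : Policy X A) :
    (n : ℕ) → ℕ → Kernel X (Fin n → Step X A)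
  | 0, _ => Kernel.const X (Measure.dirac Fin.elim0)
  | n + 1, h =>
      ((M.stepKernel h (π.kern h)) ⊗ₖ
        ((MDP.roll M π n (h + 1)).comap (fun p : X × Step X A => p.2.2.2)
          (measurable_snd.comp (measurable_snd.comp measurable_snd)))).map
        (fun p => Fin.cons (α := fun _ => Step X A) p.1 p.2)

/-- The return `∑_h c_h` of a trajectory. -/
def ret {n : ℕ} (τ : Fin n → Step X A) : ℝ := ∑ i, (τ i).2.1

/-- `V^π(x₁)`. -/
def MDP.value (M : MDP X A) (H : ℕ) (π : Policy X A) (x : X) : ℝ :=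
  ∫ τ, ret τ ∂(M.roll π H 0 x)

/-- `Var(Z^π(x₁))`. -/
def MDP.returnVar (M : MDP X A) (H : ℕ) (π : Policy X A) (x : X) : ℝ :=
  variance ret (M.roll π H 0 x)

/-- `V^⋆(x₁)`. -/
def MDP.optValue (M : MDP X A) (H : ℕ) (x : X) : ℝ :=
  ⨅ π : Policy X A, M.value H π x

/-- `V^{π̄}(x₁)` for the mixture policy that draws `k` uniformly among `0, …, K-1` and runs `π^k`. -/
def MDP.mixtureValue (M : MDP X A) (H K : ℕ) (π : ℕ → Policy X A) (x : X) : ℝ :=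
  ∫ τ, ret τ ∂((K : ℝ≥0∞)⁻¹ • ∑ k ∈ Finset.range K, M.roll (π k) H 0 x)

/-- Cumulative costs lie in `[0,1]` almost surely. -/
def MDP.Normalized (M : MDP X A) (H : ℕ) : Prop :=
  ∀ (π : Policy X A) (x : X), ∀ᵐ τ ∂(M.roll π H 0 x), ret τ ∈ Set.Icc (0 : ℝ) 1

/-- The state-action distribution `d^π_h` when starting from `x₁`. -/
def MDP.occ (M : MDP X A) {H : ℕ} (π : Policy X A) (h : Fin H) : Kernel X (X × A) :=
  (M.roll π H 0).map (fun τ => (τ h).1)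

/-- The state distribution `d^π_h` when starting from `x₁`. -/
def MDP.stateOcc (M : MDP X A) {H : ℕ} (π : Policy X A) (h : Fin H) : Kernel X X :=
  (M.roll π H 0).map (fun τ => (τ h).1.1)

/-- Roll in `π` up to step `h`, then take a uniformly random action. -/
def MDP.uaeKernel (M : MDP X A) [Fintype A] [Nonempty A] {H : ℕ} (π : Policy X A) (h : Fin H) :
    Kernel X (Step X A) :=
  (M.stepKernel h.val (Kernel.const X (PMF.uniformOfFintype A).toMeasure)) ∘ₖ (M.stateOcc π h)

/-- The law of the data of one episode: a trajectory of `π` from `x` without uniform action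
exploration; one separate rollout for each step with it. -/
def MDP.episodeLaw (M : MDP X A) [Fintype A] [Nonempty A] (H : ℕ) (uae : Bool)
    (π : Policy X A) (x : X) : Measure (Fin H → Step X A) :=
  if uae then Measure.pi (fun h => M.uaeKernel π h x) else M.roll π H 0 x

lemma measurable_cons (n : ℕ) :
    Measurable (fun p : Step X A × (Fin n → Step X A) =>
      (Fin.cons (α := fun _ => Step X A) p.1 p.2 : Fin (n + 1) → Step X A)) := by
  refine measurable_pi_iff.2 fun i => ?_
  refine Fin.cases ?_ (fun j => ?_) i
  · simpa using measurable_fst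
  · simp only [Fin.cons_succ]; fun_prop

instance (M : MDP X A) (h : ℕ) (ρ : Kernel X A) [IsMarkovKernel ρ] :
    IsMarkovKernel (M.stepKernel h ρ) := by
  unfold MDP.stepKernel; infer_instance

instance MDP.isMarkovKernel_roll (M : MDP X A) (π : Policy X A) (n : ℕ) :
    ∀ h, IsMarkovKernel (M.roll π n h) := by
  induction n with
  | zero => intro h; unfold MDP.roll; infer_instance
  | succ n ih =>
      intro h
      have := ih (h + 1)
      unfold MDP.roll
      exact Kernel.IsMarkovKernel.map _ (measurable_cons n)

end Rollout

/-- A conditional distribution `X × A → Δ([0,1])`, given by its density with respect to the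
dominating measure `lam`. -/
structure CondDens (X A : Type*) [MeasurableSpace X] [MeasurableSpace A] (lam : Measure ℝ) where
  dens : X × A → ℝ → ℝ≥0
  measurable_dens : Measurable (Function.uncurry dens)
  lintegral_eq_one : ∀ xa, ∫⁻ y, (dens xa y : ℝ≥0∞) ∂lam = 1

section Bellman

variable {X A : Type*} [MeasurableSpace X] [MeasurableSpace A]

/-- The conditional distribution itself, as a kernel. -/
def CondDens.law {lam : Measure ℝ} [SFinite lam] (f : CondDens X A lam) : Kernel (X × A) ℝ :=
  Kernel.withDensity (Kernel.const (X × A) lam) (fun xa y => (f.dens xa y : ℝ≥0∞))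

/-- The mean `d̄(x,a)`. -/
def mean (d : Kernel (X × A) ℝ) (x : X) (a : A) : ℝ := ∫ y, y ∂(d (x, a))

lemma measurable_mean (d : Kernel (X × A) ℝ) : Measurable (fun x a => mean d x a) := by
  have h : Measurable (fun xa => ∫ y, y ∂(d xa)) :=
    (StronglyMeasurable.integral_kernel (κ := d) (f := fun y : ℝ => y)
      stronglyMeasurable_id).measurable
  exact measurable_pi_iff.2 fun a => h.comp (measurable_id.prodMk measurable_const)

/-- `argmin_a d̄(x,a)`. -/
def greedyAct (am : ArgminRule A) (d : Kernel (X × A) ℝ) (x : X) : A := am.act (mean d x)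

/-- The deterministic kernel `x ↦ argmin_a d̄(x,a)`. -/
def greedyKernel (am : ArgminRule A) (d : Kernel (X × A) ℝ) : Kernel X A :=
  Kernel.deterministic (greedyAct am d) (am.measurable_act.comp (measurable_mean d))

instance (am : ArgminRule A) (d : Kernel (X × A) ℝ) : IsMarkovKernel (greedyKernel am d) :=
  Kernel.isMarkovKernel_deterministic _

/-- The law of `c + y` where `c ∼ C_h(x,a)`, `x' ∼ P_h(x,a)`, `a' ∼ ρ(x')`, `y ∼ d(x',a')`. -/
def MDP.bellman (M : MDP X A) (h : ℕ) (ρ : Kernel X A) (d : Kernel (X × A) ℝ) :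
    Kernel (X × A) ℝ :=
  (M.C h ×ₖ (d ∘ₖ ((Kernel.id ×ₖ ρ) ∘ₖ M.P h))).map (fun p : ℝ × ℝ => p.1 + p.2)

/-- The distributional Bellman operator `T_h^{π,D}`. -/
def MDP.bellmanPolicy (M : MDP X A) (π : Policy X A) (h : ℕ) (d : Kernel (X × A) ℝ) :
    Kernel (X × A) ℝ :=
  M.bellman h (π.kern (h + 1)) d

/-- The distributional Bellman optimality operator `T_h^{⋆,D}`. -/
def MDP.bellmanOpt (M : MDP X A) (am : ArgminRule A) (h : ℕ) (d : Kernel (X × A) ℝ) :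
    Kernel (X × A) ℝ :=
  M.bellman h (greedyKernel am d) d

/-- Triangular discrimination of two distributions with densities with respect to `lam`. -/
def triDisc (lam μ ν : Measure ℝ) : ℝ :=
  ∫ y, ((μ.rnDeriv lam y).toReal - (ν.rnDeriv lam y).toReal) ^ 2 /
    ((μ.rnDeriv lam y).toReal + (ν.rnDeriv lam y).toReal) ∂lam

variable {lam : Measure ℝ} [SFinite lam] {H : ℕ}

/-- `f_n` as a kernel, with the terminal convention `f_H = δ_0` (steps are `0, …, H-1`). -/
def lawAt (f : Fin H → CondDens X A lam) (n : ℕ) : Kernel (X × A) ℝ :=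
  if hn : n < H then (f ⟨n, hn⟩).law else Kernel.const (X × A) (Measure.dirac 0)

/-- The greedy policy `π_h(x) = argmin_a f̄_h(x,a)`. -/
def greedyPolicy (am : ArgminRule A) (f : Fin H → CondDens X A lam) : Policy X A where
  kern h := greedyKernel am (lawAt f h)
  markov _ := inferInstance

/-- The product class `F = F_0 × ⋯ × F_{H-1}`. -/
def tuples (F : Fin H → Finset (CondDens X A lam)) : Set (Fin H → CondDens X A lam) :=
  {f | ∀ h, f h ∈ F h}

/-- The class `F_n` as a set of kernels, with `F_H = {δ_0}`. -/
def lawClass (F : Fin H → Finset (CondDens X A lam)) (n : ℕ) : Set (Kernel (X × A) ℝ) :=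
  if hn : n < H then {d | ∃ g ∈ F ⟨n, hn⟩, d = g.law}
  else {Kernel.const (X × A) (Measure.dirac 0)}

/-- Distributional Bellman completeness over the policy class `Pol`. -/
def BellmanComplete (M : MDP X A) (Pol : Set (Policy X A))
    (F : Fin H → Finset (CondDens X A lam)) : Prop :=
  ∀ π ∈ Pol, ∀ h < H, ∀ d ∈ lawClass F (h + 1), M.bellmanPolicy π h d ∈ lawClass F h

end Bellman

/-- The `ℓ₁`-distributional eluder dimension. -/
def eluderDim {S : Type*} [MeasurableSpace S] (Ψ : Set (S → ℝ)) (𝔇 : Set (Measure S)) (ε₀ : ℝ) :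
    ℕ∞ :=
  sSup {n : ℕ∞ | ∃ L : ℕ, n = L ∧ ∃ d : Fin L → Measure S, (∀ t, d t ∈ 𝔇) ∧
    ∃ ε : ℝ, ε₀ ≤ ε ∧ ∀ t, ∃ f ∈ Ψ, ε < |∫ s, f s ∂(d t)| ∧
      ∑ i ∈ Finset.univ.filter (· < t), |∫ s, f s ∂(d i)| ≤ ε}

section Dimension

variable {X A : Type*} [MeasurableSpace X] [MeasurableSpace A] {lam : Measure ℝ} [SFinite lam]
  {H : ℕ}

/-- `D_△(f_h(x,a) ‖ T_h^{⋆,D} f_{h+1}(x,a))`. -/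
def bellmanError (M : MDP X A) (am : ArgminRule A) (f : Fin H → CondDens X A lam) (h : Fin H)
    (xa : X × A) : ℝ :=
  triDisc lam (lawAt f h.val xa) (M.bellmanOpt am h.val (lawAt f (h.val + 1)) xa)

/-- The Q-type dimension `d_RL(ε)`. -/
def dimQ (M : MDP X A) (am : ArgminRule A) (Pol : Set (Policy X A))
    (F : Fin H → Finset (CondDens X A lam)) (ε : ℝ) : ℕ∞ :=
  ⨆ h : Fin H, eluderDim {ψ | ∃ f ∈ tuples F, ψ = bellmanError M am f h}
    {μ | ∃ π ∈ Pol, ∃ x₁ : X, μ = M.occ π h x₁} ε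

/-- The V-type dimension `d_{RL,V}(ε)`. -/
def dimV [Fintype A] (M : MDP X A) (am : ArgminRule A) (Pol : Set (Policy X A))
    (F : Fin H → Finset (CondDens X A lam)) (ε : ℝ) : ℕ∞ :=
  ⨆ h : Fin H, eluderDim
    {ψ | ∃ f ∈ tuples F,
      ψ = fun x => (∑ a : A, bellmanError M am f h (x, a)) / (Fintype.card A : ℝ)}
    {μ | ∃ π ∈ Pol, ∃ x₁ : X, μ = M.stateOcc π h x₁} ε

end Dimension

/-- Conditionally on the `σ`-algebra `m`, the random element `Y` has law `κ ω`. -/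
def HasCondLaw {Ω E : Type*} [MeasurableSpace Ω] [MeasurableSpace E] (Pr : Measure Ω)
    (m : MeasurableSpace Ω) (Y : Ω → E) (κ : Ω → Measure E) : Prop :=
  ∀ S : Set E, MeasurableSet S → ∀ G : Set Ω, MeasurableSet[m] G →
    Pr (G ∩ Y ⁻¹' S) = ∫⁻ ω in G, κ ω S ∂Pr

section Algorithm

variable {X A : Type*} [MeasurableSpace X] [MeasurableSpace A] {lam : Measure ℝ} [SFinite lam]
  {H : ℕ}

/-- Log-likelihood of `g` at step `h` on the first `k` episodes, with the targets
`z^f_{h,i} = c_{h,i} + y^f_{h,i}`. The logarithm is extended by `log 0 = -∞`. -/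
def logLik (data : ℕ → Fin H → Step X A) (y : ℕ → Fin H → (Fin H → CondDens X A lam) → ℝ)
    (k : ℕ) (h : Fin H) (f : Fin H → CondDens X A lam) (g : CondDens X A lam) : EReal :=
  ∑ i ∈ Finset.range k,
    ENNReal.log (g.dens (data i h).1 ((data i h).2.1 + y i h f) : ℝ≥0∞)

/-- The confidence set after `k` episodes. -/
def confSet (F : Fin H → Finset (CondDens X A lam)) (β : ℝ) (data : ℕ → Fin H → Step X A)
    (y : ℕ → Fin H → (Fin H → CondDens X A lam) → ℝ) (k : ℕ) :
    Set (Fin H → CondDens X A lam) :=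
  {f | f ∈ tuples F ∧ ∀ h, ∀ g ∈ F h,
    logLik data y k h f g - (β : EReal) ≤ logLik data y k h f (f h)}

/-- `min_a f̄_1(x,a)`. -/
def optimisticValue (f : Fin H → CondDens X A lam) (x : X) : ℝ := ⨅ a : A, mean (lawAt f 0) x a

/-- A run of O-DISCO over `K` episodes (numbered `0, …, K-1`) against an adaptive adversary.
`𝒢 k` is the information available just before the rollouts of episode `k`. -/
structure ODiscoRun [Fintype A] [Nonempty A] {Ω : Type*} [mΩ : MeasurableSpace Ω]
    (Pr : Measure Ω) (M : MDP X A) (am : ArgminRule A) (F : Fin H → Finset (CondDens X A lam))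
    (β : ℝ) (K : ℕ) (uae : Bool) where
  𝒢 : Filtration ℕ mΩ
  /-- the initial state of episode `k`, chosen by the adversary -/
  x₁ : ℕ → Ω → X
  /-- the selected tuple `f^{(k)}` -/
  sel : ℕ → Ω → (Fin H → CondDens X A lam)
  /-- the transitions `((x_{h,k}, a_{h,k}), c_{h,k}, x'_{h,k})` -/
  data : ℕ → Ω → Fin H → Step X A
  /-- the sampled next-step values `y^f_{h,k}` -/
  y : ℕ → Ω → Fin H → (Fin H → CondDens X A lam) → ℝ
  measurable_x₁ : ∀ k < K, Measurable[𝒢 k] (x₁ k)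
  measurable_sel : ∀ k < K, ∀ f, MeasurableSet[𝒢 k] {ω | sel k ω = f}
  measurable_data : ∀ k < K, Measurable[𝒢 (k + 1)] (data k)
  measurable_y : ∀ k < K, ∀ h, ∀ f ∈ tuples F, Measurable[𝒢 (k + 1)] (fun ω => y k ω h f)
  sel_mem : ∀ k < K, ∀ ω, sel k ω ∈ tuples F
  /-- optimism: `f^{(k)}` minimizes `min_a f̄_1(x_{1,k},a)` over the confidence set of the data of
  the previous episodes (the choice is free should that set be empty) -/
  sel_optimistic : ∀ k < K, ∀ ω,
    (confSet F β (fun i => data i ω) (fun i => y i ω) k).Nonempty →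
    sel k ω ∈ confSet F β (fun i => data i ω) (fun i => y i ω) k ∧
    ∀ g ∈ confSet F β (fun i => data i ω) (fun i => y i ω) k,
      optimisticValue (sel k ω) (x₁ k ω) ≤ optimisticValue g (x₁ k ω)
  /-- the transitions are collected by rolling in the greedy policy of `f^{(k)}` from `x_{1,k}` -/
  data_law : ∀ k < K, HasCondLaw Pr (𝒢 k) (data k)
    (fun ω => M.episodeLaw H uae (greedyPolicy am (sel k ω)) (x₁ k ω))
  /-- given the past and the transitions of episode `k`, `y^f_{h,k} ∼ f_{h+1}(x', a')` with
  `x' = x'_{h,k}` and `a' = argmin_a f̄_{h+1}(x', a)` (any coupling of the draws over `h, f`) -/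
  y_law : ∀ k < K, ∀ h : Fin H, ∀ f ∈ tuples F,
    HasCondLaw Pr (𝒢 k ⊔ MeasurableSpace.comap (data k) inferInstance) (fun ω => y k ω h f)
      (fun ω => lawAt f (h.val + 1)
        ((data k ω h).2.2, greedyAct am (lawAt f (h.val + 1)) (data k ω h).2.2))

variable [Fintype A] [Nonempty A] {Ω : Type*} [MeasurableSpace Ω] {Pr : Measure Ω} {M : MDP X A}
  {am : ArgminRule A} {F : Fin H → Finset (CondDens X A lam)} {β : ℝ} {K : ℕ} {uae : Bool}

/-- The policy `π^k` of episode `k`. -/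
def ODiscoRun.pol (R : ODiscoRun Pr M am F β K uae) (k : ℕ) (ω : Ω) : Policy X A :=
  greedyPolicy am (R.sel k ω)

/-- `∑_k (V^{π^k}(x_{1,k}) - V^⋆(x_{1,k}))`. -/
def ODiscoRun.regret (R : ODiscoRun Pr M am F β K uae) (ω : Ω) : ℝ :=
  ∑ k ∈ Finset.range K,
    (M.value H (R.pol k ω) (R.x₁ k ω) - M.optValue H (R.x₁ k ω))

/-- `∑_k Var(Z^{π^k}(x_{1,k}))`. -/
def ODiscoRun.sumVar (R : ODiscoRun Pr M am F β K uae) (ω : Ω) : ℝ :=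
  ∑ k ∈ Finset.range K, M.returnVar H (R.pol k ω) (R.x₁ k ω)

end Algorithm

/-- `β = log(H K |F| / δ)`. -/
def threshold {X A : Type*} [MeasurableSpace X] [MeasurableSpace A] {lam : Measure ℝ} {H : ℕ}
    (F : Fin H → Finset (CondDens X A lam)) (K : ℕ) (δ : ℝ) : ℝ :=
  Real.log ((H : ℝ) * K * ((∏ h, (F h).card : ℕ) : ℝ) / δ)

/-- `H √(a · V · D · β · L) + a · H^{5/2} · D · β · L`. -/
def secondOrderBound (H : ℕ) (a V D β L : ℝ) : ℝ :=
  (H : ℝ) * √(a * V * D * β * L) + a * (H : ℝ) ^ (5 / 2 : ℝ) * D * β * L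

end DistRL

end

universe u v w

open DistRL

noncomputable section

/-! The proof combines optimism, likelihood confidence sets and a change of variance, all measured
by triangular discrimination.

Write D for the triangular discrimination between `f_h` and its Bellman image `T^{⋆,D} f_{h+1}`.
Completeness, applied to greedy policies, puts this image in the class, so it has a density `g_h`.
Backward induction over the product class even gives a tuple `fs` that is its own image
(`exists_fixedPoint`). Its predicted value `min_a` of the mean at the first step is at most the
optimal value, since all its one-step residuals are nonnegative under any policy
(`potential_le_optValue`).

Statistics: given the past, the targets of `f` at step h have density `g_h`. The likelihood ratio
`q/g_h` therefore has conditional mean at most 1, and `√(f_h/g_h)` has conditional mean at most `1 -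
D/4` averaged over the exploration law. Markov's inequality for the two resulting supermartingales
and a union bound show that, off an event of probability δ, `fs` lies in every confidence set and
each member of a confidence set has accumulated past error at most `10β` (`exists_good_event`). The
eluder dimension turns small error on the past into small total error E of the selected tuples
(`sum_le_of_eluderDim`). Under uniform exploration the greedy action's error is at most A times the
action average, which gives the factor A.

Second-order gap: the value of the greedy policy of `f` minus its prediction is the expected sum
over h of mean(`g_h`) - mean(`f_h`) along its rollout. A weighted Cauchy-Schwarz inequality bounds
each term by `2s Var(f_h) + D/s` for every s in (0,1] (`mean_sub_le`). The predicted variances are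
exchanged for the variance of the return: replacing `f_h` by `g_h` costs a factor `1 + 1/H` and `2H
D`, and the law of total variance splits Var(`g_h`) into a one-step variance plus the expected
Var(`f_{h+1}`). Unrolling costs a factor at most 3, and a martingale decomposition of the return
controls the sum of the one-step variances. Hence the sum of Var(`f_h`) is at most `6H Var(Z) + 18H²
E` (`sum_varAt_le`).

By optimism the regret is at most the sum of these gaps. One common s is optimised at the end,
giving `H√(V·aDβL)` plus `H² aDβL`, and `H² ≤ H^{5/2}`. -/

namespace DistRL

/-! ### Triangular discrimination: control of means, variances and Hellinger affinity. -/

section Densities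

/-- The triangular discrimination of two densities. -/
def triDens (lam : Measure ℝ) (p q : ℝ → ℝ≥0) : ℝ :=
  ∫ y, ((p y : ℝ) - q y) ^ 2 / ((p y : ℝ) + q y) ∂lam

/-- `p` is a probability density with respect to `lam`. -/
structure IsDensity (lam : Measure ℝ) (p : ℝ → ℝ≥0) : Prop where
  measurable : Measurable p
  lintegral_eq_one : ∫⁻ y, (p y : ℝ≥0∞) ∂lam = 1

variable {lam : Measure ℝ} {p q : ℝ → ℝ≥0}

lemma integrable_of_lintegral_eq_one (hp : IsDensity lam p) :
    Integrable (fun y => (p y : ℝ)) lam := by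
  have := hp.measurable
  refine ⟨by fun_prop, ?_⟩
  rw [hasFiniteIntegral_iff_enorm]
  have : ∀ y, ‖(p y : ℝ)‖ₑ = p y := fun y => by simp
  simp [this, hp.lintegral_eq_one]

lemma integral_eq_one_of_lintegral (hp : IsDensity lam p) : ∫ y, (p y : ℝ) ∂lam = 1 := by
  have := hp.measurable
  rw [integral_eq_lintegral_of_nonneg_ae (Filter.Eventually.of_forall fun y => by positivity)
    (by fun_prop)]
  simp [hp.lintegral_eq_one]

lemma sub_sq_div_add_le (a b : ℝ≥0) : ((a : ℝ) - b) ^ 2 / ((a : ℝ) + b) ≤ (a : ℝ) + b := by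
  refine div_le_of_le_mul₀ (by positivity) (by positivity) ?_
  nlinarith [mul_nonneg a.2 b.2, NNReal.coe_nonneg a, NNReal.coe_nonneg b]

lemma integrable_triDens (hp : IsDensity lam p) (hq : IsDensity lam q) :
    Integrable (fun y => ((p y : ℝ) - q y) ^ 2 / ((p y : ℝ) + q y)) lam := by
  have h1 := hp.measurable
  have h2 := hq.measurable
  refine Integrable.mono' ((integrable_of_lintegral_eq_one hp).add
    (integrable_of_lintegral_eq_one hq))
    (Measurable.div (by fun_prop) (by fun_prop)).aestronglyMeasurable
    (Filter.Eventually.of_forall fun y => ?_)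
  rw [Real.norm_of_nonneg (by positivity)]
  exact sub_sq_div_add_le _ _

lemma triDens_nonneg : 0 ≤ triDens lam p q :=
  integral_nonneg fun y => by positivity

lemma triDens_le_two (hp : IsDensity lam p) (hq : IsDensity lam q) :
    triDens lam p q ≤ 2 := by
  have ip := integrable_of_lintegral_eq_one hp
  have iq := integrable_of_lintegral_eq_one hq
  calc triDens lam p q ≤ ∫ y, ((p y : ℝ) + q y) ∂lam :=
        integral_mono (integrable_triDens hp hq) (ip.add iq)
          fun y => sub_sq_div_add_le _ _
    _ = 2 := by
        rw [integral_add ip iq, integral_eq_one_of_lintegral hp,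
          integral_eq_one_of_lintegral hq]; norm_num

lemma two_mul_mul_sub_le (φ : ℝ) (a b : ℝ≥0) {s : ℝ} (hs : 0 < s) :
    2 * (φ * ((a : ℝ) - b)) ≤
      s * (φ ^ 2 * ((a : ℝ) + b)) + ((a : ℝ) - b) ^ 2 / ((a : ℝ) + b) / s := by
  -- At a = b = 0 the quotient is 0 by convention; otherwise the difference of the two sides is a
  -- perfect square over a positive denominator.
  rcases eq_or_lt_of_le (add_nonneg a.2 b.2 : (0 : ℝ) ≤ a + b) with h | h
  · have ha : (a : ℝ) = 0 := le_antisymm (by linarith [b.2, h]) a.2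
    have hb : (b : ℝ) = 0 := le_antisymm (by linarith [a.2, h]) b.2
    simp [ha, hb]
  · have key : 0 ≤ (s * φ * ((a : ℝ) + b) - (a - b)) ^ 2 / (((a : ℝ) + b) * s) := by positivity
    have h' : (a : ℝ) + b ≠ 0 := h.ne'
    have e : (s * φ * ((a : ℝ) + b) - (a - b)) ^ 2 / (((a : ℝ) + b) * s) =
      s * (φ ^ 2 * ((a : ℝ) + b)) + ((a : ℝ) - b) ^ 2 / ((a : ℝ) + b) / s
        - 2 * (φ * ((a : ℝ) - b)) := by
      field_simp
      ring
    linarith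

/-- Weighted arithmetic-geometric form of the Cauchy-Schwarz inequality for `D_△`. -/
lemma two_mul_integral_sub_le (hp : IsDensity lam p) (hq : IsDensity lam q)
    {φ : ℝ → ℝ} (h1 : Integrable (fun y => φ y * ((p y : ℝ) - q y)) lam)
    (h2 : Integrable (fun y => φ y ^ 2 * ((p y : ℝ) + q y)) lam) {s : ℝ} (hs : 0 < s) :
    2 * ∫ y, φ y * ((p y : ℝ) - q y) ∂lam ≤
      s * ∫ y, φ y ^ 2 * ((p y : ℝ) + q y) ∂lam + triDens lam p q / s := by
  have h3 := integrable_triDens hp hq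
  rw [triDens, ← integral_const_mul, ← integral_const_mul, ← integral_div,
    ← integral_add (h2.const_mul s) (h3.div_const s)]
  exact integral_mono (h1.const_mul 2) ((h2.const_mul s).add (h3.div_const s))
    fun y => two_mul_mul_sub_le _ _ _ hs

/-- The left side is the Hellinger affinity, the integral of √(pq). It equals 1 minus half the
integral of (√p - √q)², and (p - q)²/(p + q) ≤ 2(√p - √q)² because (√p + √q)² ≤ 2(p + q). Points
with q = 0 contribute 0, even when p/q is infinite. -/
lemma lintegral_sqrt_div_mul_le (hp : IsDensity lam p) (hq : IsDensity lam q) :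
    ∫⁻ y, (q y : ℝ≥0∞) * ((p y : ℝ≥0∞) / q y) ^ (1 / 2 : ℝ) ∂lam ≤
      ENNReal.ofReal (1 - triDens lam p q / 4) := by
  have ip := integrable_of_lintegral_eq_one hp
  have iq := integrable_of_lintegral_eq_one hq
  have h3 := integrable_triDens hp hq
  have key : ∀ a b : ℝ≥0, √((a : ℝ) * b) ≤
      ((a : ℝ) + b) / 2 - ((a : ℝ) - b) ^ 2 / ((a : ℝ) + b) / 4 := by
    intro a b
    obtain ⟨u, hu, hua⟩ : ∃ u : ℝ, 0 ≤ u ∧ (a : ℝ) = u ^ 2 :=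
      ⟨√a, Real.sqrt_nonneg _, (Real.sq_sqrt a.2).symm⟩
    obtain ⟨v, hv, hvb⟩ : ∃ v : ℝ, 0 ≤ v ∧ (b : ℝ) = v ^ 2 :=
      ⟨√b, Real.sqrt_nonneg _, (Real.sq_sqrt b.2).symm⟩
    rw [hua, hvb, ← mul_pow, Real.sqrt_sq (by positivity)]
    have : (u ^ 2 - v ^ 2) ^ 2 / (u ^ 2 + v ^ 2) ≤ 2 * (u - v) ^ 2 := by
      refine div_le_of_le_mul₀ (by positivity) (by positivity) ?_
      nlinarith [mul_nonneg (sq_nonneg (u - v)) (sq_nonneg (u - v))]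
    nlinarith
  have pt : ∀ y, (q y : ℝ≥0∞) * ((p y : ℝ≥0∞) / q y) ^ (1 / 2 : ℝ) ≤
      ENNReal.ofReal (((p y : ℝ) + q y) / 2 -
        ((p y : ℝ) - q y) ^ 2 / ((p y : ℝ) + q y) / 4) := by
    intro y
    rcases eq_or_ne (q y) 0 with h | h
    · simp [h]
    · refine le_trans (le_of_eq ?_) (ENNReal.ofReal_le_ofReal (key (p y) (q y)))
      rw [← ENNReal.coe_div h, ← ENNReal.coe_rpow_of_nonneg _ (by norm_num), ← ENNReal.coe_mul,
        ← ENNReal.ofReal_coe_nnreal]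
      congr 1
      push_cast
      rw [← Real.sqrt_eq_rpow, Real.sqrt_div' _ (NNReal.coe_nonneg _), Real.sqrt_mul (NNReal.coe_nonneg _)]
      have : √(q y : ℝ) ≠ 0 := by
        rw [Real.sqrt_ne_zero (NNReal.coe_nonneg _)]; exact_mod_cast h
      field_simp
      rw [Real.sq_sqrt (NNReal.coe_nonneg _), mul_comm]
  refine (lintegral_mono pt).trans (le_of_eq ?_)
  have ii : Integrable (fun y => ((p y : ℝ) + q y) / 2 -
        ((p y : ℝ) - q y) ^ 2 / ((p y : ℝ) + q y) / 4) lam :=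
    ((ip.add iq).div_const 2).sub (h3.div_const 4)
  rw [← ofReal_integral_eq_lintegral_ofReal ii
    (Filter.Eventually.of_forall fun y => (Real.sqrt_nonneg _).trans (key _ _))]
  congr 1
  rw [integral_sub (f := fun y => ((p y : ℝ) + q y) / 2) ((ip.add iq).div_const 2)
    (h3.div_const 4), integral_div, integral_div,
    integral_add ip iq, integral_eq_one_of_lintegral hp, integral_eq_one_of_lintegral hq,
    triDens]
  norm_num

/-- The law with density `p`. -/
def densLaw (lam : Measure ℝ) (p : ℝ → ℝ≥0) : Measure ℝ := lam.withDensity fun y => (p y : ℝ≥0∞)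

lemma isProbabilityMeasure_densLaw (hp : IsDensity lam p) :
    IsProbabilityMeasure (densLaw lam p) :=
  ⟨by rw [densLaw, withDensity_apply _ MeasurableSet.univ, setLIntegral_univ, hp.lintegral_eq_one]⟩

lemma integral_densLaw (hp : IsDensity lam p) (φ : ℝ → ℝ) :
    ∫ y, φ y ∂(densLaw lam p) = ∫ y, φ y * (p y : ℝ) ∂lam := by
  rw [densLaw, integral_withDensity_eq_integral_smul hp.measurable]
  exact integral_congr_ae (Filter.Eventually.of_forall fun y => by
    simp [NNReal.smul_def, mul_comm])

lemma ae_densLaw (hlam : lam (Set.Icc (0 : ℝ) 1)ᶜ = 0) :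
    ∀ᵐ y ∂(densLaw lam p), y ∈ Set.Icc (0 : ℝ) 1 :=
  (withDensity_absolutelyContinuous lam _).ae_le (mem_ae_iff.2 hlam)

lemma integrable_bdd_mul_dens (hlam : lam (Set.Icc (0 : ℝ) 1)ᶜ = 0) (hp : IsDensity lam p) {φ : ℝ → ℝ} (hφ : Measurable φ) {B : ℝ}
    (hB : ∀ y ∈ Set.Icc (0 : ℝ) 1, |φ y| ≤ B) : Integrable (fun y => φ y * (p y : ℝ)) lam := by
  have hae : ∀ᵐ y ∂lam, y ∈ Set.Icc (0 : ℝ) 1 := mem_ae_iff.2 hlam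
  exact (integrable_of_lintegral_eq_one hp).bdd_mul (c := B) hφ.aestronglyMeasurable
    (by filter_upwards [hae] with y hy using hB y hy)

/-- `Var(μ)` of a law on the line. -/
def lawVar (μ : Measure ℝ) : ℝ := ∫ y, (y - ∫ z, z ∂μ) ^ 2 ∂μ

lemma lawVar_nonneg (μ : Measure ℝ) : 0 ≤ lawVar μ := integral_nonneg fun _ => sq_nonneg _

lemma mem_Icc_mean_densLaw (hlam : lam (Set.Icc (0 : ℝ) 1)ᶜ = 0) (hp : IsDensity lam p) :
    ∫ y, y ∂(densLaw lam p) ∈ Set.Icc (0 : ℝ) 1 := by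
  have := isProbabilityMeasure_densLaw hp
  have h := ae_densLaw (p := p) hlam
  constructor
  · exact integral_nonneg_of_ae (by filter_upwards [h] with y hy using hy.1)
  · have i : Integrable (fun y : ℝ => y) (densLaw lam p) :=
      Integrable.of_bound (C := 1) (by fun_prop) (by
        filter_upwards [h] with y hy
        rw [Real.norm_eq_abs, abs_le]; constructor <;> linarith [hy.1, hy.2])
    calc _ ≤ ∫ y, (1 : ℝ) ∂(densLaw lam p) :=
          integral_mono_ae i (integrable_const _) (by filter_upwards [h] with y hy using hy.2)
      _ = 1 := by simp

/-- The weighted Cauchy-Schwarz inequality rewritten for expectations. All later comparisons of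
means and variances come from a choice of φ and s here. -/
lemma integral_densLaw_sub (hlam : lam (Set.Icc (0 : ℝ) 1)ᶜ = 0) (hp : IsDensity lam p)
    (hq : IsDensity lam q) {φ : ℝ → ℝ} (hφ : Measurable φ) {B : ℝ}
    (hB : ∀ y ∈ Set.Icc (0 : ℝ) 1, |φ y| ≤ B) {s : ℝ} (hs : 0 < s) :
    2 * (∫ y, φ y ∂(densLaw lam p) - ∫ y, φ y ∂(densLaw lam q)) ≤
      s * (∫ y, φ y ^ 2 ∂(densLaw lam p) + ∫ y, φ y ^ 2 ∂(densLaw lam q))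
        + triDens lam p q / s := by
  have hB2 : ∀ y ∈ Set.Icc (0 : ℝ) 1, |φ y ^ 2| ≤ B ^ 2 := fun y hy => by
    rw [abs_pow]; exact pow_le_pow_left₀ (abs_nonneg _) (hB y hy) 2
  have a1 := integrable_bdd_mul_dens hlam hp hφ hB
  have a2 := integrable_bdd_mul_dens hlam hq hφ hB
  have b1 := integrable_bdd_mul_dens hlam hp (hφ.pow_const 2) hB2
  have b2 := integrable_bdd_mul_dens hlam hq (hφ.pow_const 2) hB2
  have h := two_mul_integral_sub_le hp hq (φ := φ) (s := s)
    ((a1.sub a2).congr (Filter.Eventually.of_forall fun y => (mul_sub _ _ _).symm))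
    ((b1.add b2).congr (Filter.Eventually.of_forall fun y => (mul_add _ _ _).symm)) hs
  simp only [mul_sub, mul_add] at h
  rw [integral_sub a1 a2, integral_add b1 b2] at h
  simp only [integral_densLaw hp, integral_densLaw hq]
  linarith

lemma sq_mean_sub_le (hlam : lam (Set.Icc (0 : ℝ) 1)ᶜ = 0) (hp : IsDensity lam p) (hq : IsDensity lam q) :
    (∫ y, y ∂(densLaw lam p) - ∫ y, y ∂(densLaw lam q)) ^ 2 ≤ 2 * triDens lam p q := by
  have bd : ∀ {r : ℝ → ℝ≥0}, IsDensity lam r →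
      ∫ y, y ^ 2 ∂(densLaw lam r) ≤ 1 := by
    intro r hr
    have := isProbabilityMeasure_densLaw hr
    have h := ae_densLaw (p := r) hlam
    calc _ ≤ ∫ y, (1 : ℝ) ∂(densLaw lam r) := by
          refine integral_mono_of_nonneg (Filter.Eventually.of_forall fun y => sq_nonneg _)
            (integrable_const _) ?_
          filter_upwards [h] with y hy
          exact pow_le_one₀ hy.1 hy.2
      _ = 1 := by simp
  have habs : ∀ c : ℝ, |c| = 1 → ∀ y ∈ Set.Icc (0 : ℝ) 1, |c * y| ≤ 1 := fun c hc y hy => by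
    rw [abs_mul, hc, one_mul, abs_le]; constructor <;> linarith [hy.1, hy.2]
  have main : ∀ c : ℝ, |c| = 1 → ∀ s : ℝ, 0 < s →
      2 * (c * (∫ y, y ∂(densLaw lam p) - ∫ y, y ∂(densLaw lam q))) ≤
        2 * s + triDens lam p q / s := by
    intro c hc s hs
    have h := integral_densLaw_sub hlam hp hq (φ := fun y => c * y)
      (by fun_prop) (habs c hc) hs
    have hc2 : c ^ 2 = 1 := by rw [← sq_abs, hc, one_pow]
    simp only [mul_pow, hc2, one_mul] at h
    rw [integral_const_mul, integral_const_mul] at h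
    nlinarith [bd hp, bd hq]
  set b := ∫ y, y ∂(densLaw lam p) - ∫ y, y ∂(densLaw lam q) with hb
  rcases eq_or_ne b 0 with h0 | h0
  · rw [h0]; nlinarith [triDens_nonneg (lam := lam) (p := p) (q := q)]
  · have hpos : 0 < |b| := abs_pos.2 h0
    obtain ⟨c, hc, hcb⟩ : ∃ c : ℝ, |c| = 1 ∧ c * b = |b| := by
      rcases abs_choice b with h | h
      · exact ⟨1, by simp, by rw [h, one_mul]⟩
      · exact ⟨-1, by simp, by rw [h]; ring⟩
    -- With b the difference of means, the bound is 2|b| ≤ 2s + D/s; s = |b|/2 leaves |b| ≤ 2D/|b|.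
    have h := main c hc (|b| / 2) (by positivity)
    rw [hcb] at h
    have h' : |b| ≤ triDens lam p q / (|b| / 2) := by linarith
    rw [le_div_iff₀ (by positivity)] at h'
    rw [← sq_abs]
    nlinarith

/-- Take φ = (y - m)² with m the mean of q. It has values in [0,1] on the support, so φ² ≤ φ and the
second moments of φ are again second moments about m. The choice s = 1 gives the first, crude bound;
inserting it on the right side for general s sharpens the leading constant to 1 + 2s, which tends to
1 and so can be iterated over H steps. -/
lemma integral_sq_sub_mean_le (hlam : lam (Set.Icc (0 : ℝ) 1)ᶜ = 0) (hp : IsDensity lam p) (hq : IsDensity lam q) :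
    (∫ y, (y - ∫ z, z ∂(densLaw lam q)) ^ 2 ∂(densLaw lam p)) + lawVar (densLaw lam q) ≤
      4 * lawVar (densLaw lam q) + triDens lam p q ∧
    ∀ s : ℝ, 0 < s → s ≤ 1 →
      ∫ y, (y - ∫ z, z ∂(densLaw lam q)) ^ 2 ∂(densLaw lam p) ≤
        (1 + 2 * s) * lawVar (densLaw lam q) + triDens lam p q / s := by
  have hm := mem_Icc_mean_densLaw hlam hq
  set m := ∫ z, z ∂(densLaw lam q) with hmdef
  have hbd : ∀ y ∈ Set.Icc (0 : ℝ) 1, |(y - m) ^ 2| ≤ 1 := fun y hy => by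
    rw [abs_of_nonneg (sq_nonneg _), sq_le_one_iff_abs_le_one, abs_le]
    constructor <;> linarith [hy.1, hy.2, hm.1, hm.2]
  have i4 : ∀ {r : ℝ → ℝ≥0}, IsDensity lam r →
      ∫ y, ((y - m) ^ 2) ^ 2 ∂(densLaw lam r) ≤ ∫ y, (y - m) ^ 2 ∂(densLaw lam r) := by
    intro r hr
    have := isProbabilityMeasure_densLaw hr
    have h := ae_densLaw (p := r) hlam
    refine integral_mono_of_nonneg (Filter.Eventually.of_forall fun y => by positivity)
      (Integrable.of_bound (C := 1) (by fun_prop) (by filter_upwards [h] with y hy using hbd y hy))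
      ?_
    filter_upwards [h] with y hy
    have := hbd y hy
    rw [abs_of_nonneg (sq_nonneg _)] at this
    change ((y - m) ^ 2) ^ 2 ≤ (y - m) ^ 2
    nlinarith [sq_nonneg (y - m)]
  have main := fun (s : ℝ) (hs : 0 < s) =>
    integral_densLaw_sub hlam hp hq (φ := fun y => (y - m) ^ 2) (by fun_prop) hbd hs
  have hV : lawVar (densLaw lam q) = ∫ y, (y - m) ^ 2 ∂(densLaw lam q) := rfl
  rw [hV]
  set Vq := ∫ y, (y - m) ^ 2 ∂(densLaw lam q)
  set Wp := ∫ y, (y - m) ^ 2 ∂(densLaw lam p)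
  have hVq : 0 ≤ Vq := integral_nonneg fun _ => sq_nonneg _
  have hT := triDens_nonneg (lam := lam) (p := p) (q := q)
  have h1 : Wp + Vq ≤ 4 * Vq + triDens lam p q := by
    have := main 1 one_pos
    linarith [i4 hp, i4 hq, div_one (triDens lam p q)]
  refine ⟨h1, fun s hs hs1 => ?_⟩
  have h2 := main s hs
  have h3 : s * (∫ y, ((y - m) ^ 2) ^ 2 ∂(densLaw lam p) +
      ∫ y, ((y - m) ^ 2) ^ 2 ∂(densLaw lam q)) ≤ s * (4 * Vq + triDens lam p q) :=
    mul_le_mul_of_nonneg_left (by linarith [i4 hp, i4 hq]) hs.le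
  have h4 : s * triDens lam p q ≤ triDens lam p q / s := by
    rw [le_div_iff₀ hs]; 
    nlinarith [mul_nonneg hT (sub_nonneg.2 hs1),
      mul_nonneg hT (mul_nonneg hs.le (sub_nonneg.2 hs1))]
  nlinarith

/-- Take φ = y - m with m the mean of q. Its second moments under p and q add up to at most 4 Var(q)
+ D by the crude bound above, and s D ≤ D/s since s ≤ 1. -/
lemma mean_sub_le (hlam : lam (Set.Icc (0 : ℝ) 1)ᶜ = 0) (hp : IsDensity lam p)
    (hq : IsDensity lam q) {s : ℝ} (hs : 0 < s) (hs1 : s ≤ 1) :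
    ∫ y, y ∂(densLaw lam p) - ∫ y, y ∂(densLaw lam q) ≤
      2 * s * lawVar (densLaw lam q) + triDens lam p q / s := by
  have hm := mem_Icc_mean_densLaw hlam hq
  have hW := (integral_sq_sub_mean_le hlam hp hq).1
  have hpp := isProbabilityMeasure_densLaw hp
  have hpq := isProbabilityMeasure_densLaw hq
  have hi : ∀ {r : ℝ → ℝ≥0}, IsDensity lam r →
      Integrable (fun y : ℝ => y) (densLaw lam r) := by
    intro r hr
    have := isProbabilityMeasure_densLaw hr
    refine Integrable.of_bound (C := 1) (by fun_prop) ?_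
    filter_upwards [ae_densLaw (p := r) hlam] with y hy
    rw [Real.norm_eq_abs, abs_le]; constructor <;> linarith [hy.1, hy.2]
  have h := integral_densLaw_sub hlam hp hq
    (φ := fun y => y - ∫ z, z ∂(densLaw lam q)) (B := 1) (by fun_prop)
    (fun y hy => by rw [abs_le]; constructor <;> linarith [hy.1, hy.2, hm.1, hm.2]) hs
  rw [integral_sub (hi hp) (integrable_const _), integral_sub (hi hq) (integrable_const _)] at h
  simp only [integral_const, probReal_univ, one_smul, sub_self, sub_zero] at h
  have hV : lawVar (densLaw lam q) =
    ∫ y, (y - ∫ z, z ∂(densLaw lam q)) ^ 2 ∂(densLaw lam q) := rfl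
  rw [← hV] at h
  have h3 := mul_le_mul_of_nonneg_left hW hs.le
  have hT := triDens_nonneg (lam := lam) (p := p) (q := q)
  have h4 : s * triDens lam p q ≤ triDens lam p q / s := by
    rw [le_div_iff₀ hs]; 
    nlinarith [mul_nonneg hT (sub_nonneg.2 hs1),
      mul_nonneg hT (mul_nonneg hs.le (sub_nonneg.2 hs1))]
  nlinarith

lemma lawVar_le_integral_sq_sub {μ : Measure ℝ} [IsProbabilityMeasure μ]
    (hi : MemLp (fun y : ℝ => y) 2 μ) (m : ℝ) : lawVar μ ≤ ∫ y, (y - m) ^ 2 ∂μ := by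
  obtain ⟨n, hn⟩ : ∃ n, n = ∫ z, z ∂μ := ⟨_, rfl⟩
  have i1 : Integrable (fun y : ℝ => y) μ := hi.integrable one_le_two
  have i2 : Integrable (fun y : ℝ => (y - n) ^ 2) μ := (hi.sub (memLp_const n)).integrable_sq
  have i3 : Integrable (fun y : ℝ => 2 * (n - m) * (y - n)) μ :=
    (i1.sub (integrable_const n)).const_mul _
  have i4 : Integrable (fun y : ℝ => (y - m) ^ 2) μ := (hi.sub (memLp_const m)).integrable_sq
  have e : ∫ y, (2 * (n - m) * (y - n)) ∂μ = 0 := by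
    rw [integral_const_mul, integral_sub i1 (integrable_const _), ← hn]
    simp
  calc lawVar μ = ∫ y, ((y - n) ^ 2 + 2 * (n - m) * (y - n)) ∂μ := by
        rw [integral_add i2 i3, e, add_zero, lawVar, hn]
    _ ≤ ∫ y, (y - m) ^ 2 ∂μ :=
        integral_mono (i2.add i3) i4 fun y => by
          show (y - n) ^ 2 + 2 * (n - m) * (y - n) ≤ (y - m) ^ 2
          nlinarith [sq_nonneg (n - m)]

lemma lawVar_le (hlam : lam (Set.Icc (0 : ℝ) 1)ᶜ = 0) (hp : IsDensity lam p)
    (hq : IsDensity lam q) {s : ℝ} (hs : 0 < s) (hs1 : s ≤ 1) :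
    lawVar (densLaw lam p) ≤ (1 + 2 * s) * lawVar (densLaw lam q) + triDens lam p q / s := by
  have hpp := isProbabilityMeasure_densLaw hp
  have hi : MemLp (fun y : ℝ => y) 2 (densLaw lam p) := by
    refine MemLp.of_bound (by fun_prop) 1 ?_
    filter_upwards [ae_densLaw (p := p) hlam] with y hy
    rw [Real.norm_eq_abs, abs_le]; constructor <;> linarith [hy.1, hy.2]
  exact (lawVar_le_integral_sq_sub hi _).trans
    ((integral_sq_sub_mean_le hlam hp hq).2 s hs hs1)

end Densities

/-! ### From small error on the past to small total error. -/

section Eluder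

/-- Greedy colouring: if the row sums of `a` are at most `m * ε`, the indices of `T` can be
coloured with `m` colours so that each row sum over an earlier colour class is at most `ε`. -/
lemma exists_coloring {a : ℕ → ℕ → ℝ} (ha : ∀ k i, 0 ≤ a k i) {K m : ℕ} (hm : 0 < m) {ε : ℝ}
    (T : Finset ℕ) (hrow : ∀ k < K, ∑ i ∈ Finset.range k, a k i ≤ m * ε) :
    ∃ col : ℕ → Fin m, ∀ k < K,
      ∑ i ∈ (Finset.range k).filter (fun i => i ∈ T ∧ col i = col k), a k i ≤ ε := by
  induction K with
  | zero => exact ⟨fun _ => ⟨0, hm⟩, fun k hk => absurd hk (Nat.not_lt_zero k)⟩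
  | succ n ih =>
    obtain ⟨col, hcol⟩ := ih fun k hk => hrow k (hk.trans (Nat.lt_succ_self n))
    have hne : (Finset.univ : Finset (Fin m)).Nonempty := ⟨⟨0, hm⟩, Finset.mem_univ _⟩
    -- Pigeonhole: the m colour classes share a row sum of at most mε, so one of them carries at
    -- most ε.
    obtain ⟨j, -, hj⟩ : ∃ j ∈ (Finset.univ : Finset (Fin m)),
        ∑ i ∈ ((Finset.range n).filter (· ∈ T)).filter (fun i => col i = j), a n i ≤ ε := by
      refine Finset.exists_le_of_sum_le hne ?_
      rw [Finset.sum_fiberwise]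
      refine le_trans ?_ ((hrow n (Nat.lt_succ_self n)).trans (le_of_eq (by simp)))
      exact Finset.sum_le_sum_of_subset_of_nonneg (Finset.filter_subset _ _) fun i _ _ => ha n i
    refine ⟨Function.update col n j, fun k hk => ?_⟩
    have hup : ∀ i, i < n → Function.update col n j i = col i := fun i hi =>
      Function.update_of_ne hi.ne _ _
    rcases Nat.lt_succ_iff_lt_or_eq.1 hk with h | rfl
    · refine le_trans (le_of_eq (Finset.sum_congr ?_ fun _ _ => rfl)) (hcol k h)
      refine Finset.filter_congr fun i hi => ?_
      rw [hup k h, hup i ((Finset.mem_range.1 hi).trans h)]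
    · refine le_trans (le_of_eq (Finset.sum_congr ?_ fun _ _ => rfl)) hj
      rw [Finset.filter_filter]
      refine Finset.filter_congr fun i hi => ?_
      rw [hup i (Finset.mem_range.1 hi), Function.update_self]

variable {S : Type*} [MeasurableSpace S] {Ψ : Set (S → ℝ)} {𝔇 : Set (Measure S)} {ε₀ : ℝ}
  {ψ : ℕ → S → ℝ} {μ : ℕ → Measure S} {K D : ℕ}

/-- Colour the indices with m colours. Inside one colour class of large indices each member exceeds
ε at its own measure and has mass at most ε on the earlier members, so the class is a sequence
admissible for the eluder dimension and has at most D elements. -/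
lemma card_large_le (hdim : eluderDim Ψ 𝔇 ε₀ ≤ D) (hψ : ∀ k < K, ψ k ∈ Ψ)
    (hμ : ∀ k < K, μ k ∈ 𝔇) {m : ℕ} (hm : 0 < m) {ε : ℝ} (hε : ε₀ ≤ ε)
    (hrow : ∀ k < K, ∑ i ∈ Finset.range k, |∫ s, ψ k s ∂(μ i)| ≤ m * ε) :
    ((Finset.range K).filter (fun k => ε < |∫ s, ψ k s ∂(μ k)|)).card ≤ m * D := by
  set T := (Finset.range K).filter (fun k => ε < |∫ s, ψ k s ∂(μ k)|) with hT
  obtain ⟨col, hcol⟩ := exists_coloring (a := fun k i => |∫ s, ψ k s ∂(μ i)|)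
    (fun _ _ => abs_nonneg _) hm T hrow
  have hclass : ∀ j ∈ (Finset.univ : Finset (Fin m)),
      (T.filter (fun k => col k = j)).card ≤ D := by
    intro j _
    set U := T.filter (fun k => col k = j) with hU
    -- Increasing enumeration, so that earlier positions in the eluder sequence are earlier
    -- episodes.
    let e := U.orderEmbOfFin rfl
    have heU : ∀ t, e t ∈ U := fun t => Finset.orderEmbOfFin_mem U rfl t
    have heK : ∀ t, e t < K ∧ ε < |∫ s, ψ (e t) s ∂(μ (e t))| ∧ col (e t) = j := fun t => by
      have := heU t
      simp only [hU, hT, Finset.mem_filter, Finset.mem_range] at this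
      exact ⟨this.1.1, this.1.2, this.2⟩
    have : ((U.card : ℕ) : ℕ∞) ≤ D := by
      refine le_trans ?_ hdim
      unfold eluderDim
      refine le_sSup ⟨U.card, rfl, fun t => μ (e t), fun t => hμ _ (heK t).1, ε, hε,
        fun t => ⟨ψ (e t), hψ _ (heK t).1, (heK t).2.1, ?_⟩⟩
      refine le_trans ?_ (hcol (e t) (heK t).1)
      refine le_trans (le_of_eq (Finset.sum_map (Finset.univ.filter (· < t)) e.toEmbedding
        (fun i => |∫ s, ψ (e t) s ∂(μ i)|)).symm) ?_
      refine Finset.sum_le_sum_of_subset_of_nonneg ?_ fun i _ _ => abs_nonneg _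
      intro i hi
      obtain ⟨t', ht', rfl⟩ := Finset.mem_map.1 hi
      have hlt : t' < t := (Finset.mem_filter.1 ht').2
      refine Finset.mem_filter.2 ⟨Finset.mem_range.2 (e.strictMono hlt),
        (Finset.mem_filter.1 (heU t')).1, ?_⟩
      exact (heK t').2.2.trans (heK t).2.2.symm
    exact_mod_cast this
  have := Finset.card_le_mul_card_image_of_maps_to (s := T) (t := Finset.univ) (f := col)
    (fun _ _ => Finset.mem_univ _) D (fun j hj => hclass j hj)
  rw [Finset.card_univ, Fintype.card_fin] at this
  rwa [mul_comm]

/-- A sequence whose members have small mass on the past has small total mass. -/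
lemma sum_le_of_eluderDim (hK : 0 < K) (hdim : eluderDim Ψ 𝔇 (1 / K) ≤ D)
    (hψ : ∀ k < K, ψ k ∈ Ψ) (hμ : ∀ k < K, μ k ∈ 𝔇) {B : ℝ} (hB : 0 ≤ B)
    (hrow : ∀ k < K, ∑ i ∈ Finset.range k, |∫ s, ψ k s ∂(μ i)| ≤ B)
    (htwo : ∀ k < K, |∫ s, ψ k s ∂(μ k)| ≤ 2) :
    ∑ k ∈ Finset.range K, |∫ s, ψ k s ∂(μ k)| ≤
      4 * (B + 3) * ((max 1 D : ℕ) : ℝ) * (1 + Real.log K) := by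
  set a : ℕ → ℝ := fun k => |∫ s, ψ k s ∂(μ k)| with ha
  have hKr : (0 : ℝ) < K := by exact_mod_cast hK
  have ha0 : ∀ k, 0 ≤ a k := fun k => abs_nonneg _
  have hN : ∀ ε : ℝ, 1 / (K : ℝ) ≤ ε →
      (((Finset.range K).filter (fun k => ε < a k)).card : ℝ) ≤ (B / ε + 1) * D := by
    intro ε hε
    have hε0 : 0 < ε := lt_of_lt_of_le (by positivity) hε
    -- The number of colours is the least natural m that surely satisfies B ≤ mε.
    have h := card_large_le hdim hψ hμ (m := ⌊B / ε⌋₊ + 1) (Nat.succ_pos _) hε (fun k hk => by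
      refine (hrow k hk).trans ?_
      have := (Nat.lt_floor_add_one (B / ε)).le
      rw [div_le_iff₀ hε0] at this
      exact_mod_cast this)
    calc _ ≤ (((⌊B / ε⌋₊ + 1) * D : ℕ) : ℝ) := by exact_mod_cast h
      _ ≤ _ := by
        push_cast
        have := Nat.floor_le (div_nonneg hB hε0.le)
        gcongr
  -- Dyadic peeling from level 2, above which there is nothing: each shell (ε, 2ε] has at most (B/ε
  -- + 1)D members of size at most 2ε, hence mass at most 2(B + 2)D.
  have hlev : ∀ n : ℕ, 1 / (K : ℝ) ≤ 2 / 2 ^ n →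
      ∑ k ∈ (Finset.range K).filter (fun k => 2 / 2 ^ n < a k), a k ≤ n * (2 * (B + 2) * D) := by
    intro n
    induction n with
    | zero =>
      intro _
      rw [Finset.filter_false_of_mem]
      · simp
      · intro k hk
        have := htwo k (Finset.mem_range.1 hk)
        simp only [pow_zero, div_one, not_lt]
        exact this
    | succ n ih =>
      intro hn
      set ε : ℝ := 2 / 2 ^ (n + 1) with hε
      have hε2 : (2 : ℝ) / 2 ^ n = 2 * ε := by rw [hε, pow_succ]; field_simp
      have hε0 : 0 < ε := by positivity
      have hε1 : ε ≤ 2 := by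
        rw [hε]; exact div_le_self (by norm_num) (one_le_pow₀ (by norm_num))
      rw [hε2] at ih
      have h1 := ih (by linarith)
      have hsplit : (Finset.range K).filter (fun k => ε < a k) ⊆
          (Finset.range K).filter (fun k => 2 * ε < a k) ∪
            (Finset.range K).filter (fun k => ε < a k ∧ a k ≤ 2 * ε) := by
        intro k hk
        simp only [Finset.mem_union, Finset.mem_filter] at hk ⊢
        rcases lt_or_ge (2 * ε) (a k) with h | h
        · exact Or.inl ⟨hk.1, h⟩
        · exact Or.inr ⟨hk.1, hk.2, h⟩
      have h2 : ∑ k ∈ (Finset.range K).filter (fun k => ε < a k ∧ a k ≤ 2 * ε), a k ≤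
          2 * (B + 2) * D := by
        calc _ ≤ ∑ k ∈ (Finset.range K).filter (fun k => ε < a k ∧ a k ≤ 2 * ε), 2 * ε :=
              Finset.sum_le_sum fun k hk => (Finset.mem_filter.1 hk).2.2
          _ = (((Finset.range K).filter (fun k => ε < a k ∧ a k ≤ 2 * ε)).card : ℝ) * (2 * ε) := by
              rw [Finset.sum_const, nsmul_eq_mul]
          _ ≤ ((B / ε + 1) * D) * (2 * ε) := by
              refine mul_le_mul_of_nonneg_right (le_trans ?_ (hN ε hn)) (by positivity)
              refine Nat.cast_le.2 (Finset.card_le_card fun k hk => ?_)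
              rw [Finset.mem_filter] at hk ⊢
              exact ⟨hk.1, hk.2.1⟩
          _ = 2 * (B + ε) * D := by field_simp
          _ ≤ _ := by gcongr
      calc _ ≤ _ := Finset.sum_le_sum_of_subset_of_nonneg hsplit fun k _ _ => ha0 k
        _ ≤ _ := by
          have h3 := Finset.sum_union_inter (f := a)
            (s₁ := (Finset.range K).filter (fun k => 2 * ε < a k))
            (s₂ := (Finset.range K).filter (fun k => ε < a k ∧ a k ≤ 2 * ε))
          have h4 := Finset.sum_nonneg (s := (Finset.range K).filter (fun k => 2 * ε < a k) ∩
            (Finset.range K).filter (fun k => ε < a k ∧ a k ≤ 2 * ε)) fun k _ => ha0 k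
          push_cast
          linarith
  -- The last level 2/2^n lies between 1/K, so the dimension still applies, and 2/K, so the K
  -- remaining terms sum to at most 2.
  set n := Nat.log 2 (2 * K) with hn
  have hpow : 2 ^ n ≤ 2 * K := Nat.pow_log_le_self 2 (by omega)
  have hpow' : 2 * K < 2 ^ (n + 1) := Nat.lt_pow_succ_log_self (by norm_num) _
  have hpowr : (2 : ℝ) ^ n ≤ 2 * K := by exact_mod_cast hpow
  have hpowr' : 2 * (K : ℝ) < 2 ^ n * 2 := by rw [← pow_succ]; exact_mod_cast hpow'
  have hbig := hlev n (by rw [div_le_div_iff₀ hKr (by positivity)]; linarith)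
  have hsmall : ∑ k ∈ (Finset.range K).filter (fun k => ¬ 2 / 2 ^ n < a k), a k ≤ 2 := by
    calc _ ≤ ∑ k ∈ (Finset.range K).filter (fun k => ¬ 2 / 2 ^ n < a k), 2 / (K : ℝ) := by
          refine Finset.sum_le_sum fun k hk => ?_
          refine (not_lt.1 (Finset.mem_filter.1 hk).2).trans ?_
          rw [div_le_div_iff₀ (by positivity) hKr]; linarith
      _ ≤ ∑ k ∈ Finset.range K, 2 / (K : ℝ) :=
          Finset.sum_le_sum_of_subset_of_nonneg (Finset.filter_subset _ _)
            fun _ _ _ => by positivity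
      _ = 2 := by rw [Finset.sum_const, Finset.card_range, nsmul_eq_mul]; field_simp
  have hnlog : (n : ℝ) ≤ 2 * (1 + Real.log K) := by
    have h1 : (n : ℝ) * Real.log 2 ≤ Real.log 2 + Real.log K := by
      rw [← Real.log_pow, ← Real.log_mul (by norm_num) hKr.ne']
      exact Real.log_le_log (by positivity) (by exact_mod_cast hpow)
    have h2 := Real.log_two_gt_d9
    have h3 := Real.log_two_lt_d9
    have h4 : 0 ≤ Real.log K := Real.log_natCast_nonneg K
    nlinarith [(Nat.cast_nonneg n : (0 : ℝ) ≤ n)]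
  have hL : 1 ≤ 1 + Real.log K := by linarith [Real.log_natCast_nonneg K]
  have hD1 : (1 : ℝ) ≤ ((max 1 D : ℕ) : ℝ) := by exact_mod_cast le_max_left 1 D
  have hDD : (D : ℝ) ≤ ((max 1 D : ℕ) : ℝ) := by exact_mod_cast le_max_right 1 D
  rw [← Finset.sum_filter_add_sum_filter_not (Finset.range K) (fun k => 2 / 2 ^ n < a k)]
  have h5 : (n : ℝ) * (2 * (B + 2) * D) ≤
      2 * (1 + Real.log K) * (2 * (B + 2) * ((max 1 D : ℕ) : ℝ)) := by gcongr
  have h6 : 1 ≤ ((max 1 D : ℕ) : ℝ) * (1 + Real.log K) := by nlinarith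
  nlinarith

end Eluder

/-! ### Bounded measurable functions: a class closed under all operations used, so that
integrability is automatic. -/

section BddMeas

variable {E G : Type*} [MeasurableSpace E] [MeasurableSpace G]

/-- Bounded measurable real functions. -/
structure BddMeas (φ : E → ℝ) : Prop where
  measurable : Measurable φ
  exists_bound : ∃ B, ∀ x, |φ x| ≤ B

namespace BddMeas

variable {φ χ : E → ℝ}

lemma integrable (hφ : BddMeas φ) (μ : Measure E) [IsFiniteMeasure μ] : Integrable φ μ := by
  obtain ⟨B, hB⟩ := hφ.exists_bound
  exact Integrable.of_bound hφ.measurable.aestronglyMeasurable B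
    (Filter.Eventually.of_forall hB)

lemma const (c : ℝ) : BddMeas (fun _ : E => c) := ⟨measurable_const, |c|, fun _ => le_rfl⟩

lemma add (hφ : BddMeas φ) (hχ : BddMeas χ) : BddMeas (fun x => φ x + χ x) := by
  obtain ⟨B, hB⟩ := hφ.exists_bound
  obtain ⟨D, hD⟩ := hχ.exists_bound
  exact ⟨hφ.measurable.add hχ.measurable, B + D,
    fun x => (abs_add_le _ _).trans (add_le_add (hB x) (hD x))⟩

lemma mul (hφ : BddMeas φ) (hχ : BddMeas χ) : BddMeas (fun x => φ x * χ x) := by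
  obtain ⟨B, hB⟩ := hφ.exists_bound
  obtain ⟨D, hD⟩ := hχ.exists_bound
  refine ⟨hφ.measurable.mul hχ.measurable, B * D, fun x => ?_⟩
  rw [abs_mul]
  exact mul_le_mul (hB x) (hD x) (abs_nonneg _) ((abs_nonneg _).trans (hB x))

lemma sub (hφ : BddMeas φ) (hχ : BddMeas χ) : BddMeas (fun x => φ x - χ x) := by
  simpa [sub_eq_add_neg] using hφ.add ((const (-1)).mul hχ)

lemma sq (hφ : BddMeas φ) : BddMeas (fun x => φ x ^ 2) := by
  simpa only [pow_two] using hφ.mul hφ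

lemma comp (hφ : BddMeas φ) {g : G → E} (hg : Measurable g) : BddMeas (fun x => φ (g x)) :=
  ⟨hφ.measurable.comp hg, hφ.exists_bound.imp fun _ h x => h (g x)⟩

lemma sum {ι : Type*} (s : Finset ι) {φ : ι → E → ℝ} (h : ∀ i ∈ s, BddMeas (φ i)) :
    BddMeas (fun x => ∑ i ∈ s, φ i x) := by
  classical
  induction s using Finset.induction_on with
  | empty => simpa using const 0
  | insert a s ha ih =>
    simp only [Finset.sum_insert ha]
    exact (h a (Finset.mem_insert_self _ _)).add
      (ih fun i hi => h i (Finset.mem_insert_of_mem hi))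

lemma of_mem_Icc {B : ℝ} (h : Measurable φ) (h0 : ∀ x, 0 ≤ φ x) (h1 : ∀ x, φ x ≤ B) :
    BddMeas φ := ⟨h, B, fun x => by rw [abs_of_nonneg (h0 x)]; exact h1 x⟩

lemma integral_kernel_prod {φ : E × G → ℝ} (hφ : BddMeas φ) (κ : Kernel E G)
    [IsMarkovKernel κ] : BddMeas (fun x => ∫ y, φ (x, y) ∂(κ x)) := by
  obtain ⟨B, hB⟩ := hφ.exists_bound
  refine ⟨(StronglyMeasurable.integral_kernel_prod_right' (κ := κ)
    hφ.measurable.stronglyMeasurable).measurable, B, fun x => ?_⟩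
  have := norm_integral_le_of_norm_le_const (μ := κ x) (f := fun y => φ (x, y)) (C := B)
    (Filter.Eventually.of_forall fun y => hB (x, y))
  simpa using this

lemma integral_kernel {φ : G → ℝ} (hφ : BddMeas φ) (κ : Kernel E G)
    [IsMarkovKernel κ] : BddMeas (fun x => ∫ y, φ y ∂(κ x)) :=
  integral_kernel_prod (φ := fun p : E × G => φ p.2) (hφ.comp measurable_snd) κ

end BddMeas

lemma integral_kernel_comp {Y : Type*} [MeasurableSpace Y] {φ : Y → ℝ} (hφ : BddMeas φ)
    (η : Kernel G Y) (κ : Kernel E G) [IsMarkovKernel η] [IsMarkovKernel κ] (x : E) :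
    ∫ z, φ z ∂((η ∘ₖ κ) x) = ∫ y, ∫ z, φ z ∂(η y) ∂(κ x) :=
  Kernel.integral_comp (hφ.integrable _)

lemma id_prod_apply (κ : Kernel E G) [IsSFiniteKernel κ] (x : E) :
    (Kernel.id ×ₖ κ) x = (κ x).map (Prod.mk x) := by
  rw [Kernel.prod_apply, Kernel.id_apply, Measure.dirac_prod]

lemma integral_id_prod {φ : E × G → ℝ} (hφ : Measurable φ) (κ : Kernel E G) [IsSFiniteKernel κ]
    (x : E) : ∫ p, φ p ∂((Kernel.id ×ₖ κ) x) = ∫ y, φ (x, y) ∂(κ x) := by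
  rw [id_prod_apply, integral_map measurable_prodMk_left.aemeasurable
    hφ.aestronglyMeasurable]

end BddMeas

/-! ### Marginals of rollouts. -/

section Roll

variable {X A : Type*} [MeasurableSpace X] [MeasurableSpace A] (M : MDP X A) (π : Policy X A)

/-- The law of an observed transition given its state-action pair. -/
def MDP.obs (h : ℕ) : Kernel (X × A) (Step X A) := Kernel.id ×ₖ (M.C h ×ₖ M.P h)

instance (h : ℕ) : IsMarkovKernel (M.obs h) := by unfold MDP.obs; infer_instance

lemma stepKernel_eq (h : ℕ) (ρ : Kernel X A) :
    M.stepKernel h ρ = M.obs h ∘ₖ (Kernel.id ×ₖ ρ) := rfl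

lemma integral_obs {φ : Step X A → ℝ} (hφ : Measurable φ) (h : ℕ) (xa : X × A) :
    ∫ s, φ s ∂(M.obs h xa) = ∫ p, φ (xa, p) ∂((M.C h xa).prod (M.P h xa)) := by
  rw [MDP.obs, integral_id_prod hφ, Kernel.prod_apply]

lemma lintegral_obs {φ : Step X A → ℝ≥0∞} (hφ : Measurable φ) (h : ℕ) (xa : X × A) :
    ∫⁻ s, φ s ∂(M.obs h xa) = ∫⁻ c, ∫⁻ x', φ (xa, c, x') ∂(M.P h xa) ∂(M.C h xa) := by
  rw [MDP.obs, Kernel.lintegral_id_prod hφ, Kernel.prod_apply,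
    lintegral_prod _ (by fun_prop)]

lemma integral_stepKernel {φ : Step X A → ℝ} (hφ : BddMeas φ) (h : ℕ) (ρ : Kernel X A)
    [IsMarkovKernel ρ] (x : X) :
    ∫ s, φ s ∂(M.stepKernel h ρ x) =
      ∫ a, ∫ p, φ ((x, a), p) ∂((M.C h (x, a)).prod (M.P h (x, a))) ∂(ρ x) := by
  rw [stepKernel_eq, integral_kernel_comp hφ,
    integral_id_prod (hφ.integral_kernel _).measurable]
  simp only [integral_obs M hφ.measurable]

lemma integral_roll_succ {n : ℕ} {φ : (Fin (n + 1) → Step X A) → ℝ} (hφ : BddMeas φ) (h : ℕ)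
    (x : X) :
    ∫ τ, φ τ ∂(M.roll π (n + 1) h x) =
      ∫ s, ∫ τ, φ (Fin.cons (α := fun _ => Step X A) s τ) ∂(M.roll π n (h + 1) s.2.2)
        ∂(M.stepKernel h (π.kern h) x) := by
  rw [MDP.roll, Kernel.map_apply _ (measurable_cons n),
    integral_map (measurable_cons n).aemeasurable hφ.measurable.aestronglyMeasurable,
    integral_compProd ((hφ.comp (measurable_cons n)).integrable _)]
  rfl

/-- The law of the state reached after `i` steps from a state at step `h`. -/
def MDP.stateLaw : ℕ → ℕ → Kernel X X
  | _, 0 => Kernel.id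
  | h, i + 1 => MDP.stateLaw (h + 1) i ∘ₖ (M.P h ∘ₖ (Kernel.id ×ₖ π.kern h))

instance isMarkovKernel_stateLaw (h i : ℕ) : IsMarkovKernel (M.stateLaw π h i) := by
  induction i generalizing h with
  | zero => unfold MDP.stateLaw; infer_instance
  | succ i ih => have := ih (h + 1); unfold MDP.stateLaw; infer_instance

/-- `stateLaw` peels off the first transition, in step with `roll`; the forward recursion of
occupancies needs the last one peeled off instead. -/
lemma stateLaw_succ (h i : ℕ) :
    M.stateLaw π h (i + 1) =
      (M.P (h + i) ∘ₖ (Kernel.id ×ₖ π.kern (h + i))) ∘ₖ M.stateLaw π h i := by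
  induction i generalizing h with
  | zero => simp [MDP.stateLaw]
  | succ i ih =>
    rw [MDP.stateLaw, ih (h + 1), MDP.stateLaw.eq_2 M π h i, ← Kernel.comp_assoc,
      show h + 1 + i = h + (i + 1) by ring]
    simp only [Kernel.comp_assoc]

lemma map_snd_stepKernel (h : ℕ) (ρ : Kernel X A) [IsMarkovKernel ρ] :
    (M.stepKernel h ρ).map (fun s => s.2.2) = M.P h ∘ₖ (Kernel.id ×ₖ ρ) := by
  rw [stepKernel_eq, Kernel.map_comp]
  congr 1
  have : (fun s : Step X A => s.2.2) = Prod.snd ∘ Prod.snd := rfl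
  rw [this, Kernel.map_comp_right _ measurable_snd measurable_snd, ← Kernel.snd_eq,
    ← Kernel.snd_eq, MDP.obs, Kernel.snd_prod, Kernel.snd_prod]

lemma map_fst_stepKernel (h : ℕ) (ρ : Kernel X A) [IsMarkovKernel ρ] :
    (M.stepKernel h ρ).map (fun s => s.1) = Kernel.id ×ₖ ρ := by
  rw [stepKernel_eq, Kernel.map_comp]
  have : (M.obs h).map (fun s : Step X A => s.1) = Kernel.id := by
    change (M.obs h).map Prod.fst = _
    rw [← Kernel.fst_eq, MDP.obs, Kernel.fst_prod]
  rw [this, Kernel.id_comp]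

lemma map_roll_zero (n h : ℕ) :
    (M.roll π (n + 1) h).map (fun τ => τ 0) = M.stepKernel h (π.kern h) := by
  rw [MDP.roll, ← Kernel.map_comp_right _ (measurable_cons n) (measurable_pi_apply 0)]
  have : ((fun τ : Fin (n + 1) → Step X A => τ 0) ∘
      fun p : Step X A × (Fin n → Step X A) => Fin.cons (α := fun _ => Step X A) p.1 p.2) =
      Prod.fst := by ext p <;> simp
  rw [this, ← Kernel.fst_eq, Kernel.fst_compProd]

lemma map_roll_succ (n h : ℕ) (i : Fin n) :
    (M.roll π (n + 1) h).map (fun τ => τ i.succ) =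
      (M.roll π n (h + 1)).map (fun τ => τ i) ∘ₖ (M.P h ∘ₖ (Kernel.id ×ₖ π.kern h)) := by
  rw [MDP.roll, ← Kernel.map_comp_right _ (measurable_cons n) (measurable_pi_apply i.succ)]
  have : ((fun τ : Fin (n + 1) → Step X A => τ i.succ) ∘
      fun p : Step X A × (Fin n → Step X A) => Fin.cons (α := fun _ => Step X A) p.1 p.2) =
      (fun τ => τ i) ∘ Prod.snd := by ext p <;> simp
  have hm : Measurable (fun s : Step X A => s.2.2) := measurable_snd.comp measurable_snd
  rw [this, Kernel.map_comp_right _ measurable_snd (measurable_pi_apply i), ← Kernel.snd_eq,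
    show (M.roll π n (h + 1)).comap (fun p : X × Step X A => p.2.2.2)
      (measurable_snd.comp (measurable_snd.comp measurable_snd)) =
      Kernel.prodMkLeft X ((M.roll π n (h + 1)).comap (fun s : Step X A => s.2.2) hm) from rfl,
    ← Kernel.comp_eq_snd_compProd, Kernel.map_comp, ← map_snd_stepKernel M h (π.kern h),
    Kernel.comp_map _ _ hm, Kernel.comap_map_comm _ hm (measurable_pi_apply i)]

/-- The law of the `i`-th transition of a rollout. -/
lemma map_roll_apply (n h : ℕ) (i : Fin n) :
    (M.roll π n h).map (fun τ => τ i) =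
      M.stepKernel (h + i) (π.kern (h + i)) ∘ₖ M.stateLaw π h i := by
  induction n generalizing h with
  | zero => exact i.elim0
  | succ n ih =>
    refine Fin.cases ?_ (fun j => ?_) i
    · rw [map_roll_zero]; simp [MDP.stateLaw]
    · rw [map_roll_succ, ih, Fin.val_succ, MDP.stateLaw, Kernel.comp_assoc,
        show h + 1 + (j : ℕ) = h + (j + 1) by ring]

variable {H : ℕ}

lemma occ_eq (h : Fin H) :
    M.occ π h = (Kernel.id ×ₖ π.kern h) ∘ₖ M.stateLaw π 0 h := by
  have : (fun τ : Fin H → Step X A => (τ h).1) = Prod.fst ∘ fun τ => τ h := rfl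
  rw [MDP.occ, this, Kernel.map_comp_right _ (measurable_pi_apply h) measurable_fst,
    map_roll_apply, Kernel.map_comp, zero_add]
  congr 1
  exact map_fst_stepKernel M h (π.kern h)

instance (h : Fin H) : IsMarkovKernel (M.occ π h) := by
  rw [occ_eq]; infer_instance

lemma stateOcc_eq (h : Fin H) : M.stateOcc π h = M.stateLaw π 0 h := by
  have : (fun τ : Fin H → Step X A => (τ h).1.1) = Prod.fst ∘ fun τ => (τ h).1 := rfl
  rw [MDP.stateOcc, this, Kernel.map_comp_right _ (by fun_prop) measurable_fst]
  change (M.occ π h).map Prod.fst = _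
  rw [occ_eq, Kernel.map_comp, ← Kernel.fst_eq, Kernel.fst_prod, Kernel.id_comp]

instance (h : Fin H) : IsMarkovKernel (M.stateOcc π h) := by
  rw [stateOcc_eq]; infer_instance

lemma map_roll_eq_obs_comp_occ (h : Fin H) :
    (M.roll π H 0).map (fun τ => τ h) = M.obs h ∘ₖ M.occ π h := by
  rw [map_roll_apply, occ_eq, zero_add, stepKernel_eq, Kernel.comp_assoc]

lemma stateLaw_succ_eq_comp_occ (h : Fin H) :
    M.stateLaw π 0 (h + 1) = M.P h ∘ₖ M.occ π h := by
  rw [stateLaw_succ, occ_eq, zero_add, Kernel.comp_assoc]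

end Roll

/-- Truncation to `[0, B]`. -/
def clamp (B z : ℝ) : ℝ := max 0 (min B z)

lemma clamp_of_mem {B z : ℝ} (hz : z ∈ Set.Icc 0 B) : clamp B z = z := by
  rw [clamp, min_eq_right hz.2, max_eq_right hz.1]

lemma bddMeas_clamp {B : ℝ} (hB : 0 ≤ B) : BddMeas (clamp B) :=
  BddMeas.of_mem_Icc (B := B) (by unfold clamp; fun_prop) (fun _ => le_max_left _ _)
    fun _ => max_le hB (min_le_left _ _)

/-! ### Martingale decomposition of the return. -/

section Martingale

variable {X A : Type*} [MeasurableSpace X] [MeasurableSpace A] (M : MDP X A) (π : Policy X A)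
  (w : ℕ → X → ℝ)

/-- The one-step lookahead `E[c + w_{t+1}(x')]`. -/
def MDP.lookahead (t : ℕ) (xa : X × A) : ℝ :=
  ∫ p, (clamp 1 p.1 + w (t + 1) p.2) ∂((M.C t xa).prod (M.P t xa))

/-- The one-step conditional variance `Var(c + w_{t+1}(x'))`. -/
def MDP.stepVar (t : ℕ) (xa : X × A) : ℝ :=
  ∫ p, (clamp 1 p.1 + w (t + 1) p.2 - M.lookahead w t xa) ^ 2 ∂((M.C t xa).prod (M.P t xa))

/-- The martingale part of the return, relative to the potentials `w`. -/
def MDP.resid (n h : ℕ) (x : X) (τ : Fin n → Step X A) : ℝ :=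
  ∑ i, clamp 1 (τ i).2.1 - w h x -
    ∑ i : Fin n, (M.lookahead w (h + i) (τ i).1 - w (h + i) (τ i).1.1)

variable {w}

lemma bddMeas_clamp_add (t : ℕ) (hw : BddMeas (w (t + 1))) :
    BddMeas (fun p : ℝ × X => clamp 1 p.1 + w (t + 1) p.2) :=
  ((bddMeas_clamp zero_le_one).comp measurable_fst).add (hw.comp measurable_snd)

lemma bddMeas_lookahead (t : ℕ) (hw : BddMeas (w (t + 1))) : BddMeas (M.lookahead w t) := by
  have := (bddMeas_clamp_add t hw).integral_kernel (M.C t ×ₖ M.P t)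
  simp only [Kernel.prod_apply] at this
  exact this

lemma bddMeas_stepVar (t : ℕ) (hw : BddMeas (w (t + 1))) : BddMeas (M.stepVar w t) := by
  have := BddMeas.integral_kernel_prod (φ := fun q : (X × A) × ℝ × X =>
    (clamp 1 q.2.1 + w (t + 1) q.2.2 - M.lookahead w t q.1) ^ 2)
    ((((bddMeas_clamp_add t hw).comp measurable_snd).sub
      ((bddMeas_lookahead M t hw).comp measurable_fst)).sq) (M.C t ×ₖ M.P t)
  simp only [Kernel.prod_apply] at this
  exact this

lemma stepVar_nonneg (t : ℕ) (xa : X × A) : 0 ≤ M.stepVar w t xa :=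
  integral_nonneg fun _ => sq_nonneg _

lemma bddMeas_resid (hw : ∀ t, BddMeas (w t)) (n h : ℕ) (x : X) :
    BddMeas (M.resid w n h x) := by
  refine ((BddMeas.sum _ fun i _ => ?_).sub (BddMeas.const _)).sub (BddMeas.sum _ fun i _ => ?_)
  · exact (bddMeas_clamp zero_le_one).comp (by fun_prop)
  · exact ((bddMeas_lookahead M _ (hw _)).comp (by fun_prop)).sub ((hw _).comp (by fun_prop))

/-- The bracket `w h s.1.1 - w h x` vanishes for a transition that starts at x, but the identity is
needed for every s before integrating. -/
lemma resid_cons (n h : ℕ) (x : X) (s : Step X A) (τ : Fin n → Step X A) :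
    M.resid w (n + 1) h x (Fin.cons (α := fun _ => Step X A) s τ) =
      (clamp 1 s.2.1 + w (h + 1) s.2.2 - M.lookahead w h s.1 + (w h s.1.1 - w h x)) +
        M.resid w n (h + 1) s.2.2 τ := by
  have e : ∀ i : Fin n, h + ((i : ℕ) + 1) = h + 1 + i := fun i => by ring
  rw [MDP.resid, Fin.sum_univ_succ, Fin.sum_univ_succ]
  simp only [Fin.cons_zero, Fin.cons_succ, Fin.val_zero, Fin.val_succ, add_zero, e]
  rw [MDP.resid]
  ring

/-- The increments `c + w(x') - lookahead` have conditional mean zero given the state-action pair,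
so `resid` has mean zero and its second moment is the sum of the expected one-step variances. The
potential must vanish at the end for the telescoping sum to close. -/
lemma integral_resid (hw : ∀ t, BddMeas (w t)) (n h : ℕ) (hend : ∀ x, w (h + n) x = 0) (x : X) :
    ∫ τ, M.resid w n h x τ ∂(M.roll π n h x) = 0 ∧
    ∫ τ, M.resid w n h x τ ^ 2 ∂(M.roll π n h x) =
      ∫ τ, ∑ i : Fin n, M.stepVar w (h + i) (τ i).1 ∂(M.roll π n h x) := by
  induction n generalizing h x with
  | zero =>
    have h0 : ∀ τ, M.resid w 0 h x τ = 0 := fun τ => by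
      have := hend x
      rw [add_zero] at this
      simp [MDP.resid, this]
    simp [h0]
  | succ n ih =>
    have ih' := ih (h + 1) (fun x => by rw [show h + 1 + n = h + (n + 1) by ring]; exact hend x)
    have hR := bddMeas_resid M hw (n + 1) h x
    have hζ : BddMeas (fun s : Step X A =>
        clamp 1 s.2.1 + w (h + 1) s.2.2 - M.lookahead w h s.1 + (w h s.1.1 - w h x)) :=
      (((bddMeas_clamp_add h (hw _)).comp (by fun_prop)).sub
        ((bddMeas_lookahead M h (hw _)).comp (by fun_prop))).add
        (((hw h).comp (by fun_prop)).sub (BddMeas.const _))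
    have hN : BddMeas (fun x' : X => ∫ τ, ∑ i : Fin n, M.stepVar w (h + 1 + i) (τ i).1
        ∂(M.roll π n (h + 1) x')) :=
      BddMeas.integral_kernel (BddMeas.sum _ fun i _ =>
        (bddMeas_stepVar M _ (hw _)).comp (by fun_prop)) _
    have hS := bddMeas_stepVar M h (hw (h + 1))
    constructor
    · rw [integral_roll_succ M π hR]
      have inner : ∀ s : Step X A, ∫ τ, M.resid w (n + 1) h x
          (Fin.cons (α := fun _ => Step X A) s τ) ∂(M.roll π n (h + 1) s.2.2) =
          clamp 1 s.2.1 + w (h + 1) s.2.2 - M.lookahead w h s.1 + (w h s.1.1 - w h x) := by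
        intro s
        simp only [resid_cons]
        rw [integral_add (integrable_const _) ((bddMeas_resid M hw n (h + 1) s.2.2).integrable _),
          (ih' s.2.2).1]
        simp
      simp only [inner]
      rw [integral_stepKernel M hζ]
      simp only [sub_self, add_zero]
      refine integral_eq_zero_of_ae (Filter.Eventually.of_forall fun a => ?_)
      change ∫ p : ℝ × X, (clamp 1 p.1 + w (h + 1) p.2 - M.lookahead w h (x, a))
        ∂((M.C h (x, a)).prod (M.P h (x, a))) = 0
      rw [integral_sub ((bddMeas_clamp_add h (hw _)).integrable _) (integrable_const _)]
      simp [MDP.lookahead]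
    · rw [integral_roll_succ M π hR.sq, integral_roll_succ M π (BddMeas.sum _ fun i _ =>
        (bddMeas_stepVar M _ (hw _)).comp (by fun_prop))]
      have inner : ∀ s : Step X A, ∫ τ, M.resid w (n + 1) h x
          (Fin.cons (α := fun _ => Step X A) s τ) ^ 2 ∂(M.roll π n (h + 1) s.2.2) =
          (clamp 1 s.2.1 + w (h + 1) s.2.2 - M.lookahead w h s.1 + (w h s.1.1 - w h x)) ^ 2 +
          ∫ τ, ∑ i : Fin n, M.stepVar w (h + 1 + i) (τ i).1 ∂(M.roll π n (h + 1) s.2.2) := by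
        intro s
        obtain ⟨z, hz⟩ : ∃ z, z = clamp 1 s.2.1 + w (h + 1) s.2.2 - M.lookahead w h s.1 +
          (w h s.1.1 - w h x) := ⟨_, rfl⟩
        have hr := bddMeas_resid M hw n (h + 1) s.2.2
        -- The first increment z is constant in τ, and the cross term integrates to zero by the
        -- mean-zero part of the induction hypothesis.
        have e : ∀ τ, M.resid w (n + 1) h x (Fin.cons (α := fun _ => Step X A) s τ) ^ 2 =
            (z ^ 2 + 2 * z * M.resid w n (h + 1) s.2.2 τ) +
              M.resid w n (h + 1) s.2.2 τ ^ 2 := fun τ => by rw [resid_cons, ← hz]; ring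
        simp only [e]
        rw [integral_add (((BddMeas.const _).add ((BddMeas.const _).mul hr)).integrable _)
          (hr.sq.integrable _), integral_add (integrable_const _) ((hr.integrable _).const_mul _),
          integral_const_mul, (ih' s.2.2).1, (ih' s.2.2).2, ← hz]
        simp
      have inner' : ∀ s : Step X A, ∫ τ, ∑ i : Fin (n + 1), M.stepVar w (h + i)
          ((Fin.cons (α := fun _ => Step X A) s τ : Fin (n + 1) → Step X A) i).1
            ∂(M.roll π n (h + 1) s.2.2) =
          M.stepVar w h s.1 +
          ∫ τ, ∑ i : Fin n, M.stepVar w (h + 1 + i) (τ i).1 ∂(M.roll π n (h + 1) s.2.2) := by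
        intro s
        have e : ∀ i : Fin n, h + ((i : ℕ) + 1) = h + 1 + i := fun i => by ring
        simp only [Fin.sum_univ_succ, Fin.cons_zero, Fin.cons_succ, Fin.val_zero, Fin.val_succ,
          add_zero, e]
        rw [integral_add (integrable_const _) ((BddMeas.sum _ fun i _ =>
          (bddMeas_stepVar M _ (hw _)).comp (by fun_prop)).integrable _)]
        simp
      simp only [inner, inner']
      have hN' := hN.comp (g := fun s : Step X A => s.2.2) (by fun_prop)
      have hS' := hS.comp (g := fun s : Step X A => s.1) (by fun_prop)
      rw [integral_add (hζ.sq.integrable _) (hN'.integrable _),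
        integral_add (hS'.integrable _) (hN'.integrable _), integral_stepKernel M hζ.sq,
        integral_stepKernel M hS']
      simp only [sub_self, add_zero, integral_const, probReal_univ, one_smul]
      rfl

lemma integral_sum_roll {H : ℕ} {φ : Fin H → X × A → ℝ} (hφ : ∀ h, BddMeas (φ h)) (x : X) :
    ∫ τ, ∑ h, φ h (τ h).1 ∂(M.roll π H 0 x) = ∑ h, ∫ xa, φ h xa ∂(M.occ π h x) := by
  rw [integral_finsetSum _ fun h _ => ((hφ h).comp (by fun_prop)).integrable _]
  refine Finset.sum_congr rfl fun h _ => ?_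
  rw [MDP.occ, Kernel.map_apply _ (by fun_prop), integral_map
    (by fun_prop : Measurable fun τ : Fin H → Step X A => (τ h).1).aemeasurable
    (hφ h).measurable.aestronglyMeasurable]

/-- Each cost lies in [0,1] almost surely, so truncation gives an everywhere bounded version of the
return. -/
lemma ae_ret_eq (H : ℕ) (x : X) :
    ∀ᵐ τ ∂(M.roll π H 0 x), ret τ = ∑ h, clamp 1 (τ h).2.1 := by
  have h1 : ∀ h : Fin H, ∀ᵐ τ ∂(M.roll π H 0 x), (τ h).2.1 ∈ Set.Icc (0 : ℝ) 1 := by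
    intro h
    have hm : MeasurableSet {s : Step X A | s.2.1 ∈ Set.Icc (0 : ℝ) 1} :=
      measurableSet_Icc.preimage (by fun_prop : Measurable fun s : Step X A => s.2.1)
    have : ∀ᵐ s ∂(((M.roll π H 0).map (fun τ => τ h)) x), s.2.1 ∈ Set.Icc (0 : ℝ) 1 := by
      rw [map_roll_eq_obs_comp_occ]
      refine Kernel.ae_comp_of_ae_ae hm (Filter.Eventually.of_forall fun xa => ?_)
      rw [MDP.obs, id_prod_apply, ae_map_iff (by fun_prop) hm, Kernel.prod_apply]
      exact Measure.quasiMeasurePreserving_fst.ae (M.cost_mem h xa)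
    rw [Kernel.map_apply _ (measurable_pi_apply h)] at this
    exact ae_of_ae_map (measurable_pi_apply h).aemeasurable this
  filter_upwards [ae_all_iff.2 h1] with τ hτ
  exact Finset.sum_congr rfl fun h _ => (clamp_of_mem (hτ h)).symm

/-- Performance difference: the value minus a potential is the expected sum of the one-step
Bellman residuals. -/
lemma value_sub_eq {H : ℕ} (hw : ∀ t, BddMeas (w t)) (hend : ∀ x, w H x = 0) (x : X) :
    M.value H π x - w 0 x =
      ∑ h : Fin H, ∫ xa, (M.lookahead w h xa - w h xa.1) ∂(M.occ π h x) := by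
  have h0 := (integral_resid M π hw H 0 (by simpa using hend) x).1
  have hb : ∀ h : Fin H, BddMeas (fun xa : X × A => M.lookahead w h xa - w h xa.1) := fun h =>
    (bddMeas_lookahead M _ (hw _)).sub ((hw _).comp measurable_fst)
  have hc : BddMeas (fun τ : Fin H → Step X A => ∑ h, clamp 1 (τ h).2.1) :=
    BddMeas.sum _ fun h _ => (bddMeas_clamp zero_le_one).comp (by fun_prop)
  rw [← integral_sum_roll M π hb, MDP.value, integral_congr_ae (ae_ret_eq M π H x)]
  have hbs : BddMeas (fun τ : Fin H → Step X A =>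
      ∑ h : Fin H, (M.lookahead w h (τ h).1 - w h (τ h).1.1)) :=
    BddMeas.sum _ fun h _ => (hb h).comp (g := fun τ : Fin H → Step X A => (τ h).1) (by fun_prop)
  simp only [MDP.resid, zero_add] at h0
  rw [integral_sub ((hc.sub (BddMeas.const _)).integrable _) (hbs.integrable _),
    integral_sub (hc.integrable _) (integrable_const _)] at h0
  simp only [integral_const, probReal_univ, one_smul] at h0
  linarith

/-- The accumulated one-step variances are controlled by the variance of the return. -/
lemma sum_stepVar_le {H : ℕ} (hw : ∀ t, BddMeas (w t)) (hend : ∀ x, w H x = 0) (x : X) :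
    ∑ h : Fin H, ∫ xa, M.stepVar w h xa ∂(M.occ π h x) ≤
      2 * M.returnVar H π x +
        2 * H * ∑ h : Fin H, ∫ xa, (M.lookahead w h xa - w h xa.1) ^ 2 ∂(M.occ π h x) := by
  have h0 := (integral_resid M π hw H 0 (by simpa using hend) x).2
  simp only [zero_add] at h0
  rw [integral_sum_roll M π (fun h => bddMeas_stepVar M h (hw _))] at h0
  rw [← h0]
  have hb : ∀ h : Fin H, BddMeas (fun xa : X × A => M.lookahead w h xa - w h xa.1) := fun h =>
    (bddMeas_lookahead M _ (hw _)).sub ((hw _).comp measurable_fst)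
  have hc : BddMeas (fun τ : Fin H → Step X A => ∑ h, clamp 1 (τ h).2.1) :=
    BddMeas.sum _ fun h _ => (bddMeas_clamp zero_le_one).comp (by fun_prop)
  have hbs : BddMeas (fun τ : Fin H → Step X A =>
      ∑ h : Fin H, (M.lookahead w h (τ h).1 - w h (τ h).1.1)) :=
    BddMeas.sum _ fun h _ => (hb h).comp (g := fun τ : Fin H → Step X A => (τ h).1) (by fun_prop)
  have hbs2 : BddMeas (fun τ : Fin H → Step X A =>
      ∑ h : Fin H, (M.lookahead w h (τ h).1 - w h (τ h).1.1) ^ 2) :=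
    BddMeas.sum _ fun h _ =>
      (hb h).sq.comp (g := fun τ : Fin H → Step X A => (τ h).1) (by fun_prop)
  have hV : M.value H π x = ∫ τ, ∑ h, clamp 1 (τ h).2.1 ∂(M.roll π H 0 x) := by
    rw [MDP.value, integral_congr_ae (ae_ret_eq M π H x)]
  have hVar : M.returnVar H π x =
      ∫ τ, (∑ h, clamp 1 (τ h).2.1 - M.value H π x) ^ 2 ∂(M.roll π H 0 x) := by
    rw [MDP.returnVar, variance_congr (ae_ret_eq M π H x),
      variance_eq_integral hc.measurable.aemeasurable, hV]
  have hm : M.value H π x - w 0 x = ∫ τ, ∑ h : Fin H,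
      (M.lookahead w h (τ h).1 - w h (τ h).1.1) ∂(M.roll π H 0 x) := by
    rw [value_sub_eq M π hw hend, ← integral_sum_roll M π hb]
  -- The constant `V - w_0` is the mean of the sum of residuals, so the left side is a variance and
  -- is at most the second moment.
  have hvar2 : ∫ τ, (∑ h : Fin H, (M.lookahead w h (τ h).1 - w h (τ h).1.1) -
      (M.value H π x - w 0 x)) ^ 2 ∂(M.roll π H 0 x) ≤
      ∫ τ, (∑ h : Fin H, (M.lookahead w h (τ h).1 - w h (τ h).1.1)) ^ 2
        ∂(M.roll π H 0 x) := by
    rw [hm, ← variance_eq_integral hbs.measurable.aemeasurable]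
    exact variance_le_expectation_sq hbs.measurable.aestronglyMeasurable
  have hsq : ∫ τ, (∑ h : Fin H, (M.lookahead w h (τ h).1 - w h (τ h).1.1)) ^ 2
        ∂(M.roll π H 0 x) ≤
      H * ∑ h : Fin H, ∫ xa, (M.lookahead w h xa - w h xa.1) ^ 2 ∂(M.occ π h x) := by
    rw [← integral_sum_roll M π fun h => (hb h).sq, ← integral_const_mul]
    refine integral_mono (hbs.sq.integrable _) ((hbs2.integrable _).const_mul _) fun τ => ?_
    have := sq_sum_le_card_mul_sum_sq (s := Finset.univ)
      (f := fun h : Fin H => M.lookahead w h (τ h).1 - w h (τ h).1.1)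
    simpa using this
  -- The martingale part is the centred return minus the centred sum of residuals; use (u - v)² ≤
  -- 2u² + 2v².
  have hsplit : ∫ τ, M.resid w H 0 x τ ^ 2 ∂(M.roll π H 0 x) ≤
      ∫ τ, (2 * (∑ h, clamp 1 (τ h).2.1 - M.value H π x) ^ 2 +
        2 * (∑ h : Fin H, (M.lookahead w h (τ h).1 - w h (τ h).1.1) -
          (M.value H π x - w 0 x)) ^ 2) ∂(M.roll π H 0 x) := by
    refine integral_mono ((bddMeas_resid M hw H 0 x).sq.integrable _)
      ((((hc.sub (BddMeas.const _)).sq.integrable _).const_mul 2).add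
        (((hbs.sub (BddMeas.const _)).sq.integrable _).const_mul 2)) fun τ => ?_
    simp only [MDP.resid, zero_add]
    obtain ⟨u, hu⟩ : ∃ u, u = ∑ h, clamp 1 (τ h).2.1 := ⟨_, rfl⟩
    obtain ⟨v, hv⟩ : ∃ v, v = ∑ h : Fin H, (M.lookahead w h (τ h).1 - w h (τ h).1.1) := ⟨_, rfl⟩
    rw [← hu, ← hv]
    nlinarith [sq_nonneg ((u - M.value H π x) + (v - (M.value H π x - w 0 x)))]
  rw [integral_add (((hc.sub (BddMeas.const _)).sq.integrable _).const_mul 2)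
        (((hbs.sub (BddMeas.const _)).sq.integrable _).const_mul 2), integral_const_mul,
    integral_const_mul, ← hVar] at hsplit
  nlinarith

end Martingale

/-! ### Means and variances of laws on the unit interval. -/

section UnitLaw

lemma memLp_of_mem_Icc {μ : Measure ℝ} [IsFiniteMeasure μ]
    (hμ : ∀ᵐ y ∂μ, y ∈ Set.Icc (0 : ℝ) 1) : MemLp (fun y : ℝ => y) 2 μ := by
  refine MemLp.of_bound (by fun_prop) 1 ?_
  filter_upwards [hμ] with y hy
  rw [Real.norm_eq_abs, abs_le]; constructor <;> linarith [hy.1, hy.2]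

lemma integral_add_sq {μ : Measure ℝ} [IsProbabilityMeasure μ]
    (hi : MemLp (fun y : ℝ => y) 2 μ) (a : ℝ) :
    ∫ y, (a + y) ^ 2 ∂μ = (a + ∫ y, y ∂μ) ^ 2 + lawVar μ := by
  obtain ⟨n, hn⟩ : ∃ n, n = ∫ z, z ∂μ := ⟨_, rfl⟩
  have i1 : Integrable (fun y : ℝ => y) μ := hi.integrable one_le_two
  have i2 : Integrable (fun y : ℝ => (y - n) ^ 2) μ := (hi.sub (memLp_const n)).integrable_sq
  have i3 : Integrable (fun y : ℝ => 2 * (a + n) * (y - n)) μ :=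
    (i1.sub (integrable_const n)).const_mul _
  have i4 : Integrable (fun y : ℝ => (a + n) ^ 2 + 2 * (a + n) * (y - n)) μ :=
    (integrable_const _).add i3
  have e : ∫ y, (2 * (a + n) * (y - n)) ∂μ = 0 := by
    rw [integral_const_mul, integral_sub i1 (integrable_const _), ← hn]
    simp
  calc ∫ y, (a + y) ^ 2 ∂μ
      = ∫ y, (((a + n) ^ 2 + 2 * (a + n) * (y - n)) + (y - n) ^ 2) ∂μ := by
        congr 1; ext y; ring
    _ = _ := by
        rw [integral_add i4 i2, integral_add (integrable_const _) i3, e, lawVar, ← hn]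
        simp

lemma mean_mem_Icc {μ : Measure ℝ} [IsProbabilityMeasure μ]
    (hμ : ∀ᵐ y ∂μ, y ∈ Set.Icc (0 : ℝ) 1) : ∫ y, y ∂μ ∈ Set.Icc (0 : ℝ) 1 := by
  refine ⟨integral_nonneg_of_ae (by filter_upwards [hμ] with y hy using hy.1), ?_⟩
  calc _ ≤ ∫ _, (1 : ℝ) ∂μ :=
        integral_mono_ae ((memLp_of_mem_Icc hμ).integrable one_le_two) (integrable_const _)
          (by filter_upwards [hμ] with y hy using hy.2)
    _ = 1 := by simp

lemma lawVar_le_one {μ : Measure ℝ} [IsProbabilityMeasure μ]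
    (hμ : ∀ᵐ y ∂μ, y ∈ Set.Icc (0 : ℝ) 1) : lawVar μ ≤ 1 := by
  have hm := mean_mem_Icc hμ
  calc lawVar μ ≤ ∫ _, (1 : ℝ) ∂μ := by
        refine integral_mono_of_nonneg (Filter.Eventually.of_forall fun y => sq_nonneg _)
          (integrable_const _) ?_
        filter_upwards [hμ] with y hy
        simp only [sq_le_one_iff_abs_le_one, abs_le]
        constructor <;> linarith [hy.1, hy.2, hm.1, hm.2]
    _ = 1 := by simp

variable {E : Type*} [MeasurableSpace E] {d : Kernel E ℝ} [IsMarkovKernel d]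

lemma bddMeas_mean (hd : ∀ x, ∀ᵐ y ∂(d x), y ∈ Set.Icc (0 : ℝ) 1) :
    BddMeas (fun x => ∫ y, y ∂(d x)) :=
  BddMeas.of_mem_Icc (StronglyMeasurable.integral_kernel (κ := d) (f := fun y : ℝ => y)
    stronglyMeasurable_id).measurable (fun x => (mean_mem_Icc (hd x)).1)
    fun x => (mean_mem_Icc (hd x)).2

lemma bddMeas_lawVar (hd : ∀ x, ∀ᵐ y ∂(d x), y ∈ Set.Icc (0 : ℝ) 1) :
    BddMeas (fun x => lawVar (d x)) := by
  have hm := (bddMeas_mean hd).measurable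
  refine BddMeas.of_mem_Icc ?_ (fun x => lawVar_nonneg _) fun x => lawVar_le_one (hd x)
  exact (StronglyMeasurable.integral_kernel_prod_right' (κ := d)
    (f := fun p : E × ℝ => (p.2 - ∫ y, y ∂(d p.1)) ^ 2)
    ((measurable_snd.sub (hm.comp measurable_fst)).pow_const 2).stronglyMeasurable).measurable

end UnitLaw

/-! ### The Bellman optimality operator: support, mean and variance. -/

section Bellman

variable {X A : Type*} [MeasurableSpace X] [MeasurableSpace A] (M : MDP X A)
  (am : ArgminRule A)

lemma measurable_greedyAct (d : Kernel (X × A) ℝ) : Measurable (greedyAct am d) :=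
  am.measurable_act.comp (measurable_mean d)

lemma measurable_graph_greedyAct (d : Kernel (X × A) ℝ) :
    Measurable (fun x => (x, greedyAct am d x)) :=
  measurable_id.prodMk (measurable_greedyAct am d)

/-- The law of the greedy action's value at `x`. -/
def greedyLaw (d : Kernel (X × A) ℝ) : Kernel X ℝ :=
  d.comap (fun x => (x, greedyAct am d x)) (measurable_graph_greedyAct am d)

instance (d : Kernel (X × A) ℝ) [IsMarkovKernel d] : IsMarkovKernel (greedyLaw am d) := by
  unfold greedyLaw; infer_instance

lemma id_prod_greedyKernel (d : Kernel (X × A) ℝ) :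
    Kernel.id ×ₖ greedyKernel am d =
      Kernel.deterministic (fun x => (x, greedyAct am d x)) (measurable_graph_greedyAct am d) :=
  Kernel.deterministic_prod_deterministic measurable_id (measurable_greedyAct am d)

/-- The greedy action is a function of the next state, so drawing it and then the value is a single
kernel from states to values. -/
lemma bellmanOpt_eq (h : ℕ) (d : Kernel (X × A) ℝ) :
    M.bellmanOpt am h d = (M.C h ×ₖ (greedyLaw am d ∘ₖ M.P h)).map (fun p => p.1 + p.2) := by
  rw [MDP.bellmanOpt, MDP.bellman, id_prod_greedyKernel, ← Kernel.comp_assoc,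
    Kernel.comp_deterministic_eq_comap]
  rfl

lemma integral_bellmanOpt {φ : ℝ → ℝ} (hφ : BddMeas φ) (h : ℕ) (d : Kernel (X × A) ℝ)
    [IsMarkovKernel d] (xa : X × A) :
    ∫ z, φ z ∂(M.bellmanOpt am h d xa) =
      ∫ p, ∫ y, φ (p.1 + y) ∂(greedyLaw am d p.2) ∂((M.C h xa).prod (M.P h xa)) := by
  have hadd : Measurable (fun p : ℝ × ℝ => p.1 + p.2) := by fun_prop
  have hin : BddMeas (fun p : ℝ × X => ∫ y, φ (p.1 + y) ∂(greedyLaw am d p.2)) :=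
    BddMeas.integral_kernel_prod (φ := fun q : (ℝ × X) × ℝ => φ (q.1.1 + q.2))
      (hφ.comp (by fun_prop)) ((greedyLaw am d).comap Prod.snd measurable_snd)
  rw [bellmanOpt_eq, Kernel.map_apply _ hadd,
    integral_map hadd.aemeasurable hφ.measurable.aestronglyMeasurable, Kernel.prod_apply,
    integral_prod _ ((hφ.comp hadd).integrable _), integral_prod _ (hin.integrable _)]
  congr 1
  ext c
  exact integral_kernel_comp (hφ.comp (by fun_prop)) _ _ _

lemma lintegral_bellmanOpt {φ : ℝ → ℝ≥0∞} (hφ : Measurable φ) (h : ℕ) (d : Kernel (X × A) ℝ)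
    [IsMarkovKernel d] (xa : X × A) :
    ∫⁻ z, φ z ∂(M.bellmanOpt am h d xa) =
      ∫⁻ c, ∫⁻ x', ∫⁻ y, φ (c + y) ∂(greedyLaw am d x') ∂(M.P h xa) ∂(M.C h xa) := by
  have hadd : Measurable (fun p : ℝ × ℝ => p.1 + p.2) := by fun_prop
  rw [bellmanOpt_eq, Kernel.map_apply _ hadd, lintegral_map hφ hadd, Kernel.prod_apply,
    lintegral_prod _ (by fun_prop)]
  congr 1
  ext c
  exact Kernel.lintegral_comp _ _ _ (by fun_prop)

variable {lam : Measure ℝ} {H : ℕ}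

lemma CondDens.isDensity (f : CondDens X A lam) (xa : X × A) : IsDensity lam (f.dens xa) :=
  ⟨f.measurable_dens.comp measurable_prodMk_left, f.lintegral_eq_one xa⟩

lemma CondDens.law_apply [SFinite lam] (f : CondDens X A lam) (xa : X × A) :
    f.law xa = densLaw lam (f.dens xa) := by
  rw [CondDens.law, Kernel.withDensity_apply _ f.measurable_dens.coe_nnreal_ennreal,
    Kernel.const_apply]
  rfl

instance [SFinite lam] (f : CondDens X A lam) : IsMarkovKernel f.law :=
  ⟨fun xa => by rw [f.law_apply]; exact isProbabilityMeasure_densLaw (f.isDensity xa)⟩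

lemma lawAt_of_lt [SFinite lam] (f : Fin H → CondDens X A lam) (h : Fin H) :
    lawAt f h = (f h).law := by simp [lawAt]

lemma lawAt_end [SFinite lam] (f : Fin H → CondDens X A lam) :
    lawAt f H = Kernel.const (X × A) (Measure.dirac 0) := by simp [lawAt]

instance [SFinite lam] (f : Fin H → CondDens X A lam) (n : ℕ) : IsMarkovKernel (lawAt f n) := by
  unfold lawAt
  split_ifs
  · infer_instance
  · infer_instance

lemma ae_law [SFinite lam] (hlam : lam (Set.Icc (0 : ℝ) 1)ᶜ = 0) (f : CondDens X A lam)
    (xa : X × A) : ∀ᵐ y ∂(f.law xa), y ∈ Set.Icc (0 : ℝ) 1 := by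
  rw [f.law_apply]; exact ae_densLaw hlam

lemma ae_lawAt [SFinite lam] (hlam : lam (Set.Icc (0 : ℝ) 1)ᶜ = 0)
    (f : Fin H → CondDens X A lam) (n : ℕ) (xa : X × A) :
    ∀ᵐ y ∂(lawAt f n xa), y ∈ Set.Icc (0 : ℝ) 1 := by
  unfold lawAt
  split_ifs
  · exact ae_law hlam _ xa
  · rw [Kernel.const_apply, ae_dirac_eq, Filter.eventually_pure]; simp

lemma triDisc_law [SigmaFinite lam] (f g : CondDens X A lam) (xa : X × A) :
    triDisc lam (f.law xa) (g.law xa) = triDens lam (f.dens xa) (g.dens xa) := by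
  rw [f.law_apply, g.law_apply, triDisc, triDens]
  have e := fun f : CondDens X A lam => Measure.rnDeriv_withDensity lam
    (f.isDensity xa).measurable.coe_nnreal_ennreal
  refine integral_congr_ae ?_
  filter_upwards [e f, e g] with y hf hg
  simp only [densLaw, hf, hg, ENNReal.coe_toReal]

lemma bddMeas_triDens [SFinite lam] (f g : CondDens X A lam) :
    BddMeas (fun xa => triDens lam (f.dens xa) (g.dens xa)) := by
  refine BddMeas.of_mem_Icc ?_ (fun _ => triDens_nonneg)
    fun xa => triDens_le_two (f.isDensity xa) (g.isDensity xa)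
  have hf : Measurable (fun p : (X × A) × ℝ => (f.dens p.1 p.2 : ℝ)) :=
    f.measurable_dens.coe_nnreal_real
  have hg : Measurable (fun p : (X × A) × ℝ => (g.dens p.1 p.2 : ℝ)) :=
    g.measurable_dens.coe_nnreal_real
  exact (StronglyMeasurable.integral_prod_right' (ν := lam) (f := fun p : (X × A) × ℝ =>
    ((f.dens p.1 p.2 : ℝ) - g.dens p.1 p.2) ^ 2 / ((f.dens p.1 p.2 : ℝ) + g.dens p.1 p.2))
    (((hf.sub hg).pow_const 2).div (hf.add hg)).stronglyMeasurable).measurable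

variable [SFinite lam]

/-- `min_a f̄_t(x,a)`. -/
def potential (f : Fin H → CondDens X A lam) (t : ℕ) (x : X) : ℝ :=
  ∫ y, y ∂(greedyLaw am (lawAt f t) x)

lemma potential_le (f : Fin H → CondDens X A lam) (t : ℕ) (x : X) (a : A) :
    potential am f t x ≤ mean (lawAt f t) x a :=
  am.act_le (mean (lawAt f t) x) a

lemma optimisticValue_eq [Finite A] [Nonempty A] (f : Fin H → CondDens X A lam) (x : X) :
    optimisticValue f x = potential am f 0 x :=
  le_antisymm (ciInf_le (Set.finite_range _).bddBelow _) (le_ciInf fun a => potential_le am f 0 x a)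

lemma ae_greedyLaw (hlam : lam (Set.Icc (0 : ℝ) 1)ᶜ = 0) (f : Fin H → CondDens X A lam) (t : ℕ)
    (x : X) : ∀ᵐ y ∂(greedyLaw am (lawAt f t) x), y ∈ Set.Icc (0 : ℝ) 1 :=
  ae_lawAt hlam f t _

lemma bddMeas_potential (hlam : lam (Set.Icc (0 : ℝ) 1)ᶜ = 0) (f : Fin H → CondDens X A lam)
    (t : ℕ) : BddMeas (potential am f t) :=
  bddMeas_mean (ae_greedyLaw am hlam f t)

lemma potential_end (f : Fin H → CondDens X A lam) (x : X) : potential am f H x = 0 := by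
  rw [potential, lawAt_end]
  change ∫ y, y ∂(Measure.dirac (0 : ℝ)) = 0
  simp

lemma lawVar_greedyLaw_end (f : Fin H → CondDens X A lam) (x : X) :
    lawVar (greedyLaw am (lawAt f H) x) = 0 := by
  rw [lawAt_end]
  change lawVar (Measure.dirac (0 : ℝ)) = 0
  simp [lawVar]

/-- Allows unbounded φ such as z or (z - m)². A cost and a value in [0,1] have a sum in [0,2], so
truncation at 2 changes neither side almost surely and reduces to the bounded formula. -/
lemma integral_congr_bellmanOpt (hlam : lam (Set.Icc (0 : ℝ) 1)ᶜ = 0)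
    (f : Fin H → CondDens X A lam) (h : ℕ) (xa : X × A) {φ : ℝ → ℝ}
    (hφ : BddMeas fun z => φ (clamp 2 z))
    (hsupp : ∀ᵐ z ∂(M.bellmanOpt am h (lawAt f (h + 1)) xa), z ∈ Set.Icc (0 : ℝ) 1) :
    ∫ z, φ z ∂(M.bellmanOpt am h (lawAt f (h + 1)) xa) =
      ∫ p, ∫ y, φ (clamp 1 p.1 + y) ∂(greedyLaw am (lawAt f (h + 1)) p.2)
        ∂((M.C h xa).prod (M.P h xa)) := by
  have e1 : ∫ z, φ z ∂(M.bellmanOpt am h (lawAt f (h + 1)) xa) =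
      ∫ z, φ (clamp 2 z) ∂(M.bellmanOpt am h (lawAt f (h + 1)) xa) := by
    refine integral_congr_ae ?_
    filter_upwards [hsupp] with z hz
    rw [clamp_of_mem ⟨hz.1, hz.2.trans one_le_two⟩]
  rw [e1, integral_bellmanOpt M am hφ]
  refine integral_congr_ae ?_
  have hc : ∀ᵐ p ∂((M.C h xa).prod (M.P h xa)), p.1 ∈ Set.Icc (0 : ℝ) 1 :=
    Measure.quasiMeasurePreserving_fst.ae (M.cost_mem h xa)
  filter_upwards [hc] with p hp
  refine integral_congr_ae ?_
  filter_upwards [ae_greedyLaw am hlam f (h + 1) p.2] with y hy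
  rw [clamp_of_mem hp, clamp_of_mem ⟨add_nonneg hp.1 hy.1, by linarith [hp.2, hy.2]⟩]

lemma mean_bellmanOpt (hlam : lam (Set.Icc (0 : ℝ) 1)ᶜ = 0)
    (f : Fin H → CondDens X A lam) (h : ℕ) (xa : X × A)
    (hsupp : ∀ᵐ z ∂(M.bellmanOpt am h (lawAt f (h + 1)) xa), z ∈ Set.Icc (0 : ℝ) 1) :
    ∫ z, z ∂(M.bellmanOpt am h (lawAt f (h + 1)) xa) =
      M.lookahead (potential am f) h xa := by
  rw [integral_congr_bellmanOpt M am hlam f h xa (φ := fun z => z)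
    (bddMeas_clamp zero_le_two) hsupp, MDP.lookahead]
  congr 1
  ext p
  rw [integral_add (integrable_const _)
    ((memLp_of_mem_Icc (ae_greedyLaw am hlam f (h + 1) p.2)).integrable one_le_two)]
  simp [potential]

/-- Law of total variance for the distributional Bellman operator. -/
lemma lawVar_bellmanOpt (hlam : lam (Set.Icc (0 : ℝ) 1)ᶜ = 0)
    (f : Fin H → CondDens X A lam) (h : ℕ) (xa : X × A)
    (hsupp : ∀ᵐ z ∂(M.bellmanOpt am h (lawAt f (h + 1)) xa), z ∈ Set.Icc (0 : ℝ) 1) :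
    lawVar (M.bellmanOpt am h (lawAt f (h + 1)) xa) =
      M.stepVar (potential am f) h xa +
        ∫ x', lawVar (greedyLaw am (lawAt f (h + 1)) x') ∂(M.P h xa) := by
  have hw := bddMeas_potential am hlam f (h + 1)
  have hU := bddMeas_lawVar (ae_greedyLaw am hlam f (h + 1))
  rw [lawVar, mean_bellmanOpt M am hlam f h xa hsupp,
    integral_congr_bellmanOpt M am hlam f h xa
      (φ := fun z => (z - M.lookahead (potential am f) h xa) ^ 2)
      ((bddMeas_clamp zero_le_two).sub (BddMeas.const _)).sq hsupp]
  have inner : ∀ p : ℝ × X,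
      ∫ y, (clamp 1 p.1 + y - M.lookahead (potential am f) h xa) ^ 2
        ∂(greedyLaw am (lawAt f (h + 1)) p.2) =
      (clamp 1 p.1 + potential am f (h + 1) p.2 - M.lookahead (potential am f) h xa) ^ 2 +
        lawVar (greedyLaw am (lawAt f (h + 1)) p.2) := by
    intro p
    have := integral_add_sq (memLp_of_mem_Icc (ae_greedyLaw am hlam f (h + 1) p.2))
      (clamp 1 p.1 - M.lookahead (potential am f) h xa)
    rw [show (fun y : ℝ => (clamp 1 p.1 + y - M.lookahead (potential am f) h xa) ^ 2) =
      fun y => (clamp 1 p.1 - M.lookahead (potential am f) h xa + y) ^ 2 by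
        ext y; ring, this, potential]
    ring
  simp only [inner]
  have hU' := hU.comp (g := fun p : ℝ × X => p.2) measurable_snd
  rw [integral_add ((((bddMeas_clamp_add h hw).sub (BddMeas.const _)).sq).integrable _)
    (hU'.integrable _), integral_prod _ (hU'.integrable _), MDP.stepVar]
  simp

end Bellman

lemma triDens_comm {lam : Measure ℝ} (p q : ℝ → ℝ≥0) : triDens lam p q = triDens lam q p := by
  unfold triDens
  congr 1
  ext y
  rw [← neg_sub, neg_sq, add_comm]

lemma one_add_inv_pow_le {H : ℕ} (hH : 0 < H) : (1 + 1 / (H : ℝ)) ^ H ≤ 3 := by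
  have hHr : (0 : ℝ) < H := by exact_mod_cast hH
  calc (1 + 1 / (H : ℝ)) ^ H ≤ (Real.exp (1 / H)) ^ H :=
        pow_le_pow_left₀ (by positivity) (by linarith [Real.add_one_le_exp (1 / (H : ℝ))]) H
    _ = Real.exp 1 := by rw [← Real.exp_nat_mul]; congr 1; field_simp
    _ ≤ 3 := by linarith [Real.exp_one_lt_d9]

/-- A backward Grönwall argument: the factor 1 + 1/H is applied at most H times, hence compounds to
at most e ≤ 3. -/
lemma le_of_backward_recursion {H : ℕ} (hH : 0 < H) {v u : ℕ → ℝ} (hu : ∀ t, 0 ≤ u t)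
    (hend : v H = 0) (hrec : ∀ t < H, v t ≤ (1 + 1 / (H : ℝ)) * (u t + v (t + 1))) :
    ∀ t ≤ H, v t ≤ 3 * ∑ j ∈ Finset.range H, u j := by
  have hr : 1 ≤ 1 + 1 / (H : ℝ) := by
    have : 0 ≤ 1 / (H : ℝ) := by positivity
    linarith
  have key : ∀ j ≤ H, v (H - j) ≤
      (1 + 1 / (H : ℝ)) ^ j * ∑ i ∈ Finset.Ico (H - j) H, u i := by
    intro j
    induction j with
    | zero => intro _; simp [hend]
    | succ j ih =>
      intro hj
      have h1 := hrec (H - (j + 1)) (by omega)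
      have h2 := ih (by omega)
      rw [show H - (j + 1) + 1 = H - j by omega] at h1
      rw [Finset.sum_eq_sum_Ico_succ_bot (by omega : H - (j + 1) < H),
        show H - (j + 1) + 1 = H - j by omega, pow_succ']
      have h3 : 1 ≤ (1 + 1 / (H : ℝ)) ^ j := one_le_pow₀ hr
      refine h1.trans ?_
      rw [mul_assoc]
      refine mul_le_mul_of_nonneg_left ?_ (by linarith)
      nlinarith [hu (H - (j + 1))]
  intro t ht
  have h1 := key (H - t) (by omega)
  rw [show H - (H - t) = t by omega] at h1
  have hsub : ∑ i ∈ Finset.Ico t H, u i ≤ ∑ j ∈ Finset.range H, u j :=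
    Finset.sum_le_sum_of_subset_of_nonneg
      (fun i hi => Finset.mem_range.2 (Finset.mem_Ico.1 hi).2) fun i _ _ => hu i
  have hpow : (1 + 1 / (H : ℝ)) ^ (H - t) ≤ 3 :=
    (pow_le_pow_right₀ hr (by omega)).trans (one_add_inv_pow_le hH)
  refine h1.trans (mul_le_mul hpow hsub (Finset.sum_nonneg fun i _ => hu i) (by norm_num))

/-! ### Prediction gap of a greedy policy in terms of its return variance and Bellman errors. -/

section Gap

variable {X A : Type*} [MeasurableSpace X] [MeasurableSpace A] (M : MDP X A)
  (am : ArgminRule A) {lam : Measure ℝ} [SigmaFinite lam] {H : ℕ}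
  {f g : Fin H → CondDens X A lam}

/-- `g_h` is a density of `T_h^{⋆,D} f_{h+1}`, for every `h`. -/
def IsBellmanImage (f g : Fin H → CondDens X A lam) : Prop :=
  ∀ h : Fin H, M.bellmanOpt am h (lawAt f (h + 1)) = (g h).law

variable {M am}

lemma bellmanError_eq (hg : IsBellmanImage M am f g) (h : Fin H) (xa : X × A) :
    bellmanError M am f h xa = triDens lam ((f h).dens xa) ((g h).dens xa) := by
  rw [bellmanError, hg h, lawAt_of_lt, triDisc_law]

lemma bddMeas_bellmanError (hg : IsBellmanImage M am f g) (h : Fin H) :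
    BddMeas (bellmanError M am f h) := by
  rw [funext (bellmanError_eq hg h)]; exact bddMeas_triDens _ _

lemma bellmanError_nonneg (hg : IsBellmanImage M am f g) (h : Fin H) (xa : X × A) :
    0 ≤ bellmanError M am f h xa := by
  rw [bellmanError_eq hg]; exact triDens_nonneg

lemma bellmanError_le_two (hg : IsBellmanImage M am f g) (h : Fin H) (xa : X × A) :
    bellmanError M am f h xa ≤ 2 := by
  rw [bellmanError_eq hg]; exact triDens_le_two ((f h).isDensity xa) ((g h).isDensity xa)

/-- The support is inherited from the density `g h`, whose dominating measure is concentrated on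
[0,1]. -/
lemma ae_bellmanOpt (hlam : lam (Set.Icc (0 : ℝ) 1)ᶜ = 0) (hg : IsBellmanImage M am f g)
    (h : Fin H) (xa : X × A) :
    ∀ᵐ z ∂(M.bellmanOpt am h (lawAt f (h + 1)) xa), z ∈ Set.Icc (0 : ℝ) 1 := by
  rw [hg h]; exact ae_law hlam _ xa

lemma lookahead_eq (hlam : lam (Set.Icc (0 : ℝ) 1)ᶜ = 0) (hg : IsBellmanImage M am f g)
    (h : Fin H) (xa : X × A) :
    M.lookahead (potential am f) h xa = ∫ y, y ∂(densLaw lam ((g h).dens xa)) := by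
  rw [← mean_bellmanOpt M am hlam f h xa (ae_bellmanOpt hlam hg h xa), hg h, CondDens.law_apply]

lemma potential_eq (h : Fin H) (x : X) :
    potential am f h x =
      ∫ y, y ∂(densLaw lam ((f h).dens (x, greedyAct am (lawAt f h) x))) := by
  rw [← CondDens.law_apply, ← lawAt_of_lt]; rfl

variable (M am f) in
lemma integral_occ_greedy {φ : X × A → ℝ} (hφ : BddMeas φ) (h : Fin H) (x : X) :
    ∫ xa, φ xa ∂(M.occ (greedyPolicy am f) h x) =
      ∫ x', φ (x', greedyAct am (lawAt f h) x') ∂(M.stateLaw (greedyPolicy am f) 0 h x) := by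
  rw [occ_eq, integral_kernel_comp hφ]
  congr 1
  ext x'
  change ∫ z, φ z ∂((Kernel.id ×ₖ greedyKernel am (lawAt f h)) x') = _
  rw [id_prod_greedyKernel, Kernel.deterministic_apply,
    integral_dirac' _ _ hφ.measurable.stronglyMeasurable]

/-- The rollout charges only the graph of the greedy action. This restriction is essential:
`potential` agrees with the mean of `f_h` at the greedy action but may be smaller elsewhere. -/
lemma integral_occ_greedy_mono {φ χ : X × A → ℝ} (hφ : BddMeas φ) (hχ : BddMeas χ) (h : Fin H)
    (hle : ∀ x', φ (x', greedyAct am (lawAt f h) x') ≤ χ (x', greedyAct am (lawAt f h) x'))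
    (x : X) :
    ∫ xa, φ xa ∂(M.occ (greedyPolicy am f) h x) ≤
      ∫ xa, χ xa ∂(M.occ (greedyPolicy am f) h x) := by
  rw [integral_occ_greedy M am f hφ, integral_occ_greedy M am f hχ]
  exact integral_mono ((hφ.comp (measurable_graph_greedyAct am _)).integrable _)
    ((hχ.comp (measurable_graph_greedyAct am _)).integrable _) hle

variable (M am f) in
/-- The expected Bellman errors of `f` along its greedy policy. -/
def errorSum (x : X) : ℝ :=
  ∑ h : Fin H, ∫ xa, bellmanError M am f h xa ∂(M.occ (greedyPolicy am f) h x)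

variable (M am f) in
/-- The expected variance of `f_t` at step `t` of its greedy policy. -/
def varAt (x : X) (t : ℕ) : ℝ :=
  ∫ x', lawVar (greedyLaw am (lawAt f t) x') ∂(M.stateLaw (greedyPolicy am f) 0 t x)

lemma bddMeas_lawVar_dens (hlam : lam (Set.Icc (0 : ℝ) 1)ᶜ = 0) (h : Fin H) :
    BddMeas (fun xa => lawVar (densLaw lam ((f h).dens xa))) := by
  have := bddMeas_lawVar (d := (f h).law) (ae_law hlam (f h))
  simpa only [CondDens.law_apply] using this

lemma varAt_eq (hlam : lam (Set.Icc (0 : ℝ) 1)ᶜ = 0) (x : X) (h : Fin H) :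
    varAt M am f x h =
      ∫ xa, lawVar (densLaw lam ((f h).dens xa)) ∂(M.occ (greedyPolicy am f) h x) := by
  rw [integral_occ_greedy M am f (bddMeas_lawVar_dens hlam h), varAt]
  congr 1
  ext x'
  rw [← CondDens.law_apply, ← lawAt_of_lt]
  rfl

/-- Compare Var(`f_h`) with the variance of its Bellman image at cost D, then split the image's
variance by the law of total variance; averaging over the rollout turns the second piece into the
quantity at the next step. -/
lemma varAt_recursion (hlam : lam (Set.Icc (0 : ℝ) 1)ᶜ = 0) (hg : IsBellmanImage M am f g)
    (x : X) (h : Fin H) :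
    varAt M am f x h ≤ (1 + 1 / (H : ℝ)) *
      ((∫ xa, M.stepVar (potential am f) h xa ∂(M.occ (greedyPolicy am f) h x) +
        2 * H * ∫ xa, bellmanError M am f h xa ∂(M.occ (greedyPolicy am f) h x)) +
        varAt M am f x (h + 1)) := by
  have hH : 0 < H := h.pos
  have hHr : (1 : ℝ) ≤ H := by exact_mod_cast hH
  have hw := bddMeas_potential am hlam f
  have hU := bddMeas_lawVar (ae_greedyLaw am hlam f (h + 1))
  have hs := bddMeas_stepVar M h (hw (h + 1))
  have hD := bddMeas_bellmanError hg h
  have hPU : BddMeas (fun xa => ∫ x', lawVar (greedyLaw am (lawAt f (h + 1)) x')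
    ∂(M.P h xa)) := hU.integral_kernel _
  have hv : varAt M am f x (h + 1) =
      ∫ xa, ∫ x', lawVar (greedyLaw am (lawAt f (h + 1)) x') ∂(M.P h xa)
        ∂(M.occ (greedyPolicy am f) h x) := by
    rw [varAt, stateLaw_succ_eq_comp_occ, integral_kernel_comp hU]
  have i1 := hs.integrable (M.occ (greedyPolicy am f) h x)
  have i2 := hD.integrable (M.occ (greedyPolicy am f) h x)
  have i3 := hPU.integrable (M.occ (greedyPolicy am f) h x)
  have i4 : Integrable (fun xa => M.stepVar (potential am f) h xa +
    2 * H * bellmanError M am f h xa) (M.occ (greedyPolicy am f) h x) := i1.add (i2.const_mul _)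
  rw [varAt_eq hlam, hv, ← integral_const_mul, ← integral_add i1 (i2.const_mul _),
    ← integral_add i4 i3, ← integral_const_mul]
  refine integral_mono ((bddMeas_lawVar_dens hlam h).integrable _)
    ((i4.add i3).const_mul _) fun xa => ?_
  have hvar := lawVar_bellmanOpt M am hlam f h xa (ae_bellmanOpt hlam hg h xa)
  rw [hg h, CondDens.law_apply] at hvar
  -- s = 1/(2H) makes the variance factor exactly 1 + 1/H, at the price 2H D.
  have key := lawVar_le hlam ((f h).isDensity xa) ((g h).isDensity xa)
    (s := 1 / (2 * H)) (by positivity) (by rw [div_le_one (by positivity)]; linarith)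
  rw [hvar] at key
  have hE := bellmanError_eq hg h xa
  simp only [hE]
  have hT := triDens_nonneg (lam := lam) (p := (f h).dens xa) (q := (g h).dens xa)
  have e1 : (1 : ℝ) + 2 * (1 / (2 * H)) = 1 + 1 / H := by field_simp
  have e2 : triDens lam ((f h).dens xa) ((g h).dens xa) / (1 / (2 * H)) =
      2 * H * triDens lam ((f h).dens xa) ((g h).dens xa) := by field_simp
  rw [e1, e2] at key
  have h4 : 0 ≤ 1 / (H : ℝ) * (2 * H * triDens lam ((f h).dens xa) ((g h).dens xa)) := by
    positivity
  linarith [h4]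

lemma sum_sq_residual_le (hlam : lam (Set.Icc (0 : ℝ) 1)ᶜ = 0) (hg : IsBellmanImage M am f g)
    (x : X) :
    ∑ h : Fin H, ∫ xa, (M.lookahead (potential am f) h xa - potential am f h xa.1) ^ 2
      ∂(M.occ (greedyPolicy am f) h x) ≤ 2 * errorSum M am f x := by
  have hw := bddMeas_potential am hlam f
  rw [errorSum, Finset.mul_sum]
  refine Finset.sum_le_sum fun h _ => ?_
  rw [← integral_const_mul]
  refine integral_occ_greedy_mono
    ((bddMeas_lookahead M h (hw _)).sub ((hw h).comp measurable_fst)).sq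
    ((BddMeas.const 2).mul (bddMeas_bellmanError hg h)) h (fun x' => ?_) x
  rw [lookahead_eq hlam hg, potential_eq, bellmanError_eq hg, triDens_comm]
  exact sq_mean_sub_le hlam ((g h).isDensity _) ((f h).isDensity _)

/-- Change of variance: the accumulated predicted variances of `f` are controlled by the variance
of the return of its greedy policy and by its Bellman errors. -/
lemma sum_varAt_le (hH : 0 < H) (hlam : lam (Set.Icc (0 : ℝ) 1)ᶜ = 0)
    (hg : IsBellmanImage M am f g) (x : X) :
    ∑ h : Fin H, varAt M am f x h ≤
      6 * H * M.returnVar H (greedyPolicy am f) x + 18 * H ^ 2 * errorSum M am f x := by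
  have hw := bddMeas_potential am hlam f
  have hHr : (1 : ℝ) ≤ H := by exact_mod_cast hH
  obtain ⟨u, hu⟩ : ∃ u : Fin H → ℝ, u = fun h : Fin H =>
      ∫ xa, M.stepVar (potential am f) h xa ∂(M.occ (greedyPolicy am f) h x) +
        2 * H * ∫ xa, bellmanError M am f h xa ∂(M.occ (greedyPolicy am f) h x) := ⟨_, rfl⟩
  have hu0 : ∀ h, 0 ≤ u h := fun h => by
    rw [hu]
    exact add_nonneg (integral_nonneg fun xa => stepVar_nonneg M h xa)
      (mul_nonneg (by positivity) (integral_nonneg fun xa => bellmanError_nonneg hg h xa))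
  have hback := le_of_backward_recursion hH (v := varAt M am f x)
    (u := fun t => if ht : t < H then u ⟨t, ht⟩ else 0)
    (fun t => by split_ifs; exacts [hu0 _, le_rfl])
    (by simp only [varAt, lawVar_greedyLaw_end, integral_zero])
    (fun t ht => by
      simp only [ht, dite_true, hu]
      exact varAt_recursion hlam hg x ⟨t, ht⟩)
  rw [Finset.sum_range] at hback
  simp only [Fin.is_lt, dite_true] at hback
  -- The unrolled bound holds at each of the H steps; summing them is the source of the extra factor
  -- H.
  have hsum : ∑ h : Fin H, varAt M am f x h ≤ H * (3 * ∑ h, u h) := by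
    calc _ ≤ ∑ _h : Fin H, (3 * ∑ h, u h) :=
          Finset.sum_le_sum fun h _ => hback h h.2.le
      _ = _ := by simp
  have hN := sum_stepVar_le M (greedyPolicy am f) hw (potential_end am f) x
  have hsq := sum_sq_residual_le hlam hg x
  have husum : ∑ h, u h =
      ∑ h : Fin H, ∫ xa, M.stepVar (potential am f) h xa ∂(M.occ (greedyPolicy am f) h x) +
        2 * H * errorSum M am f x := by
    rw [hu, Finset.sum_add_distrib, ← Finset.mul_sum]; rfl
  -- The one-step variances contribute 2 Var + 2H · 2E, where 2E bounds the squared residuals, and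
  -- the source term adds 2H E.
  have h5 : ∑ h, u h ≤ 2 * M.returnVar H (greedyPolicy am f) x + 6 * H * errorSum M am f x := by
    rw [husum]
    nlinarith
  nlinarith

/-- The gap between the value of the greedy policy of `f` and its optimistic prediction. -/
lemma value_sub_potential_le (hH : 0 < H) (hlam : lam (Set.Icc (0 : ℝ) 1)ᶜ = 0)
    (hg : IsBellmanImage M am f g) (x : X) {s : ℝ} (hs : 0 < s) (hs1 : s ≤ 1) :
    M.value H (greedyPolicy am f) x - potential am f 0 x ≤
      2 * s * (6 * H * M.returnVar H (greedyPolicy am f) x + 18 * H ^ 2 * errorSum M am f x) +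
        errorSum M am f x / s := by
  have hw := bddMeas_potential am hlam f
  refine le_trans ?_ (add_le_add_left
    (mul_le_mul_of_nonneg_left (sum_varAt_le hH hlam hg x) (by positivity)) _)
  -- What remains is to compare, step by step, the mean of the Bellman image with the mean of `f_h`
  -- at the greedy action.
  rw [value_sub_eq M _ hw (potential_end am f), errorSum, Finset.mul_sum, Finset.sum_div,
    ← Finset.sum_add_distrib]
  refine Finset.sum_le_sum fun h _ => ?_
  rw [varAt_eq hlam, ← integral_const_mul, ← integral_div,
    ← integral_add (((bddMeas_lawVar_dens hlam h).integrable _).const_mul _)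
      (((bddMeas_bellmanError hg h).integrable _).div_const _)]
  refine integral_occ_greedy_mono
    ((bddMeas_lookahead M h (hw _)).sub ((hw h).comp measurable_fst))
    (((BddMeas.const _).mul (bddMeas_lawVar_dens hlam h)).add
      (by simpa only [div_eq_inv_mul] using
        (BddMeas.const s⁻¹).mul (bddMeas_bellmanError hg h))) h (fun x' => ?_) x
  rw [lookahead_eq hlam hg, potential_eq, bellmanError_eq hg, triDens_comm]
  exact mean_sub_le hlam ((g h).isDensity _) ((f h).isDensity _) hs hs1

/-- A fixed point of the distributional Bellman optimality operator predicts at most the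
optimal value. -/
lemma potential_le_optValue (hlam : lam (Set.Icc (0 : ℝ) 1)ᶜ = 0) [Nonempty A]
    (hf : IsBellmanImage M am f f) (x : X) : potential am f 0 x ≤ M.optValue H x := by
  have hne : Nonempty (Policy X A) := ⟨greedyPolicy am f⟩
  refine le_ciInf fun π => ?_
  have hw := bddMeas_potential am hlam f
  have h := value_sub_eq M π hw (potential_end am f) x
  -- For a fixed point the lookahead is the mean of `f_h` at the action played, while the potential
  -- is the minimum over actions.
  have : 0 ≤ ∑ h : Fin H, ∫ xa, (M.lookahead (potential am f) h xa - potential am f h xa.1)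
      ∂(M.occ π h x) := by
    refine Finset.sum_nonneg fun h _ => integral_nonneg fun xa => ?_
    have h1 := potential_le am f h xa.1 xa.2
    rw [lawAt_of_lt, mean, CondDens.law_apply] at h1
    simp only [lookahead_eq hlam hf, Pi.zero_apply, sub_nonneg]
    exact h1
  linarith

end Gap

/-! ### Consequences of Bellman completeness. -/

section Complete

variable {X A : Type*} [MeasurableSpace X] [MeasurableSpace A] {M : MDP X A}
  {am : ArgminRule A} {lam : Measure ℝ} [SigmaFinite lam] {H : ℕ}
  {F : Fin H → Finset (CondDens X A lam)} {Pol : Set (Policy X A)}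

lemma lawAt_mem_lawClass {f : Fin H → CondDens X A lam} (hf : f ∈ tuples F) (n : ℕ) :
    lawAt f n ∈ lawClass F n := by
  unfold lawAt lawClass
  split_ifs with hn
  · exact ⟨_, hf _, rfl⟩
  · rfl

/-- Completeness concerns policy operators; for the greedy policy of `f` itself the operator at step
h, applied to `f_{h+1}`, is the optimality operator. -/
lemma exists_isBellmanImage (hPol : ∀ f ∈ tuples F, greedyPolicy am f ∈ Pol)
    (hc : BellmanComplete M Pol F) {f : Fin H → CondDens X A lam} (hf : f ∈ tuples F) :
    ∃ g ∈ tuples F, IsBellmanImage M am f g := by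
  have : ∀ h : Fin H, ∃ g ∈ F h, M.bellmanOpt am h (lawAt f (h + 1)) = g.law := by
    intro h
    have := hc _ (hPol f hf) h h.2 _ (lawAt_mem_lawClass hf (h + 1))
    rw [lawClass, dif_pos h.2] at this
    exact this
  choose g hg hg' using this
  exact ⟨g, hg, hg'⟩

/-- Backward induction: replace the component at step H - (j+1) by the density of its Bellman image.
The product structure keeps the tuple in the class, and the later components, on which this image
and all later equations depend, are untouched. -/
lemma exists_fixedPoint (hF : ∀ h, (F h).Nonempty)
    (hPol : ∀ f ∈ tuples F, greedyPolicy am f ∈ Pol) (hc : BellmanComplete M Pol F) :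
    ∃ f ∈ tuples F, IsBellmanImage M am f f := by
  have key : ∀ j ≤ H, ∃ f ∈ tuples F, ∀ h : Fin H, H - j ≤ h →
      M.bellmanOpt am h (lawAt f (h + 1)) = (f h).law := by
    intro j
    induction j with
    | zero =>
      intro _
      choose f hf using hF
      exact ⟨f, hf, fun h hh => absurd h.2 (by omega)⟩
    | succ j ih =>
      intro hj
      obtain ⟨f, hf, hfix⟩ := ih (by omega)
      obtain ⟨g, hgF, hg⟩ := exists_isBellmanImage hPol hc hf
      let i : Fin H := ⟨H - (j + 1), by omega⟩
      have hup : ∀ n : ℕ, H - (j + 1) < n → lawAt (Function.update f i (g i)) n = lawAt f n := by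
        intro n hn
        unfold lawAt
        split_ifs with hnH
        · rw [Function.update_of_ne]
          intro he
          have := congrArg Fin.val he
          simp only [i] at this
          omega
        · rfl
      refine ⟨Function.update f i (g i), fun h => ?_, fun h hh => ?_⟩
      · rcases eq_or_ne h i with rfl | hne
        · rw [Function.update_self]; exact hgF _
        · rw [Function.update_of_ne hne]; exact hf h
      · rw [hup _ (by omega)]
        rcases eq_or_ne h i with rfl | hne
        · rw [Function.update_self]; exact hg _
        · rw [Function.update_of_ne hne]
          refine hfix h ?_
          have : (h : ℕ) ≠ H - (j + 1) := fun he => hne (Fin.ext he)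
          omega
  obtain ⟨f, hf, hfix⟩ := key H le_rfl
  exact ⟨f, hf, fun h => hfix h (by omega)⟩

end Complete

/-! ### Conditional laws and measurability with respect to sub-σ-algebras. -/

section CondLaw

/-- The hypothesis on rectangles identifies the joint law of (I, Y) with the composition-product of
the law of I and κ. -/
lemma lintegral_prodMk_of_condLaw {Ω Ω' E : Type*} [MeasurableSpace Ω] [MeasurableSpace Ω']
    [MeasurableSpace E] {Pr : Measure Ω} [IsProbabilityMeasure Pr] {I : Ω → Ω'}
    (hI : Measurable I) {Y : Ω → E} (hY : Measurable Y) (κ : Kernel Ω' E) [IsMarkovKernel κ]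
    (h : ∀ S, MeasurableSet S → ∀ G, MeasurableSet G →
      Pr (I ⁻¹' G ∩ Y ⁻¹' S) = ∫⁻ ω in I ⁻¹' G, κ (I ω) S ∂Pr)
    {Φ : Ω' × E → ℝ≥0∞} (hΦ : Measurable Φ) :
    ∫⁻ ω, Φ (I ω, Y ω) ∂Pr = ∫⁻ ω, ∫⁻ e, Φ (I ω, e) ∂(κ (I ω)) ∂Pr := by
  have hIY : Measurable (fun ω => (I ω, Y ω)) := hI.prodMk hY
  have hprob : IsProbabilityMeasure (Pr.map I) := Measure.isProbabilityMeasure_map hI.aemeasurable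
  have e : Pr.map (fun ω => (I ω, Y ω)) = (Pr.map I) ⊗ₘ κ := by
    refine Measure.ext_prod fun {G S} hG hS => ?_
    rw [Measure.map_apply hIY (hG.prod hS), Measure.compProd_apply_prod hG hS,
      setLIntegral_map hG (κ.measurable_coe hS) hI, ← h S hS G hG]
    rfl
  rw [← lintegral_map hΦ hIY, e, Measure.lintegral_compProd hΦ,
    lintegral_map hΦ.lintegral_kernel_prod_right' hI]

/-- Conditioning on m is conditioning on the identity map from Ω to (Ω, m). -/
lemma HasCondLaw.lintegral_eq {Ω E : Type*} {m : MeasurableSpace Ω} [mΩ : MeasurableSpace Ω]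
    [mE : MeasurableSpace E] {Pr : Measure Ω} [IsProbabilityMeasure Pr] (hm : m ≤ mΩ) {Y : Ω → E}
    (hY : Measurable Y) {κ : Ω → Measure E} (hκ : Measurable[m] κ)
    (hprob : ∀ ω, IsProbabilityMeasure (κ ω)) (h : HasCondLaw Pr m Y κ)
    {Φ : Ω × E → ℝ≥0∞} (hΦ : Measurable[m.prod mE] Φ) :
    ∫⁻ ω, Φ (ω, Y ω) ∂Pr = ∫⁻ ω, ∫⁻ e, Φ (ω, e) ∂(κ ω) ∂Pr :=
  @lintegral_prodMk_of_condLaw Ω Ω E mΩ m mE Pr _ id (measurable_id'' hm) Y hY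
    (@Kernel.mk Ω E m mE κ hκ) (@IsMarkovKernel.mk Ω E m mE _ hprob) h Φ hΦ

/-- The index type carries no σ-algebra; it suffices that the selection takes finitely many values
on measurable level sets. -/
lemma measurable_of_finite_selection {Ω ι X Y : Type*} [MeasurableSpace Ω] [MeasurableSpace X]
    [MeasurableSpace Y] {s : Set ι} (hs : s.Finite) {sel : Ω → ι} (hsel : ∀ ω, sel ω ∈ s)
    (hmeas : ∀ i, MeasurableSet {ω | sel ω = i}) {x : Ω → X} (hx : Measurable x)
    {κ : ι → X → Y} (hκ : ∀ i, Measurable (κ i)) :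
    Measurable (fun ω => κ (sel ω) (x ω)) := by
  intro T hT
  have : (fun ω => κ (sel ω) (x ω)) ⁻¹' T =
      ⋃ i ∈ s, {ω | sel ω = i} ∩ (fun ω => κ i (x ω)) ⁻¹' T := by
    ext ω
    simp only [Set.mem_preimage, Set.mem_iUnion, Set.mem_inter_iff, Set.mem_ofPred_eq]
    constructor
    · exact fun h => ⟨sel ω, hsel ω, rfl, h⟩
    · rintro ⟨i, -, rfl, h⟩; exact h
  rw [this]
  exact hs.measurableSet_biUnion fun i _ => (hmeas i).inter (((hκ i).comp hx) hT)

lemma measurable_mul_target {X A : Type*} [MeasurableSpace X] [MeasurableSpace A]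
    {Ω' : Type*} [MeasurableSpace Ω'] {W : Ω' → ℝ≥0∞} (hW : Measurable W)
    {s : Ω' → Step X A} (hs : Measurable s) {Φ : (X × A) × ℝ → ℝ≥0∞} (hΦ : Measurable Φ) :
    Measurable (fun p : Ω' × ℝ => W p.1 * Φ ((s p.1).1, (s p.1).2.1 + p.2)) := by
  fun_prop

lemma measurable_mul_step {X A : Type*} [MeasurableSpace X] [MeasurableSpace A]
    {Ω' : Type*} [MeasurableSpace Ω'] {W : Ω' → ℝ≥0∞} (hW : Measurable W)
    {Ψ : Step X A → ℝ≥0∞} (hΨ : Measurable Ψ) :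
    Measurable (fun p : Ω' × Step X A => W p.1 * Ψ p.2) := by
  fun_prop

lemma finite_tuples {X A : Type*} [MeasurableSpace X] [MeasurableSpace A]
    {lam : Measure ℝ} {H : ℕ} (F : Fin H → Finset (CondDens X A lam)) : (tuples F).Finite := by
  have : tuples F = ((Fintype.piFinset F : Finset _) : Set (Fin H → CondDens X A lam)) := by
    ext f; simp [tuples]
  rw [this]; exact Finset.finite_toSet _

end CondLaw

/-! ### Conditional law of the regression targets and the exponential supermartingale. -/

section Run

variable {X A : Type*} [MeasurableSpace X] [MeasurableSpace A] [Fintype A] [Nonempty A]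
  {lam : Measure ℝ} {H : ℕ}

/-- The law of the state-action pair recorded at step `h` of an episode. -/
def MDP.explore (M : MDP X A) (uae : Bool) (π : Policy X A) (h : Fin H) : Kernel X (X × A) :=
  if uae then
    (Kernel.id ×ₖ Kernel.const X (PMF.uniformOfFintype A).toMeasure) ∘ₖ M.stateOcc π h
  else M.occ π h

instance (M : MDP X A) (uae : Bool) (π : Policy X A) (h : Fin H) :
    IsMarkovKernel (M.explore uae π h) := by
  unfold MDP.explore
  split_ifs <;> infer_instance

instance (M : MDP X A) (π : Policy X A) (h : Fin H) : IsMarkovKernel (M.uaeKernel π h) := by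
  unfold MDP.uaeKernel; infer_instance

/-- Only single-step marginals of an episode enter the analysis. Each is an exploration law followed
by one observed transition, so both sampling schemes are treated at once. -/
lemma episodeLaw_map (M : MDP X A) (uae : Bool) (π : Policy X A) (h : Fin H) (x : X) :
    (M.episodeLaw H uae π x).map (fun τ => τ h) = (M.obs h ∘ₖ M.explore uae π h) x := by
  unfold MDP.episodeLaw MDP.explore
  split_ifs
  · refine (measurePreserving_eval (fun h => M.uaeKernel π h x) h).map_eq.trans ?_
    rw [MDP.uaeKernel, stepKernel_eq, Kernel.comp_assoc]
  · rw [← map_roll_eq_obs_comp_occ, Kernel.map_apply _ (measurable_pi_apply h)]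

variable [SFinite lam] {Ω : Type*} [mΩ : MeasurableSpace Ω] {Pr : Measure Ω} {M : MDP X A}
  {am : ArgminRule A} {F : Fin H → Finset (CondDens X A lam)} {β : ℝ} {K : ℕ} {uae : Bool}
  (R : ODiscoRun Pr M am F β K uae)

namespace ODiscoRun

/-- The law of the state-action pair recorded at step `h` of episode `k`, given the past. -/
def expl (k : ℕ) (h : Fin H) (ω : Ω) : Measure (X × A) :=
  M.explore uae (greedyPolicy am (R.sel k ω)) h (R.x₁ k ω)

instance (k : ℕ) (h : Fin H) (ω : Ω) : IsProbabilityMeasure (R.expl k h ω) := by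
  unfold expl; infer_instance

/-- The regression pair `((x_{h,k}, a_{h,k}), z^f_{h,k})`. -/
def target (k : ℕ) (h : Fin H) (f : Fin H → CondDens X A lam) (ω : Ω) : (X × A) × ℝ :=
  ((R.data k ω h).1, (R.data k ω h).2.1 + R.y k ω h f)

lemma measurable_data_apply {k : ℕ} (hk : k < K) (h : Fin H) :
    Measurable[R.𝒢 (k + 1)] (fun ω => R.data k ω h) :=
  (measurable_pi_apply h).comp (R.measurable_data k hk)

lemma measurable_target {k : ℕ} (hk : k < K) (h : Fin H) {f : Fin H → CondDens X A lam}
    (hf : f ∈ tuples F) : Measurable[R.𝒢 (k + 1)] (R.target k h f) := by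
  have h1 := R.measurable_data_apply hk h
  have h2 := R.measurable_y k hk h f hf
  exact h1.fst.prodMk (h1.snd.fst.add h2)

lemma measurable_selected {Y : Type*} [MeasurableSpace Y] {k : ℕ} (hk : k < K)
    {κ : (Fin H → CondDens X A lam) → X → Y} (hκ : ∀ f, Measurable (κ f)) :
    Measurable[R.𝒢 k] (fun ω => κ (R.sel k ω) (R.x₁ k ω)) :=
  @measurable_of_finite_selection Ω _ X Y (R.𝒢 k) _ _ _ (finite_tuples F) _
    (R.sel_mem k hk) (R.measurable_sel k hk) _ (R.measurable_x₁ k hk) _ hκ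

lemma hasCondLaw_data_apply {k : ℕ} (hk : k < K) (h : Fin H) :
    HasCondLaw Pr (R.𝒢 k) (fun ω => R.data k ω h)
      (fun ω => (M.obs h ∘ₖ M.explore uae (greedyPolicy am (R.sel k ω)) h) (R.x₁ k ω)) := by
  intro S hS G hG
  have := R.data_law k hk _ (measurable_pi_apply h hS) G hG
  refine Eq.trans this (lintegral_congr fun ω => ?_)
  beta_reduce
  rw [← episodeLaw_map, Measure.map_apply (measurable_pi_apply h) hS]

/-- Given the past, the regression target `z^f_{h,k}` has law `T_h^{⋆,D} f_{h+1}`. -/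
lemma lintegral_mul_target [IsProbabilityMeasure Pr] {k : ℕ} (hk : k < K) (h : Fin H)
    {f : Fin H → CondDens X A lam} (hf : f ∈ tuples F) {W : Ω → ℝ≥0∞} (hW : Measurable[R.𝒢 k] W)
    {Φ : (X × A) × ℝ → ℝ≥0∞} (hΦ : Measurable Φ) :
    ∫⁻ ω, W ω * Φ (R.target k h f ω) ∂Pr =
      ∫⁻ ω, W ω * ∫⁻ xa, ∫⁻ z, Φ (xa, z) ∂(M.bellmanOpt am h (lawAt f (h + 1)) xa)
        ∂(R.expl k h ω) ∂Pr := by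
  have hm : R.𝒢 k ≤ mΩ := R.𝒢.le k
  have hdata : Measurable (R.data k) := (R.measurable_data k hk).mono (R.𝒢.le _) le_rfl
  have hm' : R.𝒢 k ⊔ MeasurableSpace.comap (R.data k) inferInstance ≤ mΩ :=
    sup_le hm hdata.comap_le
  have hdm' : Measurable[R.𝒢 k ⊔ MeasurableSpace.comap (R.data k) inferInstance]
      (fun ω => R.data k ω h) :=
    (measurable_pi_apply h).comp
      ((comap_measurable (R.data k)).mono le_sup_right le_rfl)
  have hyk : Measurable (fun ω => R.y k ω h f) :=
    (R.measurable_y k hk h f hf).mono (R.𝒢.le _) le_rfl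
  let Ψ : Step X A → ℝ≥0∞ := fun s =>
    ∫⁻ y, Φ (s.1, s.2.1 + y) ∂(greedyLaw am (lawAt f (h + 1)) s.2.2)
  have hΨ : Measurable Ψ :=
    Measurable.lintegral_kernel_prod_right' (f := fun p : Step X A × ℝ => Φ (p.1.1, p.1.2.1 + p.2))
      (κ := (greedyLaw am (lawAt f (h + 1))).comap (fun s : Step X A => s.2.2) (by fun_prop))
      (by fun_prop)
  -- Condition in two stages: the sampled value given the past and the transitions of the episode,
  -- then the transition given the past.
  have step1 := HasCondLaw.lintegral_eq
    (m := R.𝒢 k ⊔ MeasurableSpace.comap (R.data k) MeasurableSpace.pi) hm' hyk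
    (κ := fun ω => greedyLaw am (lawAt f (h + 1)) (R.data k ω h).2.2)
    ((Kernel.measurable _).comp hdm'.snd.snd) (fun ω => inferInstance)
    (R.y_law k hk h f hf) (@measurable_mul_target _ _ _ _ Ω
      (R.𝒢 k ⊔ MeasurableSpace.comap (R.data k) MeasurableSpace.pi) W (hW.mono le_sup_left le_rfl)
      (fun ω => R.data k ω h) hdm' Φ hΦ)
  have step2 := HasCondLaw.lintegral_eq hm
    ((R.measurable_data_apply hk h).mono (R.𝒢.le _) le_rfl)
    (R.measurable_selected hk (κ := fun f' x =>
      (M.obs h ∘ₖ M.explore uae (greedyPolicy am f') h) x) fun f' => Kernel.measurable _)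
    (fun ω => inferInstance) (R.hasCondLaw_data_apply hk h)
    (@measurable_mul_step _ _ _ _ Ω (R.𝒢 k) W hW Ψ hΨ)
  refine step1.trans ?_
  have e1 : ∀ ω, ∫⁻ y, W ω * Φ ((R.data k ω h).1, (R.data k ω h).2.1 + y)
      ∂(greedyLaw am (lawAt f (h + 1)) (R.data k ω h).2.2) = W ω * Ψ (R.data k ω h) := fun ω =>
    lintegral_const_mul _ (by fun_prop)
  simp only [e1]
  refine step2.trans (lintegral_congr fun ω => ?_)
  simp only
  rw [lintegral_const_mul _ hΨ, Kernel.lintegral_comp _ _ _ hΨ]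
  congr 1
  refine lintegral_congr fun xa => ?_
  rw [lintegral_obs M hΨ, lintegral_bellmanOpt M am (by fun_prop)]

/-- Exponential supermartingale bound. -/
lemma lintegral_prod_le_one [IsProbabilityMeasure Pr] (h : Fin H) {f : Fin H → CondDens X A lam}
    (hf : f ∈ tuples F) {c : ℕ → Ω → ℝ≥0∞} (hc : ∀ i < K, Measurable[R.𝒢 i] (c i))
    {Φ : (X × A) × ℝ → ℝ≥0∞} (hΦ : Measurable Φ)
    (hle : ∀ i < K, ∀ ω, c i ω * ∫⁻ xa, ∫⁻ z, Φ (xa, z)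
      ∂(M.bellmanOpt am h (lawAt f (h + 1)) xa) ∂(R.expl i h ω) ≤ 1) {n : ℕ} (hn : n ≤ K) :
    Measurable[R.𝒢 n] (fun ω => ∏ i ∈ Finset.range n, (c i ω * Φ (R.target i h f ω))) ∧
      ∫⁻ ω, ∏ i ∈ Finset.range n, (c i ω * Φ (R.target i h f ω)) ∂Pr ≤ 1 := by
  have hmeas : ∀ n ≤ K,
      Measurable[R.𝒢 n] (fun ω => ∏ i ∈ Finset.range n, (c i ω * Φ (R.target i h f ω))) := by
    intro n hn
    refine Finset.measurable_prod _ fun i hi => ?_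
    have hin : i < n := Finset.mem_range.1 hi
    exact ((hc i (hin.trans_le hn)).mono (R.𝒢.mono hin.le) le_rfl).mul
      ((hΦ.comp (R.measurable_target (hin.trans_le hn) h hf)).mono (R.𝒢.mono hin) le_rfl)
  refine ⟨hmeas n hn, ?_⟩
  induction n with
  | zero => simp
  | succ n ih =>
    have hnK : n < K := hn
    -- The product over earlier episodes and the factor `c n` are known before episode n, so the
    -- last factor may be replaced by its conditional mean, which is at most 1.
    refine le_trans (le_of_eq ?_) ((lintegral_mono (f := fun ω => ((∏ i ∈ Finset.range n, (c i ω * Φ (R.target i h f ω))) * c n ω) *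
        ∫⁻ xa, ∫⁻ z, Φ (xa, z) ∂(M.bellmanOpt am h (lawAt f (h + 1)) xa) ∂(R.expl n h ω)) fun ω => ?_).trans (ih hnK.le))
    · refine Eq.trans ?_
        (R.lintegral_mul_target hnK h hf ((hmeas n hnK.le).mul (hc n hnK)) hΦ)
      refine lintegral_congr fun ω => ?_
      rw [Finset.prod_range_succ, Pi.mul_apply, mul_assoc]
    · beta_reduce
      rw [mul_assoc]
      exact mul_le_of_le_one_right' (hle n hnK ω)

end ODiscoRun

end Run

/-! ### From log-likelihoods to products of likelihood ratios. -/

section Likelihood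

lemma sum_log_eq_log_prod {ι : Type*} (s : Finset ι) (a : ι → ℝ≥0∞) :
    ∑ i ∈ s, ENNReal.log (a i) = ENNReal.log (∏ i ∈ s, a i) := by
  classical
  induction s using Finset.induction_on with
  | empty => simp
  | insert i s hi ih => rw [Finset.sum_insert hi, Finset.prod_insert hi, ENNReal.log_mul_add, ih]

lemma log_sub_le_log_iff {x y : ℝ≥0∞} {β : ℝ} :
    ENNReal.log x - (β : EReal) ≤ ENNReal.log y ↔ x ≤ y * ENNReal.ofReal (Real.exp β) := by
  have hβ : ENNReal.log (ENNReal.ofReal (Real.exp β)) = β := by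
    rw [ENNReal.log_ofReal_of_pos (Real.exp_pos _), Real.log_exp]
  rw [EReal.sub_le_iff_le_add (Or.inl (EReal.coe_ne_bot β)) (Or.inl (EReal.coe_ne_top β)), ← hβ,
    ← ENNReal.log_mul_add, ENNReal.log_le_log_iff]

/-- Zeros are the only issue. A vanishing a_i makes the left side zero; if no a_i vanishes, a
vanishing b_i would make the product of quotients infinite, against B ≠ ∞. -/
lemma prod_le_of_prod_div_le {ι : Type*} {s : Finset ι} {a b : ι → ℝ≥0} {B : ℝ≥0∞}
    (hB : B ≠ ∞) (h : ∏ i ∈ s, ((a i : ℝ≥0∞) / b i) ≤ B) :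
    ∏ i ∈ s, (a i : ℝ≥0∞) ≤ (∏ i ∈ s, (b i : ℝ≥0∞)) * B := by
  classical
  by_cases ha : ∃ i ∈ s, a i = 0
  · obtain ⟨i, hi, hai⟩ := ha
    rw [Finset.prod_eq_zero hi (by rw [hai]; rfl)]
    exact zero_le
  · have ha' : ∀ i ∈ s, a i ≠ 0 := fun i hi h0 => ha ⟨i, hi, h0⟩
    have hb : ∀ i ∈ s, b i ≠ 0 := by
      intro i hi h0
      refine hB (top_le_iff.1 (le_trans (le_of_eq ?_) h))
      rw [← Finset.mul_prod_erase s _ hi, h0, ENNReal.coe_zero,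
        ENNReal.div_zero (by exact_mod_cast ha' i hi), ENNReal.top_mul]
      refine Finset.prod_ne_zero_iff.2 fun j hj => ?_
      exact ENNReal.div_ne_zero.2
        ⟨by exact_mod_cast ha' j (Finset.mem_of_mem_erase hj), ENNReal.coe_ne_top⟩
    calc ∏ i ∈ s, (a i : ℝ≥0∞) = ∏ i ∈ s, ((a i : ℝ≥0∞) / b i * b i) :=
          Finset.prod_congr rfl fun i hi => (ENNReal.div_mul_cancel
            (by exact_mod_cast hb i hi) ENNReal.coe_ne_top).symm
      _ = (∏ i ∈ s, (b i : ℝ≥0∞)) * ∏ i ∈ s, ((a i : ℝ≥0∞) / b i) := by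
          rw [Finset.prod_mul_distrib, mul_comm]
      _ ≤ _ := by gcongr

/-- With S the sum of the e_i, the likelihood inequality gives √(∏a/∏b) ≥ exp(-β/2), so exp(S/4 -
β/2) < exp(2β), that is S < 10β. -/
lemma sum_le_of_prod_sqrt_lt {n : ℕ} {a b : ℕ → ℝ≥0} {e : ℕ → ℝ} {β : ℝ}
    (hb : ∀ i < n, b i ≠ 0)
    (hab : ∏ i ∈ Finset.range n, (b i : ℝ≥0∞) ≤
      (∏ i ∈ Finset.range n, (a i : ℝ≥0∞)) * ENNReal.ofReal (Real.exp β))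
    (h : ∏ i ∈ Finset.range n,
      (ENNReal.ofReal (Real.exp (e i / 4)) * ((a i : ℝ≥0∞) / b i) ^ (1 / 2 : ℝ)) <
        ENNReal.ofReal (Real.exp (2 * β))) :
    ∑ i ∈ Finset.range n, e i ≤ 10 * β := by
  obtain ⟨P, hP⟩ : ∃ P : ℝ≥0, P = ∏ i ∈ Finset.range n, a i := ⟨_, rfl⟩
  obtain ⟨Q, hQ⟩ : ∃ Q : ℝ≥0, Q = ∏ i ∈ Finset.range n, b i := ⟨_, rfl⟩
  have hQ0 : Q ≠ 0 := by
    rw [hQ]; exact Finset.prod_ne_zero_iff.2 fun i hi => hb i (Finset.mem_range.1 hi)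
  have hQpos : (0 : ℝ) < Q := NNReal.coe_pos.2 (pos_iff_ne_zero.2 hQ0)
  have hQP : (Q : ℝ) ≤ P * Real.exp β := by
    have h1 : (Q : ℝ≥0∞) ≤ P * ENNReal.ofReal (Real.exp β) := by
      rw [hP, hQ]; push_cast; exact hab
    rw [← ENNReal.ofReal_coe_nnreal, ← ENNReal.ofReal_coe_nnreal (p := P),
      ← ENNReal.ofReal_mul (NNReal.coe_nonneg _), ENNReal.ofReal_le_ofReal_iff (by positivity)] at h1
    exact h1
  have hexp : ∏ i ∈ Finset.range n, ENNReal.ofReal (Real.exp (e i / 4)) =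
      ENNReal.ofReal (Real.exp ((∑ i ∈ Finset.range n, e i) / 4)) := by
    rw [← ENNReal.ofReal_prod_of_nonneg fun i _ => (Real.exp_pos _).le, ← Real.exp_sum,
      Finset.sum_div]
  have hdiv : ∏ i ∈ Finset.range n, ((a i : ℝ≥0∞) / b i) = ((P / Q : ℝ≥0) : ℝ≥0∞) := by
    rw [hP, hQ, ← Finset.prod_div_distrib]
    push_cast
    exact Finset.prod_congr rfl fun i hi =>
      (ENNReal.coe_div (hb i (Finset.mem_range.1 hi))).symm
  rw [Finset.prod_mul_distrib, hexp, ENNReal.prod_rpow_of_nonneg (by norm_num), hdiv,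
    ← ENNReal.coe_rpow_of_nonneg _ (by norm_num), ← ENNReal.ofReal_coe_nnreal,
    ← ENNReal.ofReal_mul (Real.exp_pos _).le, ENNReal.ofReal_lt_ofReal_iff (Real.exp_pos _)] at h
  push_cast at h
  have hlow : Real.exp (-β / 2) ≤ ((P : ℝ) / Q) ^ (1 / 2 : ℝ) := by
    have h1 : Real.exp (-β) ≤ (P : ℝ) / Q := by
      rw [le_div_iff₀ hQpos, Real.exp_neg]
      calc (Real.exp β)⁻¹ * Q ≤ (Real.exp β)⁻¹ * (P * Real.exp β) := by gcongr
        _ = P := by field_simp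
    calc Real.exp (-β / 2) = Real.exp (-β) ^ (1 / 2 : ℝ) := by
          rw [← Real.exp_mul]; congr 1; ring
      _ ≤ _ := Real.rpow_le_rpow (Real.exp_pos _).le h1 (by norm_num)
  have h2 : Real.exp ((∑ i ∈ Finset.range n, e i) / 4 + -β / 2) < Real.exp (2 * β) := by
    rw [Real.exp_add]
    exact lt_of_le_of_lt (mul_le_mul_of_nonneg_left hlow (Real.exp_pos _).le) h
  rw [Real.exp_lt_exp] at h2
  linarith

end Likelihood

/-! ### Exponential tail bounds for a fixed tuple, step and episode. -/

section Events

variable {X A : Type*} [MeasurableSpace X] [MeasurableSpace A] {lam : Measure ℝ} {H : ℕ}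

lemma lintegral_law [SFinite lam] (f : CondDens X A lam) (xa : X × A) {φ : ℝ → ℝ≥0∞}
    (hφ : Measurable φ) :
    ∫⁻ z, φ z ∂(f.law xa) = ∫⁻ z, (f.dens xa z : ℝ≥0∞) * φ z ∂lam := by
  rw [f.law_apply, densLaw, lintegral_withDensity_eq_lintegral_mul _
    (f.isDensity xa).measurable.coe_nnreal_ennreal hφ]
  rfl

lemma CondDens.measurable_coe (f : CondDens X A lam) :
    Measurable (fun p : (X × A) × ℝ => (f.dens p.1 p.2 : ℝ≥0∞)) :=
  f.measurable_dens.coe_nnreal_ennreal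

variable [SigmaFinite lam] [Fintype A] [Nonempty A] {Ω : Type*} [mΩ : MeasurableSpace Ω]
  {Pr : Measure Ω} [IsProbabilityMeasure Pr] {M : MDP X A}
  {am : ArgminRule A} {F : Fin H → Finset (CondDens X A lam)} {β : ℝ} {K : ℕ} {uae : Bool}
  (R : ODiscoRun Pr M am F β K uae)

namespace ODiscoRun

lemma measure_exp_le_prod_le (h : Fin H) {f : Fin H → CondDens X A lam}
    (hf : f ∈ tuples F) {c : ℕ → Ω → ℝ≥0∞} (hc : ∀ i < K, Measurable[R.𝒢 i] (c i))
    {Φ : (X × A) × ℝ → ℝ≥0∞} (hΦ : Measurable Φ)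
    (hle : ∀ i < K, ∀ ω, c i ω * ∫⁻ xa, ∫⁻ z, Φ (xa, z)
      ∂(M.bellmanOpt am h (lawAt f (h + 1)) xa) ∂(R.expl i h ω) ≤ 1) {n : ℕ} (hn : n ≤ K)
    (t : ℝ) :
    Pr {ω | ENNReal.ofReal (Real.exp t) ≤
      ∏ i ∈ Finset.range n, (c i ω * Φ (R.target i h f ω))} ≤ ENNReal.ofReal (Real.exp (-t)) := by
  obtain ⟨hm, hi⟩ := R.lintegral_prod_le_one h hf hc hΦ hle hn
  refine (meas_ge_le_lintegral_div (hm.mono (R.𝒢.le n) le_rfl).aemeasurable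
    (by simpa using Real.exp_pos t) ENNReal.ofReal_ne_top).trans ?_
  refine (ENNReal.div_le_div_right hi _).trans (le_of_eq ?_)
  rw [one_div, ← ENNReal.ofReal_inv_of_pos (Real.exp_pos _), Real.exp_neg]

/-- Targets have density `g h`, so the conditional mean of q/`g h` is the mass of q on {`g h` ≠ 0},
at most 1. -/
lemma measure_likelihoodRatio_le {f : Fin H → CondDens X A lam} (hf : f ∈ tuples F)
    {g : Fin H → CondDens X A lam} (hg : IsBellmanImage M am f g) (h : Fin H)
    (q : CondDens X A lam) {n : ℕ} (hn : n ≤ K) (t : ℝ) :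
    Pr {ω | ENNReal.ofReal (Real.exp t) ≤ ∏ i ∈ Finset.range n,
      ((q.dens (R.target i h f ω).1 (R.target i h f ω).2 : ℝ≥0∞) /
        (g h).dens (R.target i h f ω).1 (R.target i h f ω).2)} ≤
      ENNReal.ofReal (Real.exp (-t)) := by
  have hΦ : Measurable (fun p : (X × A) × ℝ =>
      (q.dens p.1 p.2 : ℝ≥0∞) / (g h).dens p.1 p.2) := q.measurable_coe.div (g h).measurable_coe
  have := R.measure_exp_le_prod_le h hf (c := fun _ _ => 1) (fun _ _ => measurable_const) hΦ
    (fun i _ ω => ?_) hn t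
  · simpa only [one_mul] using this
  · rw [one_mul, hg h]
    calc _ ≤ ∫⁻ _, 1 ∂(R.expl i h ω) := by
          refine lintegral_mono fun xa => ?_
          rw [lintegral_law _ _ (φ := fun z => (q.dens xa z : ℝ≥0∞) / (g h).dens xa z)
            (hΦ.comp measurable_prodMk_left)]
          refine le_trans (lintegral_mono fun z => ?_) (q.lintegral_eq_one xa).le
          rcases eq_or_ne ((g h).dens xa z) 0 with h0 | h0
          · simp [h0]
          · rw [mul_comm, ENNReal.div_mul_cancel (by exact_mod_cast h0)
              ENNReal.coe_ne_top]
      _ = 1 := by simp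

/-- The expected Bellman error of `f` under the exploration law of episode `i`. -/
def explError (f : Fin H → CondDens X A lam) (h : Fin H) (i : ℕ) (ω : Ω) : ℝ :=
  ∫ xa, bellmanError M am f h xa ∂(R.expl i h ω)

/-- Given the past, the square-root ratio has mean at most 1 - e/4 ≤ exp(-e/4), where e is the
expected Bellman error under the exploration law. Since e is determined by the past, multiplying by
exp(e/4) gives a supermartingale. -/
lemma measure_hellinger_le {f : Fin H → CondDens X A lam} (hf : f ∈ tuples F)
    {g : Fin H → CondDens X A lam} (hg : IsBellmanImage M am f g) (h : Fin H)
    {n : ℕ} (hn : n ≤ K) (t : ℝ) :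
    Pr {ω | ENNReal.ofReal (Real.exp t) ≤ ∏ i ∈ Finset.range n,
      (ENNReal.ofReal (Real.exp (R.explError f h i ω / 4)) *
        (((f h).dens (R.target i h f ω).1 (R.target i h f ω).2 : ℝ≥0∞) /
          (g h).dens (R.target i h f ω).1 (R.target i h f ω).2) ^ (1 / 2 : ℝ))} ≤
      ENNReal.ofReal (Real.exp (-t)) := by
  have hΦ : Measurable (fun p : (X × A) × ℝ =>
      (((f h).dens p.1 p.2 : ℝ≥0∞) / (g h).dens p.1 p.2) ^ (1 / 2 : ℝ)) :=
    ((f h).measurable_coe.div (g h).measurable_coe).pow_const _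
  have hD := bddMeas_bellmanError hg h
  refine R.measure_exp_le_prod_le h hf
    (c := fun i ω => ENNReal.ofReal (Real.exp (R.explError f h i ω / 4))) (fun i hi => ?_) hΦ
    (fun i _ ω => ?_) hn t
  · have : Measurable[R.𝒢 i] (R.explError f h i) :=
      R.measurable_selected hi (κ := fun f' x =>
        ∫ xa, bellmanError M am f h xa ∂(M.explore uae (greedyPolicy am f') h x))
        fun f' => (hD.integral_kernel _).measurable
    exact (Real.measurable_exp.comp (this.div_const 4)).ennreal_ofReal
  · rw [hg h]
    have hint : Integrable (fun xa => 1 - bellmanError M am f h xa / 4) (R.expl i h ω) :=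
      (integrable_const _).sub ((hD.integrable _).div_const 4)
    have h1 : ∫⁻ xa, ∫⁻ z, (((f h).dens xa z : ℝ≥0∞) / (g h).dens xa z) ^ (1 / 2 : ℝ)
        ∂((g h).law xa) ∂(R.expl i h ω) ≤
        ENNReal.ofReal (1 - R.explError f h i ω / 4) := by
      calc _ ≤ ∫⁻ xa, ENNReal.ofReal (1 - bellmanError M am f h xa / 4) ∂(R.expl i h ω) := by
            refine lintegral_mono fun xa => ?_
            have hm : Measurable (fun z =>
              (((f h).dens xa z : ℝ≥0∞) / (g h).dens xa z) ^ (1 / 2 : ℝ)) :=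
              hΦ.comp measurable_prodMk_left
            rw [lintegral_law _ _ hm, bellmanError_eq hg]
            exact lintegral_sqrt_div_mul_le ((f h).isDensity xa) ((g h).isDensity xa)
        _ = _ := by
            rw [← ofReal_integral_eq_lintegral_ofReal hint (Filter.Eventually.of_forall fun xa => by
              have := bellmanError_le_two hg h xa
              simp only [Pi.zero_apply]; linarith),
              integral_sub (integrable_const _) ((hD.integrable _).div_const 4), integral_div]
            simp [explError]
    calc _ ≤ ENNReal.ofReal (Real.exp (R.explError f h i ω / 4)) *
          ENNReal.ofReal (Real.exp (-(R.explError f h i ω / 4))) := by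
          refine mul_le_mul_right (h1.trans (ENNReal.ofReal_le_ofReal ?_)) _
          linarith [Real.add_one_le_exp (-(R.explError f h i ω / 4))]
      _ = 1 := by
          rw [← ENNReal.ofReal_mul (Real.exp_pos _).le, ← Real.exp_add]
          simp

/-- A sample almost surely avoids the zero set of its own density; this justifies dividing by `g h`
at the observed targets. -/
lemma measure_dens_eq_zero {f : Fin H → CondDens X A lam} (hf : f ∈ tuples F)
    {g : Fin H → CondDens X A lam} (hg : IsBellmanImage M am f g) (h : Fin H) {i : ℕ}
    (hi : i < K) :
    Pr {ω | (g h).dens (R.target i h f ω).1 (R.target i h f ω).2 = 0} = 0 := by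
  have hS : MeasurableSet {p : (X × A) × ℝ | (g h).dens p.1 p.2 = 0} :=
    (g h).measurable_dens (measurableSet_singleton 0)
  have hT : Measurable (R.target i h f) := (R.measurable_target hi h hf).mono (R.𝒢.le _) le_rfl
  have hind : Measurable (Set.indicator {p : (X × A) × ℝ | (g h).dens p.1 p.2 = 0}
      (fun _ => (1 : ℝ≥0∞))) := measurable_const.indicator hS
  have key := R.lintegral_mul_target hi h hf (W := fun _ => 1) measurable_const hind
  have hz : ∀ ω, ∫⁻ xa, ∫⁻ z, Set.indicator {p : (X × A) × ℝ | (g h).dens p.1 p.2 = 0}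
      (fun _ => (1 : ℝ≥0∞)) (xa, z) ∂(M.bellmanOpt am h (lawAt f (h + 1)) xa)
        ∂(R.expl i h ω) = 0 := by
    intro ω
    rw [hg h]
    refine (lintegral_congr fun xa => ?_).trans lintegral_zero
    refine (lintegral_law _ _ (hind.comp measurable_prodMk_left)).trans ?_
    refine (lintegral_congr fun z => ?_).trans lintegral_zero
    by_cases h0 : (g h).dens xa z = 0
    · rw [h0, ENNReal.coe_zero, zero_mul]
    · rw [Function.comp_apply, Set.indicator_of_notMem (by exact h0), mul_zero]
  simp only [one_mul, hz, lintegral_zero] at key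
  rw [← key, ← lintegral_indicator_one
    (show MeasurableSet {ω | (g h).dens (R.target i h f ω).1 (R.target i h f ω).2 = 0} from hT hS)]
  rfl

end ODiscoRun

end Events

/-! ### Elementary bounds on β. -/

section Threshold

variable {X A : Type*} [MeasurableSpace X] [MeasurableSpace A] {lam : Measure ℝ} {H K : ℕ}
  {F : Fin H → Finset (CondDens X A lam)} {δ : ℝ}

lemma one_le_prod_card (hF : ∀ h, (F h).Nonempty) : 1 ≤ ∏ h, (F h).card :=
  Nat.one_le_iff_ne_zero.2 (Finset.prod_ne_zero_iff.2 fun h _ => (hF h).card_pos.ne')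

lemma card_le_prod_card (hF : ∀ h, (F h).Nonempty) (h : Fin H) :
    (F h).card ≤ ∏ h, (F h).card :=
  Nat.le_of_dvd (one_le_prod_card hF) (Finset.dvd_prod_of_mem _ (Finset.mem_univ h))

lemma exp_neg_threshold (hH : 0 < H) (hK : 0 < K) (hF : ∀ h, (F h).Nonempty) (hδ : 0 < δ) :
    Real.exp (-threshold F K δ) = δ / (H * K * ((∏ h, (F h).card : ℕ) : ℝ)) := by
  have hP : (0 : ℝ) < ((∏ h, (F h).card : ℕ) : ℝ) := by exact_mod_cast one_le_prod_card hF
  have hHr : (0 : ℝ) < H := by exact_mod_cast hH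
  have hKr : (0 : ℝ) < K := by exact_mod_cast hK
  rw [threshold, Real.exp_neg, Real.exp_log (by positivity), inv_div]

lemma log_prod_card_le_threshold (hH : 0 < H) (hK : 0 < K) (hF : ∀ h, (F h).Nonempty)
    (hδ : 0 < δ) (hδ1 : δ < 1) :
    0 < threshold F K δ ∧ Real.log ((∏ h, (F h).card : ℕ) : ℝ) ≤ threshold F K δ := by
  have hP : (1 : ℝ) ≤ ((∏ h, (F h).card : ℕ) : ℝ) := by exact_mod_cast one_le_prod_card hF
  have hHr : (1 : ℝ) ≤ H := by exact_mod_cast hH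
  have hKr : (1 : ℝ) ≤ K := by exact_mod_cast hK
  have hHK : 1 ≤ (H : ℝ) * K := one_le_mul_of_one_le_of_one_le hHr hKr
  have h1 : ((∏ h, (F h).card : ℕ) : ℝ) ≤ (H : ℝ) * K * ((∏ h, (F h).card : ℕ) : ℝ) :=
    le_mul_of_one_le_left (by linarith) hHK
  constructor
  · refine Real.log_pos ?_
    rw [lt_div_iff₀ hδ]
    linarith
  · refine Real.log_le_log (by linarith) (h1.trans ?_)
    rw [le_div_iff₀ hδ]
    nlinarith

end Threshold

/-! ### The good event. -/

section Good

lemma measure_biUnion_le_ofReal {Ω ι : Type*} [MeasurableSpace Ω] {Pr : Measure Ω}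
    (s : Finset ι) (E : ι → Set Ω) {a : ℝ}
    (h : ∀ i ∈ s, Pr (E i) ≤ ENNReal.ofReal a) :
    Pr (⋃ i ∈ s, E i) ≤ ENNReal.ofReal (s.card * a) := by
  refine (measure_biUnion_finset_le s E).trans ((Finset.sum_le_sum h).trans (le_of_eq ?_))
  rw [Finset.sum_const, nsmul_eq_mul, ENNReal.ofReal_mul (by positivity), ENNReal.ofReal_natCast]

variable {X A : Type*} [MeasurableSpace X] [MeasurableSpace A] {lam : Measure ℝ} {H : ℕ}
  [SigmaFinite lam] [Fintype A] [Nonempty A] {Ω : Type*} [mΩ : MeasurableSpace Ω]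
  {Pr : Measure Ω} {M : MDP X A}
  {am : ArgminRule A} {F : Fin H → Finset (CondDens X A lam)} {K : ℕ} {uae : Bool}
  {Pol : Set (Policy X A)} {δ : ℝ}

namespace ODiscoRun

lemma logLik_sub_le_iff {β : ℝ} (R : ODiscoRun Pr M am F β K uae) (k : ℕ) (h : Fin H)
    (f : Fin H → CondDens X A lam) (p q : CondDens X A lam) (ω : Ω) :
    logLik (fun i => R.data i ω) (fun i => R.y i ω) k h f p - (β : EReal) ≤
      logLik (fun i => R.data i ω) (fun i => R.y i ω) k h f q ↔
    ∏ i ∈ Finset.range k, (p.dens (R.target i h f ω).1 (R.target i h f ω).2 : ℝ≥0∞) ≤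
      (∏ i ∈ Finset.range k, (q.dens (R.target i h f ω).1 (R.target i h f ω).2 : ℝ≥0∞)) *
        ENNReal.ofReal (Real.exp β) := by
  rw [logLik, logLik, sum_log_eq_log_prod, sum_log_eq_log_prod, log_sub_le_log_iff]
  rfl

/-- With probability at least `1 - δ`, every confidence set contains the fixed point of the
Bellman operator, and all its members have small Bellman errors on the past episodes. -/
theorem exists_good_event [IsProbabilityMeasure Pr] {β : ℝ} (hH : 0 < H) (hK : 0 < K) (hF : ∀ h, (F h).Nonempty)
    (hPol : ∀ f ∈ tuples F, greedyPolicy am f ∈ Pol) (hc : BellmanComplete M Pol F)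
    (hδ : 0 < δ) (hδ1 : δ < 1) (hβ : β = threshold F K δ) (R : ODiscoRun Pr M am F β K uae)
    {fs : Fin H → CondDens X A lam} (hfs : fs ∈ tuples F) (hfix : IsBellmanImage M am fs fs) :
    ∃ bad : Set Ω, Pr bad ≤ ENNReal.ofReal δ ∧ ∀ ω ∉ bad, ∀ k < K,
      fs ∈ confSet F β (fun i => R.data i ω) (fun i => R.y i ω) k ∧
      ∀ f ∈ confSet F β (fun i => R.data i ω) (fun i => R.y i ω) k,
        ∀ h, ∑ i ∈ Finset.range k, R.explError f h i ω ≤ 10 * β := by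
  classical
  have hβ0 : 0 < β := hβ ▸ (log_prod_card_le_threshold hH hK hF hδ hδ1).1
  have himg := fun (f : Fin H → CondDens X A lam) (hf : f ∈ tuples F) =>
    exists_isBellmanImage hPol hc hf
  have : Nonempty (Fin H → CondDens X A lam) := ⟨fs⟩
  choose! img himgF himg using himg
  let A₁ : ℕ → (h : Fin H) → CondDens X A lam → Set Ω := fun n h q =>
    {ω | ENNReal.ofReal (Real.exp β) ≤ ∏ i ∈ Finset.range n,
      ((q.dens (R.target i h fs ω).1 (R.target i h fs ω).2 : ℝ≥0∞) /
        (fs h).dens (R.target i h fs ω).1 (R.target i h fs ω).2)}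
  let A₂ : ℕ → (h : Fin H) → (Fin H → CondDens X A lam) → Set Ω := fun n h f =>
    {ω | ENNReal.ofReal (Real.exp (2 * β)) ≤ ∏ i ∈ Finset.range n,
      (ENNReal.ofReal (Real.exp (R.explError f h i ω / 4)) *
        (((f h).dens (R.target i h f ω).1 (R.target i h f ω).2 : ℝ≥0∞) /
          (img f h).dens (R.target i h f ω).1 (R.target i h f ω).2) ^ (1 / 2 : ℝ))}
  let A₃ : ℕ → (h : Fin H) → (Fin H → CondDens X A lam) → Set Ω := fun i h f =>
    {ω | (img f h).dens (R.target i h f ω).1 (R.target i h f ω).2 = 0}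
  have htup : ∀ f, f ∈ Fintype.piFinset F ↔ f ∈ tuples F := fun f => by simp [tuples]
  -- Episode 0 has no past data and is trivially fine. Leaving it out makes the first union cost
  -- only (K - 1)δ/K, so that δ/K remains for the second.
  let E₁ : Set Ω := ⋃ n ∈ (Finset.range K).erase 0, ⋃ h ∈ Finset.univ, ⋃ q ∈ F h, A₁ n h q
  let E₂ : Set Ω := ⋃ n ∈ (Finset.range K).erase 0, ⋃ h ∈ Finset.univ,
    ⋃ f ∈ Fintype.piFinset F, A₂ n h f
  let E₃ : Set Ω := ⋃ n ∈ Finset.range K, ⋃ h ∈ Finset.univ, ⋃ f ∈ Fintype.piFinset F, A₃ n h f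
  have hcard : (((Finset.range K).erase 0).card : ℝ) = (K : ℝ) - 1 := by
    rw [Finset.card_erase_of_mem (Finset.mem_range.2 hK), Finset.card_range,
      Nat.cast_sub hK, Nat.cast_one]
  obtain ⟨P, hP⟩ : ∃ P : ℝ, P = ((∏ h, (F h).card : ℕ) : ℝ) := ⟨_, rfl⟩
  have hP1 : 1 ≤ P := hP ▸ by exact_mod_cast one_le_prod_card hF
  have hlt : ∀ n ∈ (Finset.range K).erase 0, n ≤ K := fun n hn =>
    (Finset.mem_range.1 (Finset.mem_of_mem_erase hn)).le
  have h1 : Pr E₁ ≤ ENNReal.ofReal ((K - 1) * (H * (P * Real.exp (-β)))) := by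
    rw [← hcard]
    refine measure_biUnion_le_ofReal _ _ fun n hn => ?_
    have hH' : (H : ℝ) = ((Finset.univ : Finset (Fin H)).card : ℝ) := by simp
    rw [hH']
    refine measure_biUnion_le_ofReal _ _ fun h _ => ?_
    refine (measure_biUnion_le_ofReal _ _ fun q _ =>
      R.measure_likelihoodRatio_le hfs hfix h q (hlt n hn) β).trans (ENNReal.ofReal_le_ofReal ?_)
    refine mul_le_mul_of_nonneg_right ?_ (Real.exp_pos _).le
    rw [hP]; exact_mod_cast card_le_prod_card hF h
  have h2 : Pr E₂ ≤ ENNReal.ofReal ((K - 1) * (H * (P * Real.exp (-(2 * β))))) := by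
    rw [← hcard]
    refine measure_biUnion_le_ofReal _ _ fun n hn => ?_
    have hH' : (H : ℝ) = ((Finset.univ : Finset (Fin H)).card : ℝ) := by simp
    rw [hH']
    refine measure_biUnion_le_ofReal _ _ fun h _ => ?_
    refine (measure_biUnion_le_ofReal _ _ fun f hf =>
      R.measure_hellinger_le ((htup f).1 hf) (himg f ((htup f).1 hf)) h (hlt n hn) (2 * β)).trans
      (le_of_eq ?_)
    rw [Fintype.card_piFinset, hP]
  have h3 : Pr E₃ = 0 := by
    refine (measure_biUnion_null_iff (Finset.countable_toSet _)).2 fun n hn => ?_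
    refine (measure_biUnion_null_iff (Finset.countable_toSet _)).2 fun h _ => ?_
    refine (measure_biUnion_null_iff (Finset.countable_toSet _)).2 fun f hf => ?_
    have hf' := (htup f).1 hf
    exact R.measure_dens_eq_zero hf' (himg f hf') h (Finset.mem_range.1 hn)
  refine ⟨E₁ ∪ E₂ ∪ E₃, ?_, fun ω hω k hk => ?_⟩
  · have hHr : (1 : ℝ) ≤ H := by exact_mod_cast hH
    have hKr : (1 : ℝ) ≤ K := by exact_mod_cast hK
    have hexp : Real.exp (-β) = δ / (H * K * P) := by
      rw [hβ, hP]; exact exp_neg_threshold hH hK hF hδ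
    have hexp2 : Real.exp (-(2 * β)) = Real.exp (-β) * Real.exp (-β) := by
      rw [← Real.exp_add]; congr 1; ring
    have hK1 : (0 : ℝ) ≤ K - 1 := by linarith
    have e1 : (H : ℝ) * (P * Real.exp (-β)) = δ / K := by
      rw [hexp]; field_simp
    -- This is why the second family uses level 2β: its union costs (K - 1)(δ/K)exp(-β), which is at
    -- most δ/K.
    have e2 : (K - 1) * Real.exp (-β) ≤ 1 := by
      have hHP : 1 ≤ (H : ℝ) * P := one_le_mul_of_one_le_of_one_le hHr hP1
      rw [hexp, mul_div_assoc', div_le_one (by positivity)]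
      nlinarith
    calc Pr (E₁ ∪ E₂ ∪ E₃) ≤ Pr E₁ + Pr E₂ + Pr E₃ :=
          (measure_union_le _ _).trans (add_le_add_left (measure_union_le _ _) _)
      _ ≤ ENNReal.ofReal ((K - 1) * (δ / K)) +
          ENNReal.ofReal ((K - 1) * (δ / K * Real.exp (-β))) := by
          rw [h3, add_zero]
          refine add_le_add (h1.trans (by rw [e1])) (h2.trans (le_of_eq ?_))
          rw [← e1, hexp2]; congr 1; ring
      _ = ENNReal.ofReal ((K - 1) * (δ / K) + (K - 1) * (δ / K * Real.exp (-β))) := by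
          rw [ENNReal.ofReal_add (by positivity) (by positivity)]
      _ ≤ ENNReal.ofReal δ := by
          refine ENNReal.ofReal_le_ofReal ?_
          have : (K - 1) * (δ / K * Real.exp (-β)) ≤ δ / K := by
            calc (K - 1) * (δ / K * Real.exp (-β)) = δ / K * ((K - 1) * Real.exp (-β)) := by ring
              _ ≤ δ / K * 1 := mul_le_mul_of_nonneg_left e2 (by positivity)
              _ = δ / K := mul_one _
          calc _ ≤ (K - 1) * (δ / K) + δ / K := by linarith
            _ = δ := by field_simp; ring
  · simp only [Set.mem_union, not_or] at hω
    obtain ⟨⟨hω1, hω2⟩, hω3⟩ := hω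
    rcases Nat.eq_zero_or_pos k with rfl | hkpos
    · refine ⟨⟨hfs, fun h q _ => ?_⟩, fun f _ h => ?_⟩
      · simp only [logLik, Finset.range_zero, Finset.sum_empty, zero_sub]
        rw [EReal.neg_le, neg_zero]
        exact_mod_cast hβ0.le
      · simpa using hβ0.le
    have hkm : k ∈ (Finset.range K).erase 0 :=
      Finset.mem_erase.2 ⟨hkpos.ne', Finset.mem_range.2 hk⟩
    refine ⟨⟨hfs, fun h q hq => ?_⟩, fun f hf h => ?_⟩
    · rw [R.logLik_sub_le_iff]
      refine prod_le_of_prod_div_le ENNReal.ofReal_ne_top (le_of_lt (not_le.1 fun hle => hω1 ?_))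
      simp only [E₁, Set.mem_iUnion]
      exact ⟨k, hkm, h, Finset.mem_univ h, q, hq, hle⟩
    · have hfF := hf.1
      have hfm := (htup f).2 hfF
      -- A member of the confidence set has nearly the best likelihood, in particular against its
      -- own Bellman image, which belongs to the class.
      have hlik := hf.2 h (img f h) (himgF f hfF h)
      rw [R.logLik_sub_le_iff] at hlik
      refine sum_le_of_prod_sqrt_lt (fun i hi h0 => hω3 ?_) hlik (not_le.1 fun hle => hω2 ?_)
      · simp only [E₃, Set.mem_iUnion]
        exact ⟨i, Finset.mem_range.2 (hi.trans hk), h, Finset.mem_univ h, f, hfm, h0⟩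
      · simp only [E₂, Set.mem_iUnion]
        exact ⟨k, hkm, h, Finset.mem_univ h, f, hfm, hle⟩

end ODiscoRun

end Good

/-! ### Choice of the scale s and the final constant. -/

section Optimization

/-- Use s = √(X/Y), which is at most 1 because X ≤ Y. -/
lemma le_of_forall_scale {r X Y E : ℝ} (hX : 0 < X) (hXY : X ≤ Y) (hE : E ≤ X)
    (h : ∀ s, 0 < s → s ≤ 1 → r ≤ s * Y + E / s) : r ≤ 2 * √(X * Y) := by
  have hY : 0 < Y := hX.trans_le hXY
  have h0 : 0 < √X := Real.sqrt_pos.2 hX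
  have h1 : 0 < √Y := Real.sqrt_pos.2 hY
  have hx : √X * √X = X := Real.mul_self_sqrt hX.le
  have hy : √Y * √Y = Y := Real.mul_self_sqrt hY.le
  refine (h (√X / √Y) (by positivity) ((div_le_one h1).2 (Real.sqrt_le_sqrt hXY))).trans ?_
  have e1 : √X / √Y * Y = √X * √Y := by
    rw [div_mul_eq_mul_div, div_eq_iff h1.ne']; nlinarith
  have e2 : E / (√X / √Y) ≤ √X * √Y := by
    rw [div_div_eq_mul_div, div_le_iff₀ h0]
    calc E * √Y ≤ X * √Y := mul_le_mul_of_nonneg_right hE h1.le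
      _ = √X * √Y * √X := by rw [← hx]; simp only [hx]; linear_combination (-√Y) * hx
  rw [Real.sqrt_mul hX.le]
  linarith

lemma le_secondOrderBound {H : ℕ} (hH : 0 < H) {r a V D β L E : ℝ} (ha : 0 < a) (hV : 0 ≤ V)
    (hD : 0 < D) (hβ : 0 < β) (hL : 0 < L) (hE : E ≤ 60 * a * H * D * β * L)
    (h : ∀ s, 0 < s → s ≤ 1 → r ≤ 2 * s * (6 * H * V + 18 * H ^ 2 * E) + E / s) :
    r ≤ 720 * secondOrderBound H a V D β L := by
  have hHr : (1 : ℝ) ≤ H := by exact_mod_cast hH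
  obtain ⟨T, hT⟩ : ∃ T, T = a * D * β * L := ⟨_, rfl⟩
  have hT0 : 0 < T := by rw [hT]; positivity
  have hE' : E ≤ 60 * H * T := hE.trans (le_of_eq (by rw [hT]; ring))
  have hH2 : (1 : ℝ) ≤ H ^ 2 := one_le_pow₀ hHr
  -- Here X = 60HT bounds E, and Y collects the coefficients of s with E replaced by X.
  have key : r ≤ 2 * √((60 * H * T) * (12 * H * V + 36 * H ^ 2 * (60 * H * T))) := by
    refine le_of_forall_scale (by positivity) ?_ hE' fun s hs hs1 => (h s hs hs1).trans ?_
    · have h1 : 0 ≤ 12 * H * V := by positivity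
      have h2 : 60 * H * T ≤ H ^ 2 * (60 * H * T) := le_mul_of_one_le_left (by positivity) hH2
      have h3 : 0 ≤ (H : ℝ) ^ 2 * (60 * H * T) := by positivity
      linarith
    · have : 36 * H ^ 2 * E ≤ 36 * H ^ 2 * (60 * H * T) :=
        mul_le_mul_of_nonneg_left hE' (by positivity)
      have := mul_le_mul_of_nonneg_left this hs.le
      linarith
  -- The product is 720 H²VT + 129600 H⁴T², and 129600 = 360²; doubling afterwards gives the
  -- constant 720.
  have hsplit : √((60 * H * T) * (12 * H * V + 36 * H ^ 2 * (60 * H * T))) ≤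
      360 * (H * √(V * T)) + 360 * (H ^ 2 * T) := by
    refine Real.sqrt_le_iff.2 ⟨by positivity, ?_⟩
    have hs : √(V * T) ^ 2 = V * T := Real.sq_sqrt (by positivity)
    have h1 : 0 ≤ H * √(V * T) * (H ^ 2 * T) := by positivity
    have h2 : 0 ≤ (H : ℝ) ^ 2 * (V * T) := by positivity
    have e : (360 * (H * √(V * T)) + 360 * (H ^ 2 * T)) ^ 2 =
        129600 * (H ^ 2 * (V * T)) + 259200 * (H * √(V * T) * (H ^ 2 * T)) +
          129600 * (H ^ 2 * T) ^ 2 := by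
      linear_combination 129600 * (H : ℝ) ^ 2 * hs
    rw [e]
    nlinarith
  have hpow : (H : ℝ) ^ 2 ≤ (H : ℝ) ^ (5 / 2 : ℝ) := by
    rw [← Real.rpow_natCast]
    exact Real.rpow_le_rpow_of_exponent_le hHr (by norm_num)
  have hpow' : (H : ℝ) ^ 2 * T ≤ (H : ℝ) ^ (5 / 2 : ℝ) * T :=
    mul_le_mul_of_nonneg_right hpow hT0.le
  have e : secondOrderBound H a V D β L = H * √(V * T) + (H : ℝ) ^ (5 / 2 : ℝ) * T := by
    rw [secondOrderBound, hT]
    congr 1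
    · congr 2; ring
    · ring
  rw [e]
  linarith

end Optimization

/-! ### Accumulated Bellman errors via the two eluder dimensions. -/

section ErrorBound

variable {X A : Type*} [MeasurableSpace X] [MeasurableSpace A] {lam : Measure ℝ} {H : ℕ}
  [SigmaFinite lam] {M : MDP X A} {am : ArgminRule A} {F : Fin H → Finset (CondDens X A lam)}
  {K : ℕ} {Pol : Set (Policy X A)} {f : ℕ → Fin H → CondDens X A lam} {x : ℕ → X} {B β : ℝ} {d : ℕ}

lemma errorSum_eq_zero {f : Fin H → CondDens X A lam} (hf : IsBellmanImage M am f f) (x : X) :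
    errorSum M am f x = 0 := by
  simp [errorSum, bellmanError_eq hf, triDens]

/-- If the class is not a singleton, the threshold dominates the additive constant of the eluder
argument; if it is, there are no Bellman errors at all. -/
lemma sum_errorSum_le (hF : ∀ h, (F h).Nonempty) (hβ : 0 < β)
    (hlog : Real.log ((∏ h, (F h).card : ℕ) : ℝ) ≤ β) {fs : Fin H → CondDens X A lam} (hfs : fs ∈ tuples F)
    (hfix : IsBellmanImage M am fs fs) (hf : ∀ k < K, f k ∈ tuples F) {a D L : ℝ} (ha : 0 ≤ a)
    (hD : 0 ≤ D) (hL : 0 ≤ L)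
    (h : ∑ k ∈ Finset.range K, errorSum M am (f k) (x k) ≤
      H * (a * (4 * (10 * β + 3) * D * L))) :
    ∑ k ∈ Finset.range K, errorSum M am (f k) (x k) ≤ 60 * a * H * D * β * L := by
  rcases (one_le_prod_card hF).eq_or_lt with h1 | h1
  · have hcard : ∀ h, (F h).card ≤ 1 := fun h => h1 ▸ card_le_prod_card hF h
    have heq : ∀ k < K, f k = fs := fun k hk =>
      funext fun h => Finset.card_le_one.1 (hcard h) _ (hf k hk h) _ (hfs h)
    rw [Finset.sum_eq_zero fun k hk => by
      rw [heq k (Finset.mem_range.1 hk), errorSum_eq_zero hfix]]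
    positivity
  -- With at least two tuples, β ≥ log 2 > 0.6, which is what 4(10β + 3) ≤ 60β requires.
  · have h2 : (2 : ℝ) ≤ ((∏ h, (F h).card : ℕ) : ℝ) := by exact_mod_cast h1
    have h3 : Real.log 2 ≤ β := (Real.log_le_log two_pos h2).trans hlog
    have h4 := Real.log_two_gt_d9
    refine h.trans ?_
    calc (H : ℝ) * (a * (4 * (10 * β + 3) * D * L))
        = (H * a * D * L) * (4 * (10 * β + 3)) := by ring
      _ ≤ (H * a * D * L) * (60 * β) :=
          mul_le_mul_of_nonneg_left (by linarith) (by positivity)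
      _ = _ := by ring

variable [Fintype A]

variable (M am) in
/-- The average of the Bellman error over the actions. -/
def avgError (f : Fin H → CondDens X A lam) (h : Fin H) (x : X) : ℝ :=
  (∑ a : A, bellmanError M am f h (x, a)) / (Fintype.card A : ℝ)

lemma bddMeas_avgError {f g : Fin H → CondDens X A lam} (hg : IsBellmanImage M am f g)
    (h : Fin H) : BddMeas (avgError M am f h) := by
  have : BddMeas (fun x => (Fintype.card A : ℝ)⁻¹ * ∑ a : A, bellmanError M am f h (x, a)) :=
    (BddMeas.const _).mul
      (BddMeas.sum _ fun a _ => (bddMeas_bellmanError hg h).comp measurable_prodMk_right)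
  refine (funext fun x => ?_ : _ = avgError M am f h) ▸ this
  rw [avgError, div_eq_inv_mul]

lemma avgError_nonneg {f g : Fin H → CondDens X A lam} (hg : IsBellmanImage M am f g)
    (h : Fin H) (x : X) : 0 ≤ avgError M am f h x :=
  div_nonneg (Finset.sum_nonneg fun _ _ => bellmanError_nonneg hg h _) (Nat.cast_nonneg _)

lemma avgError_le_two [Nonempty A] {f g : Fin H → CondDens X A lam} (hg : IsBellmanImage M am f g)
    (h : Fin H) (x : X) : avgError M am f h x ≤ 2 := by
  have hA : (0 : ℝ) < Fintype.card A := by exact_mod_cast Fintype.card_pos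
  rw [avgError, div_le_iff₀ hA]
  refine (Finset.sum_le_card_nsmul _ _ 2 fun a _ => bellmanError_le_two hg h (x, a)).trans
    (le_of_eq ?_)
  rw [nsmul_eq_mul, Finset.card_univ, mul_comm]

lemma bellmanError_le_card_mul [Nonempty A] {f g : Fin H → CondDens X A lam} (hg : IsBellmanImage M am f g)
    (h : Fin H) (x : X) (a : A) :
    bellmanError M am f h (x, a) ≤ Fintype.card A * avgError M am f h x := by
  have hA : (Fintype.card A : ℝ) ≠ 0 := by exact_mod_cast Fintype.card_ne_zero
  rw [avgError, mul_div_cancel₀ _ hA]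
  exact Finset.single_le_sum (f := fun a => bellmanError M am f h (x, a))
    (fun b _ => bellmanError_nonneg hg h _) (Finset.mem_univ a)

lemma integral_explore_true [Nonempty A] [MeasurableSingletonClass A] {f g : Fin H → CondDens X A lam}
    (hg : IsBellmanImage M am f g) (h : Fin H) (π : Policy X A) (x : X) :
    ∫ xa, bellmanError M am f h xa ∂(M.explore true π h x) =
      ∫ x', avgError M am f h x' ∂(M.stateOcc π h x) := by
  have hb := bddMeas_bellmanError hg h
  rw [MDP.explore, if_pos rfl, integral_kernel_comp hb]
  congr 1
  ext x'
  rw [integral_id_prod hb.measurable, Kernel.const_apply, PMF.integral_eq_sum, avgError, Finset.sum_div]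
  refine Finset.sum_congr rfl fun a _ => ?_
  simp [PMF.uniformOfFintype_apply, div_eq_inv_mul]

/-- Errors are nonnegative, so the greedy action's error is at most the sum over all actions, which
is A times their average. This is the only loss from exploring uniformly. -/
lemma integral_occ_le_card_mul [Nonempty A] {f g : Fin H → CondDens X A lam} (hg : IsBellmanImage M am f g)
    (h : Fin H) (x : X) :
    ∫ xa, bellmanError M am f h xa ∂(M.occ (greedyPolicy am f) h x) ≤
      Fintype.card A * ∫ x', avgError M am f h x' ∂(M.stateOcc (greedyPolicy am f) h x) := by
  have hb := bddMeas_bellmanError hg h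
  rw [integral_occ_greedy M am f hb, stateOcc_eq, ← integral_const_mul]
  exact integral_mono ((hb.comp (measurable_graph_greedyAct am _)).integrable _)
    (((BddMeas.const _).mul (bddMeas_avgError hg h)).integrable _)
    fun x' => bellmanError_le_card_mul hg h x' _

lemma abs_integral_le_two {S : Type*} [MeasurableSpace S] {μ : Measure S} [IsProbabilityMeasure μ]
    {φ : S → ℝ} (hφ : BddMeas φ) (h0 : ∀ s, 0 ≤ φ s) (h2 : ∀ s, φ s ≤ 2) :
    |∫ s, φ s ∂μ| ≤ 2 := by
  rw [abs_of_nonneg (integral_nonneg h0)]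
  calc ∫ s, φ s ∂μ ≤ ∫ _, (2 : ℝ) ∂μ := integral_mono (hφ.integrable _) (integrable_const _) h2
    _ = 2 := by simp

/-- Bellman errors that are small on the past data are summable, in terms of the Q-type
dimension. -/
lemma sum_errorSum_le_dimQ [Nonempty A] (hK : 0 < K) (hPol : ∀ f ∈ tuples F, greedyPolicy am f ∈ Pol)
    (hc : BellmanComplete M Pol F) (hd : dimQ M am Pol F (1 / (K : ℝ)) = d)
    (hf : ∀ k < K, f k ∈ tuples F) (hB : 0 ≤ B)
    (hrow : ∀ k < K, ∀ h, ∑ i ∈ Finset.range k, ∫ xa, bellmanError M am (f k) h xa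
      ∂(M.explore false (greedyPolicy am (f i)) h (x i)) ≤ B) :
    ∑ k ∈ Finset.range K, errorSum M am (f k) (x k) ≤
      H * (4 * (B + 3) * ((max 1 d : ℕ) : ℝ) * (1 + Real.log K)) := by
  have himg := fun k hk => exists_isBellmanImage hPol hc (hf k hk)
  choose g hgF hg using himg
  have habs : ∀ k < K, ∀ h (μ : Measure (X × A)), |∫ xa, bellmanError M am (f k) h xa ∂μ| =
      ∫ xa, bellmanError M am (f k) h xa ∂μ := fun k hk h μ =>
    abs_of_nonneg (integral_nonneg fun xa => bellmanError_nonneg (hg k hk) h xa)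
  have key : ∀ h : Fin H, ∑ k ∈ Finset.range K,
      ∫ xa, bellmanError M am (f k) h xa ∂(M.occ (greedyPolicy am (f k)) h (x k)) ≤
      4 * (B + 3) * ((max 1 d : ℕ) : ℝ) * (1 + Real.log K) := by
    intro h
    refine le_trans (le_of_eq (Finset.sum_congr rfl fun k hk =>
      (habs k (Finset.mem_range.1 hk) h _).symm))
      (sum_le_of_eluderDim (μ := fun k => M.occ (greedyPolicy am (f k)) h (x k))
      (ψ := fun k => bellmanError M am (f k) h) hK
      ((le_iSup (fun h : Fin H => eluderDim {ψ | ∃ f ∈ tuples F, ψ = bellmanError M am f h}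
        {μ | ∃ π ∈ Pol, ∃ x₁ : X, μ = M.occ π h x₁} (1 / (K : ℝ))) h).trans hd.le)
      (fun k hk => ⟨f k, hf k hk, rfl⟩) (fun k hk => ⟨_, hPol _ (hf k hk), x k, rfl⟩) hB
      (fun k hk => ?_) fun k hk => abs_integral_le_two (bddMeas_bellmanError (hg k hk) h)
        (bellmanError_nonneg (hg k hk) h) (bellmanError_le_two (hg k hk) h))
    simp only [habs k hk]
    exact hrow k hk h
  simp only [errorSum]
  rw [Finset.sum_comm]
  refine (Finset.sum_le_card_nsmul _ _ _ fun h _ => key h).trans (le_of_eq ?_)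
  rw [nsmul_eq_mul, Finset.card_univ, Fintype.card_fin]

/-- Bellman errors that are small on the past data with uniform actions are summable, in terms of
the V-type dimension. -/
lemma sum_errorSum_le_dimV [Nonempty A] [MeasurableSingletonClass A] (hK : 0 < K)
    (hPol : ∀ f ∈ tuples F, greedyPolicy am f ∈ Pol)
    (hc : BellmanComplete M Pol F) (hd : dimV M am Pol F (1 / (K : ℝ)) = d)
    (hf : ∀ k < K, f k ∈ tuples F) (hB : 0 ≤ B)
    (hrow : ∀ k < K, ∀ h, ∑ i ∈ Finset.range k, ∫ xa, bellmanError M am (f k) h xa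
      ∂(M.explore true (greedyPolicy am (f i)) h (x i)) ≤ B) :
    ∑ k ∈ Finset.range K, errorSum M am (f k) (x k) ≤
      H * (Fintype.card A * (4 * (B + 3) * ((max 1 d : ℕ) : ℝ) * (1 + Real.log K))) := by
  have himg := fun k hk => exists_isBellmanImage hPol hc (hf k hk)
  choose g hgF hg using himg
  have habs : ∀ k < K, ∀ h (μ : Measure X), |∫ s, avgError M am (f k) h s ∂μ| =
      ∫ s, avgError M am (f k) h s ∂μ := fun k hk h μ =>
    abs_of_nonneg (integral_nonneg fun xa => avgError_nonneg (hg k hk) h xa)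
  have key : ∀ h : Fin H, ∑ k ∈ Finset.range K,
      ∫ xa, bellmanError M am (f k) h xa ∂(M.occ (greedyPolicy am (f k)) h (x k)) ≤
      Fintype.card A * (4 * (B + 3) * ((max 1 d : ℕ) : ℝ) * (1 + Real.log K)) := by
    intro h
    refine (Finset.sum_le_sum fun k hk =>
      integral_occ_le_card_mul (hg k (Finset.mem_range.1 hk)) h (x k)).trans ?_
    rw [← Finset.mul_sum]
    refine mul_le_mul_of_nonneg_left ?_ (Nat.cast_nonneg _)
    refine le_trans (le_of_eq (Finset.sum_congr rfl fun k hk =>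
      (habs k (Finset.mem_range.1 hk) h _).symm))
      (sum_le_of_eluderDim (μ := fun k => M.stateOcc (greedyPolicy am (f k)) h (x k))
      (ψ := fun k => avgError M am (f k) h) hK
      ((le_iSup (fun h : Fin H => eluderDim {ψ | ∃ f ∈ tuples F, ψ = avgError M am f h}
        {μ | ∃ π ∈ Pol, ∃ x₁ : X, μ = M.stateOcc π h x₁} (1 / (K : ℝ))) h).trans hd.le)
      (fun k hk => ⟨f k, hf k hk, rfl⟩) (fun k hk => ⟨_, hPol _ (hf k hk), x k, rfl⟩) hB
      (fun k hk => ?_) fun k hk => abs_integral_le_two (bddMeas_avgError (hg k hk) h)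
        (avgError_nonneg (hg k hk) h) (avgError_le_two (hg k hk) h))
    simp only [habs k hk]
    have := hrow k hk h
    simp only [integral_explore_true (hg k hk) h] at this
    exact this
  simp only [errorSum]
  rw [Finset.sum_comm]
  refine (Finset.sum_le_card_nsmul _ _ _ fun h _ => key h).trans (le_of_eq ?_)
  rw [nsmul_eq_mul, Finset.card_univ, Fintype.card_fin]

end ErrorBound

/-! ### The uniform mixture of the policies played. -/

section Mixture

variable {X A : Type*} [MeasurableSpace X] [MeasurableSpace A] {H K : ℕ}

lemma integrable_ret (M : MDP X A) (π : Policy X A) (H : ℕ) (x : X) :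
    Integrable ret (M.roll π H 0 x) :=
  ((BddMeas.sum _ fun h _ => (bddMeas_clamp zero_le_one).comp (by fun_prop)).integrable _).congr
    (Filter.EventuallyEq.symm (ae_ret_eq M π H x))

lemma card_mul_mixtureValue (M : MDP X A) (hK : 0 < K) (π : ℕ → Policy X A) (x : X) :
    (K : ℝ) * M.mixtureValue H K π x = ∑ k ∈ Finset.range K, M.value H (π k) x := by
  have hKr : (K : ℝ) ≠ 0 := by exact_mod_cast hK.ne'
  rw [MDP.mixtureValue, integral_smul_measure,
    integral_finsetSum_measure fun k _ => integrable_ret M (π k) H x]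
  simp only [ENNReal.toReal_inv, ENNReal.toReal_natCast, smul_eq_mul]
  rw [mul_inv_cancel_left₀ hKr]
  rfl

end Mixture

/-! ### Optimism and the regret bound. -/

section Regret

variable {X A : Type*} [MeasurableSpace X] [MeasurableSpace A] {lam : Measure ℝ} {H : ℕ}
  [SigmaFinite lam] [Fintype A] [Nonempty A] {Ω : Type*} [mΩ : MeasurableSpace Ω]
  {Pr : Measure Ω} {M : MDP X A}
  {am : ArgminRule A} {F : Fin H → Finset (CondDens X A lam)} {K : ℕ} {uae : Bool}
  {Pol : Set (Policy X A)} {β : ℝ}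

lemma ODiscoRun.sumVar_nonneg (R : ODiscoRun Pr M am F β K uae) (ω : Ω) : 0 ≤ R.sumVar ω :=
  Finset.sum_nonneg fun _ _ => variance_nonneg _ _

/-- By optimism, the regret is at most the sum of the prediction gaps of the selected tuples. -/
lemma ODiscoRun.regret_le (R : ODiscoRun Pr M am F β K uae) (hH : 0 < H)
    (hlam : lam (Set.Icc (0 : ℝ) 1)ᶜ = 0) (hPol : ∀ f ∈ tuples F, greedyPolicy am f ∈ Pol)
    (hc : BellmanComplete M Pol F) {fs : Fin H → CondDens X A lam}
    (hfix : IsBellmanImage M am fs fs) {ω : Ω}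
    (hmem : ∀ k < K, fs ∈ confSet F β (fun i => R.data i ω) (fun i => R.y i ω) k)
    {s : ℝ} (hs : 0 < s) (hs1 : s ≤ 1) :
    R.regret ω ≤ 2 * s * (6 * H * R.sumVar ω +
      18 * H ^ 2 * ∑ k ∈ Finset.range K, errorSum M am (R.sel k ω) (R.x₁ k ω)) +
      (∑ k ∈ Finset.range K, errorSum M am (R.sel k ω) (R.x₁ k ω)) / s := by
  -- One s serves all episodes, so the per-episode bounds add up and s can be optimised against the
  -- total variance.
  have e : 2 * s * (6 * H * R.sumVar ω +
      18 * H ^ 2 * ∑ k ∈ Finset.range K, errorSum M am (R.sel k ω) (R.x₁ k ω)) +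
      (∑ k ∈ Finset.range K, errorSum M am (R.sel k ω) (R.x₁ k ω)) / s =
      ∑ k ∈ Finset.range K, (2 * s * (6 * H * M.returnVar H (R.pol k ω) (R.x₁ k ω) +
        18 * H ^ 2 * errorSum M am (R.sel k ω) (R.x₁ k ω)) +
        errorSum M am (R.sel k ω) (R.x₁ k ω) / s) := by
    rw [ODiscoRun.sumVar, Finset.sum_add_distrib, ← Finset.mul_sum, Finset.sum_add_distrib,
      ← Finset.mul_sum, ← Finset.mul_sum, Finset.sum_div]
  rw [e, ODiscoRun.regret]
  refine Finset.sum_le_sum fun k hk => ?_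
  have hk := Finset.mem_range.1 hk
  obtain ⟨g, -, hg⟩ := exists_isBellmanImage hPol hc (R.sel_mem k hk ω)
  have h1 := value_sub_potential_le hH hlam hg (R.x₁ k ω) hs hs1
  -- Optimism: the prediction of the selected tuple is at most that of the fixed point, which is at
  -- most the optimal value.
  have h2 := (R.sel_optimistic k hk ω ⟨fs, hmem k hk⟩).2 fs (hmem k hk)
  rw [optimisticValue_eq am, optimisticValue_eq am] at h2
  have h3 := potential_le_optValue hlam hfix (R.x₁ k ω)
  exact le_trans (by simp only [ODiscoRun.pol]; linarith) h1

lemma ODiscoRun.card_mul_mixture_eq_regret (R : ODiscoRun Pr M am F β K uae) (hK : 0 < K) {ω : Ω}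
    {x : X} (hx : ∀ k < K, R.x₁ k ω = x) :
    (K : ℝ) * (M.mixtureValue H K (fun k => R.pol k ω) x - M.optValue H x) = R.regret ω := by
  rw [mul_sub, card_mul_mixtureValue M hK, ODiscoRun.regret, Finset.sum_sub_distrib]
  congr 1
  · exact Finset.sum_congr rfl fun k hk => by rw [hx k (Finset.mem_range.1 hk)]
  · rw [Finset.sum_congr rfl fun k hk => by rw [hx k (Finset.mem_range.1 hk)],
      Finset.sum_const, Finset.card_range, nsmul_eq_mul]

/-- With probability at least `1 - δ` the regret obeys the second-order bound, provided that
past confidence turns into small accumulated Bellman errors. -/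
theorem ODiscoRun.measure_regret_le [IsProbabilityMeasure Pr] {δ a D L : ℝ} (hH : 0 < H)
    (hK : 0 < K) (hlam : lam (Set.Icc (0 : ℝ) 1)ᶜ = 0) (hF : ∀ h, (F h).Nonempty)
    (hPol : ∀ f ∈ tuples F, greedyPolicy am f ∈ Pol) (hc : BellmanComplete M Pol F)
    (hδ : 0 < δ) (hδ1 : δ < 1) (hβ : β = threshold F K δ) (R : ODiscoRun Pr M am F β K uae)
    (ha : 0 < a) (hD : 0 < D) (hL : 0 < L)
    (herr : ∀ ω, (∀ k < K, ∀ h, ∑ i ∈ Finset.range k, R.explError (R.sel k ω) h i ω ≤ 10 * β) →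
      ∑ k ∈ Finset.range K, errorSum M am (R.sel k ω) (R.x₁ k ω) ≤
        H * (a * (4 * (10 * β + 3) * D * L))) :
    Pr {ω | ¬ R.regret ω ≤ 720 * secondOrderBound H a (R.sumVar ω) D β L} ≤
      ENNReal.ofReal δ := by
  obtain ⟨fs, hfs, hfix⟩ := exists_fixedPoint hF hPol hc
  obtain ⟨bad, hbad, hgood⟩ := R.exists_good_event hH hK hF hPol hc hδ hδ1 hβ hfs hfix
  refine (measure_mono fun ω hω => ?_).trans hbad
  by_contra hnot
  refine hω ?_
  have hg := hgood ω hnot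
  have hsel : ∀ k < K, R.sel k ω ∈ confSet F β (fun i => R.data i ω) (fun i => R.y i ω) k :=
    fun k hk => (R.sel_optimistic k hk ω ⟨fs, (hg k hk).1⟩).1
  have hE := herr ω fun k hk => (hg k hk).2 _ (hsel k hk)
  have hβ0 := log_prod_card_le_threshold hH hK hF hδ hδ1
  rw [← hβ] at hβ0
  have hE' := sum_errorSum_le hF hβ0.1 hβ0.2 hfs hfix (fun k hk => R.sel_mem k hk ω)
    ha.le hD.le hL.le hE
  exact le_secondOrderBound hH ha (R.sumVar_nonneg ω) hD hβ0.1 hL hE' fun s hs hs1 =>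
    R.regret_le hH hlam hPol hc hfix (fun k hk => (hg k hk).1) hs hs1

end Regret

end DistRL

end

theorem mainTheorem1 :
    ∃ c : ℝ, 0 < c ∧
      ∀ (X : Type u) (A : Type v) (Ω : Type w) [MeasurableSpace X]
        [Fintype A] [Nonempty A] [MeasurableSpace A] [MeasurableSingletonClass A]
        [MeasurableSpace Ω] (Pr : Measure Ω) [IsProbabilityMeasure Pr]
        (lam : Measure ℝ) [SigmaFinite lam] (_ : lam (Set.Icc (0 : ℝ) 1)ᶜ = 0)
        (H K : ℕ) (_ : 0 < H) (_ : 0 < K)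
        (M : MDP X A) (_ : M.Normalized H) (am : ArgminRule A)
        (F : Fin H → Finset (CondDens X A lam)) (_ : ∀ h, (F h).Nonempty)
        (Pol : Set (Policy X A)) (_ : ∀ f ∈ tuples F, greedyPolicy am f ∈ Pol)
        (_ : BellmanComplete M Pol F)
        (δ : ℝ) (_ : 0 < δ) (_ : δ < 1),
        -- without uniform action exploration
        (∀ (R : ODiscoRun Pr M am F (threshold F K δ) K false)
          (d : ℕ), dimQ M am Pol F (1 / (K : ℝ)) = d →
          Pr {ω | ¬ R.regret ω ≤ c * secondOrderBound H 1 (R.sumVar ω) ((max 1 d : ℕ) : ℝ)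
              (threshold F K δ) (1 + Real.log K)} ≤ ENNReal.ofReal δ) ∧
        -- with uniform action exploration
        (∀ (R : ODiscoRun Pr M am F (threshold F K δ) K true)
          (d : ℕ), dimV M am Pol F (1 / (K : ℝ)) = d →
          Pr {ω | ¬ (
              R.regret ω ≤ c * secondOrderBound H (Fintype.card A) (R.sumVar ω)
                ((max 1 d : ℕ) : ℝ) (threshold F K δ) (1 + Real.log K) ∧
              ∀ x : X, (∀ k < K, R.x₁ k ω = x) →
                (K : ℝ) * (M.mixtureValue H K (fun k => R.pol k ω) x - M.optValue H x) ≤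
                  c * secondOrderBound H (Fintype.card A) (R.sumVar ω)
                    ((max 1 d : ℕ) : ℝ) (threshold F K δ) (1 + Real.log K))}
            ≤ ENNReal.ofReal δ) := by
  refine ⟨720, by norm_num, fun X A Ω _ _ _ _ _ _ Pr _ lam _ hlam H K hH hK M _ am F hF Pol hPol hc
    δ hδ hδ1 => ?_⟩
  have hL : (0 : ℝ) < 1 + Real.log K :=
    add_pos_of_pos_of_nonneg one_pos (Real.log_natCast_nonneg K)
  have hB : 0 ≤ 10 * threshold F K δ := by
    have := (log_prod_card_le_threshold hH hK hF hδ hδ1).1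
    positivity
  have hD : ∀ d : ℕ, (0 : ℝ) < ((max 1 d : ℕ) : ℝ) := fun d =>
    Nat.cast_pos.2 (lt_max_of_lt_left one_pos)
  refine ⟨fun R d hd => ?_, fun R d hd => ?_⟩
  · refine R.measure_regret_le hH hK hlam hF hPol hc hδ hδ1 rfl one_pos (hD d) hL fun ω hω => ?_
    rw [one_mul]
    exact sum_errorSum_le_dimQ hK hPol hc hd (fun k hk => R.sel_mem k hk ω) hB hω
  · refine (measure_mono fun ω hω => ?_).trans
      (R.measure_regret_le hH hK hlam hF hPol hc hδ hδ1 rfl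
        (Nat.cast_pos.2 (Fintype.card_pos (α := A))) (hD d) hL fun ω hω =>
        sum_errorSum_le_dimV hK hPol hc hd (fun k hk => R.sel_mem k hk ω) hB hω)
    -- For a common initial state, K times the mixture gap is the regret itself, so no further event
    -- is needed.
    refine fun h => hω ⟨h, fun x hx => ?_⟩
    rw [R.card_mul_mixture_eq_regret hK hx]
    exact h
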